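/- **Setting.** Let $M$ be an episodic MDP with horizon $H\ge 1$, countable state and action spaces $\mathcal X,\mathcal A$, transitions $P_h$, reward distributions $R_h$ supported in $[0,1]$, initial law $d_1$, and $\sum_h r_h\in[0,1]$ almost surely under every policy. Write $J(\pi)$ for the expected total reward, $V^\pi_h,Q^\pi_h$ for the value functions, and $d_h^\pi(x,a)=\mathbb P^\pi[x_h=x,a_h=a]$. Let $\mathcal F$ be a finite class of functions $\mathcal X\times\mathcal A\times[H]\to[0,1]$, let $\pi_f$ be a greedy policy of $f\in\mathcal F$ (maxima attained, a fixed tie-breaking rule), and $\Pi=\{\pi_f: f\in\mathcal F\}$. Let $\pi^\star\in\Pi$ be an optimal policy, i.e. one maximizing $V_h^\pi(x)$ over all randomized policies $\pi$ for all $h,x$, and suppose $Q^\star=Q^{\pi^\star}\in\mathcal F$. Let $\mathcal W$ be a finite non-empty class of functions $\mathcal X\times\mathcal A\times[H]\to[0,\infty]$. Ratios use the conventions $x/0=\infty$ for $x>0$ and $0/0=1$. Put $$C_{\rm cov}=\inf_{\mu_1,\dots,\mu_H\in\Delta(\mathcal X\times\mathcal A)}\ \sup_{\pi\in\Pi,\,h\in[H]}\|d_h^\pi/\mu_h\|_\infty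 .$$ Let $\nu=(\nu_h)_{h\le H}$ be an offline data distribution with $\max_h\|d_h^{\pi^\star}/\nu_h\|_\infty\le C_\star$. Let $\varepsilon>0$, $\delta\in(0,1)$, $C=C_{\rm cov}+C_\star$, $L=\log(|\mathcal F||\mathcal W|/\delta)$ and $\ell=\log(e+HCL/\varepsilon)$. **HyGlow** with $T$ rounds and scale $\gamma$. It is given, for each layer $h$, $T$ independent offline samples $(x_h,a_h,r_h,x_{h+1})$ with $(x_h,a_h)\sim\nu_h$, $r_h\sim R_h(x_h,a_h)$, $x_{h+1}\sim P_h(x_h,a_h)$. In round $t=1,\dots,T$ let $\widehat{\mathbb E}_{t,h}$ be the empirical mean, at layer $h$, over the first $t-1$ offline samples and the $t-1$ trajectories collected so far (zero if $t=1$). The algorithm picks any $$f^{(t)}\in\operatorname*{argmin}_{f\in\mathcal F}\max_{w\in\overline{\mathcal W}}\sum_{h=1}^H\Big(\big|\widehat{\mathbb E}_{t,h}[\check w_h(x,a)(f_h(x,a)-r-\max_{a'}f_{h+1}(x',a'))]\big|-\tfrac{8}{\gamma t}\widehat{\mathbb E}_{t,h}[\check w_h(x,a)^2]\Big),\qquad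 f_{H+1}=0,$$ and collects one trajectory with $\pi^{(t)}=\pi_{f^{(t)}}$. Here $\check w=\min\{w,\gamma t\}$ for $w\ge0$, extended by $(-w)^{\vee}=-\check w$; $\overline{\mathcal W}=\mathcal W\cup(-\mathcal W)\cup\bigcup_{h}(\mathcal W^{(h)}\cup(-\mathcal W^{(h)}))$, where $\mathcal W^{(h)}$ consists of the functions of $\mathcal W$ set to zero at all layers other than $h$. The output is $\widehat\pi=\mathrm{Unif}(\pi^{(1)},\dots,\pi^{(T)})$; it is $\varepsilon$-suboptimal if $J(\pi^\star)-\frac1T\sum_{t}J(\pi^{(t)})\le\varepsilon$. The number of collected trajectories is $N=T$. **Realizability up to $T$.** For $t\in[T]$ and $\pi^{(1)},\dots,\pi^{(t)}\in\Pi$ put $\mu^{(t)}_h=\frac12\big(\nu_h+\frac1t\sum_{i\le t}d_h^{\pi^{(i)}}\big)$. *Layerwise*: for all such $t$ and $\pi^{(1:t)}$, all $\pi\in\Pi$ and $h\in[H]$, $d_h^\pi/\mu_h^{(t)}\in\mathcal W_h=\{w_h:w\in\mathcal W\}$. *Joint*: for all such $t$, $\pi^{(1:t)}$ and $\pi\in\Pi$,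 the function $(x,a,h)\mapsto d_h^\pi(x,a)/\mu_h^{(t)}(x,a)$ is in $\mathcal W$. **Theorem.** There are universal constants $c>0$ and $p\in\mathbb N$ such that, in the setting above: 1. if $T=\big\lceil c\,\frac{H^4C}{\varepsilon^2}L\,\ell^p\big\rceil$, $\gamma=\sqrt{C/(TH^2L)}$, and layerwise realizability holds up to $T$, then HyGlow returns an $\varepsilon$-suboptimal policy with probability at least $1-\delta T$ (after $N=T$ trajectories); 2. if $T=\big\lceil c\,\frac{H^2C}{\varepsilon^2}L\,\ell^p\big\rceil$, $\gamma=\sqrt{C/(TL)}$, and joint realizability holds up to $T$, then HyGlow returns an $\varepsilon$-suboptimal policy with probability at least $1-\delta T$. Thus $N=T=\widetilde O\big(\frac{H^2(C_{\rm cov}+C_\star)}{\varepsilon^2}\log\frac{|\mathcal F||\mathcal W|}{\delta}\big)$ trajectories suffice. -/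

import Mathlib

open MeasureTheory ProbabilityTheory
open scoped ENNReal BigOperators

universe v u₁ u₂

namespace HybridRL

noncomputable section

/-- One transition `((x_h, a_h), (r_h, x_{h+1}))`. -/
abbrev Transition (X A : Type*) := (X × A) × (ℝ × X)

/-- An episodic Markov decision process with horizon `H`. Layers are numbered `0, …, H - 1`.
The state produced by the transition at the last layer plays the role of the terminal state; it
carries no reward and no value. -/
structure MDP (X A : Type*) [MeasurableSpace X] [MeasurableSpace A] (H : ℕ) where
  /-- initial state distribution -/
  init : Measure X
  /-- transition distributions -/
  P : Fin H → Kernel (X × A) X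
  /-- reward distributions -/
  R : Fin H → Kernel (X × A) ℝ
  init_prob : IsProbabilityMeasure init
  P_markov : ∀ h, IsMarkovKernel (P h)
  R_markov : ∀ h, IsMarkovKernel (R h)
  R_mem : ∀ h z, ∀ᵐ r ∂(R h z), r ∈ Set.Icc (0 : ℝ) 1

attribute [instance] MDP.init_prob MDP.P_markov MDP.R_markov

/-- A randomized (Markov) policy. -/
structure Policy (X A : Type*) [MeasurableSpace X] [MeasurableSpace A] (H : ℕ) where
  act : Fin H → Kernel X A
  markov : ∀ h, IsMarkovKernel (act h)

attribute [instance] Policy.markov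

/-- A deterministic policy. -/
abbrev DetPolicy (X A : Type*) (H : ℕ) := Fin H → X → A

/-- A candidate state-action value function `(h, x, a) ↦ f_h(x, a)`. -/
abbrev ValueFn (X A : Type*) (H : ℕ) := Fin H → X → A → ℝ

/-- A nonnegative, possibly infinite, weight function `(h, x, a) ↦ w_h(x, a)`. -/
abbrev WeightFn (X A : Type*) (H : ℕ) := Fin H → X → A → ℝ≥0∞

/-- A signed, possibly infinite, weight function. -/
abbrev SignedWeightFn (X A : Type*) (H : ℕ) := Fin H → X → A → EReal

section Dynamics

variable {X A : Type*} [MeasurableSpace X] [MeasurableSpace A] {H : ℕ}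

/-- A deterministic policy on a discrete state space, as a randomized policy. -/
def DetPolicy.toPolicy [DiscreteMeasurableSpace X] (π : DetPolicy X A H) : Policy X A H where
  act h := Kernel.deterministic (π h) Measurable.of_discrete
  markov _ := inferInstance

/-- Law of the pair (reward, next state) given the state-action pair: `r ∼ R_h(x, a)` and
`x' ∼ P_h(x, a)`. -/
def MDP.trans (M : MDP X A H) (h : Fin H) : Kernel (X × A) (ℝ × X) := M.R h ×ₖ M.P h

instance (M : MDP X A H) (h : Fin H) : IsMarkovKernel (M.trans h) := by
  unfold MDP.trans; infer_instance

/-- Law of the transition at layer `h` under `π`, given the state at layer `h`. -/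
def MDP.step (M : MDP X A H) (π : Policy X A H) (h : Fin H) : Kernel X (Transition X A) :=
  (Kernel.id ×ₖ π.act h) ⊗ₖ Kernel.prodMkLeft X (M.trans h)

instance (M : MDP X A H) (π : Policy X A H) (h : Fin H) : IsMarkovKernel (M.step π h) := by
  unfold MDP.step; infer_instance

/-- Law of the last `n` transitions (layers `H - n, …, H - 1`) under `π`, given the state at layer
`H - n`. -/
def MDP.rollout (M : MDP X A H) (π : Policy X A H) :
    (n : ℕ) → n ≤ H → Kernel X (Fin n → Transition X A)
  | 0, _ => Kernel.const X (Measure.dirac Fin.elim0)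
  | n + 1, hn =>
      ((M.step π ⟨H - (n + 1), by omega⟩) ⊗ₖ
          Kernel.prodMkLeft X ((M.rollout π n (by omega)).comap
            (fun s : Transition X A => s.2.2) (measurable_snd.comp measurable_snd))).map
        (fun q : Transition X A × (Fin n → Transition X A) =>
          (Fin.cons q.1 q.2 : Fin (n + 1) → Transition X A))

theorem measurable_cons_transition (n : ℕ) :
    Measurable (fun q : Transition X A × (Fin n → Transition X A) =>
      (Fin.cons q.1 q.2 : Fin (n + 1) → Transition X A)) := by
  refine measurable_pi_lambda _ (fun i => ?_)
  refine Fin.cases ?_ (fun j => ?_) i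
  · simpa using measurable_fst
  · exact (measurable_pi_apply j).comp measurable_snd

instance (M : MDP X A H) (π : Policy X A H) (n : ℕ) (hn : n ≤ H) :
    IsMarkovKernel (M.rollout π n hn) := by
  induction n with
  | zero => unfold MDP.rollout; infer_instance
  | succ n ih =>
    have := ih (by omega)
    unfold MDP.rollout
    exact Kernel.IsMarkovKernel.map _ (measurable_cons_transition n)

/-- Law `P^π` of the whole trajectory (all `H` transitions). -/
def MDP.traj (M : MDP X A H) (π : Policy X A H) : Measure (Fin H → Transition X A) :=
  M.init.bind (M.rollout π H le_rfl)

/-- Expected total reward `J(π)`. -/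
def MDP.J (M : MDP X A H) (π : Policy X A H) : ℝ := ∫ τ, ∑ h, (τ h).2.1 ∂(M.traj π)

/-- Expected total reward of the last `n` layers, started from state `x` at layer `H - n`. -/
def MDP.valueToGo (M : MDP X A H) (π : Policy X A H) (n : ℕ) (hn : n ≤ H) (x : X) : ℝ :=
  ∫ τ, ∑ i, (τ i).2.1 ∂(M.rollout π n hn x)

/-- State value function `V_h^π`. -/
def MDP.V (M : MDP X A H) (π : Policy X A H) (h : Fin H) (x : X) : ℝ :=
  M.valueToGo π (H - h) (Nat.sub_le _ _) x

/-- State-action value function `Q_h^π`: take `a` in `x` at layer `h`, then follow `π`. -/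
def MDP.Q (M : MDP X A H) (π : Policy X A H) : ValueFn X A H := fun h x a =>
  (∫ r, r ∂(M.R h (x, a))) +
    ∫ x', M.valueToGo π (H - (h + 1)) (Nat.sub_le _ _) x' ∂(M.P h (x, a))

/-- `π` maximizes the value function at all states and layers, over all randomized policies. -/
def MDP.IsOptimal (M : MDP X A H) (π : Policy X A H) : Prop :=
  ∀ (π' : Policy X A H) (h : Fin H) (x : X), M.V π' h x ≤ M.V π h x

/-- Total rewards are in `[0, 1]` almost surely, under every policy. -/
def MDP.NormalizedRewards (M : MDP X A H) : Prop :=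
  ∀ π : Policy X A H, ∀ᵐ τ ∂(M.traj π), ∑ h, (τ h).2.1 ∈ Set.Icc (0 : ℝ) 1

/-- Occupancy measure `d_h^π`: the law of `(x_h, a_h)` under `π`. -/
def MDP.occ (M : MDP X A H) (π : Policy X A H) (h : Fin H) : Measure (X × A) :=
  (M.traj π).map (fun τ => (τ h).1)

/-- Law of an offline sample at layer `h`: `(x, a) ∼ ν_h`, `r ∼ R_h(x, a)`, `x' ∼ P_h(x, a)`. -/
def MDP.sampleLaw (M : MDP X A H) (ν : Fin H → ProbabilityMeasure (X × A)) (h : Fin H) :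
    Measure (Transition X A) :=
  (ν h : Measure (X × A)) ⊗ₘ M.trans h

end Dynamics

/-- Ratio of masses with the conventions `x / 0 = ∞` for `x > 0` and `0 / 0 = 1`. -/
def ratio (p q : ℝ≥0∞) : ℝ≥0∞ := if q = 0 then (if p = 0 then 1 else ⊤) else p / q

section Coverage

variable {X A : Type*} [MeasurableSpace X] [MeasurableSpace A] [DiscreteMeasurableSpace X] {H : ℕ}

/-- `greedy` sends every `f ∈ F` to a greedy policy `π_f`, with some fixed rule for breaking
ties. -/
def IsGreedyRule (F : Finset (ValueFn X A H)) (greedy : ValueFn X A H → DetPolicy X A H) : Prop :=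
  ∀ f ∈ F, ∀ h x a, f h x a ≤ f h x (greedy f h x)

/-- The induced policy class `Π = {π_f : f ∈ F}`. -/
def policyClass (F : Finset (ValueFn X A H)) (greedy : ValueFn X A H → DetPolicy X A H) :
    Set (DetPolicy X A H) :=
  greedy '' (F : Set (ValueFn X A H))

/-- The mass `d_h^π(x, a)`. -/
def MDP.d (M : MDP X A H) (π : DetPolicy X A H) (h : Fin H) (z : X × A) : ℝ≥0∞ :=
  M.occ π.toPolicy h {z}

/-- The coverability coefficient of a policy class: the infimum over `μ_1, …, μ_H` of
`sup_{π, h} ‖d_h^π / μ_h‖_∞`. -/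
def MDP.coverability (M : MDP X A H) (Pi : Set (DetPolicy X A H)) : ℝ≥0∞ :=
  ⨅ μ : Fin H → ProbabilityMeasure (X × A), ⨆ π ∈ Pi, ⨆ h : Fin H, ⨆ z : X × A,
    ratio (M.d π h z) ((μ h : Measure (X × A)) {z})

/-- `ν` satisfies `C`-single-policy concentrability: `max_h ‖d_h^π / ν_h‖_∞ ≤ C`. -/
def MDP.SinglePolicyConcentrability (M : MDP X A H) (π : DetPolicy X A H)
    (ν : Fin H → ProbabilityMeasure (X × A)) (C : ℝ) : Prop :=
  ∀ h z, ratio (M.d π h z) ((ν h : Measure (X × A)) {z}) ≤ ENNReal.ofReal C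

/-- The mass at `z` of the hybrid mixture `(ν_h + (1/t) ∑_i d_h^{π_i}) / 2`. -/
def MDP.hybridMixture (M : MDP X A H) (ν : Fin H → ProbabilityMeasure (X × A)) {t : ℕ}
    (πs : Fin t → DetPolicy X A H) (h : Fin H) (z : X × A) : ℝ≥0∞ :=
  ((ν h : Measure (X × A)) {z} + (∑ i, M.d (πs i) h z) / (t : ℝ≥0∞)) / 2

/-- The weight function `(h, x, a) ↦ d_h^π(x, a) / μ_h(x, a)`, for `μ` the hybrid mixture. -/
def MDP.hybridRatio (M : MDP X A H) (ν : Fin H → ProbabilityMeasure (X × A)) {t : ℕ}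
    (πs : Fin t → DetPolicy X A H) (π : DetPolicy X A H) : WeightFn X A H :=
  fun h x a => ratio (M.d π h (x, a)) (M.hybridMixture ν πs h (x, a))

/-- Density ratio realizability for the hybrid mixtures, as functions on `X × A × [H]`: the weight
function `d^π / μ^{(t)}` belongs to `W`. -/
def MDP.RatioRealizable (M : MDP X A H) (ν : Fin H → ProbabilityMeasure (X × A))
    (Pi : Set (DetPolicy X A H)) (W : Finset (WeightFn X A H)) (T : ℕ) : Prop :=
  ∀ t : ℕ, 1 ≤ t → t ≤ T → ∀ πs : Fin t → DetPolicy X A H, (∀ i, πs i ∈ Pi) →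
    ∀ π ∈ Pi, M.hybridRatio ν πs π ∈ W

/-- Density ratio realizability for the hybrid mixtures, layer by layer: `d_h^π / μ_h^{(t)}` belongs
to `W_h = {w_h : w ∈ W}` for every layer `h`. -/
def MDP.RatioRealizableLayerwise (M : MDP X A H) (ν : Fin H → ProbabilityMeasure (X × A))
    (Pi : Set (DetPolicy X A H)) (W : Finset (WeightFn X A H)) (T : ℕ) : Prop :=
  ∀ t : ℕ, 1 ≤ t → t ≤ T → ∀ πs : Fin t → DetPolicy X A H, (∀ i, πs i ∈ Pi) →
    ∀ π ∈ Pi, ∀ h : Fin H, ∃ w ∈ W, w h = M.hybridRatio ν πs π h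

end Coverage

section Algorithm

variable {X A : Type*} {H : ℕ}

/-- `max_{a'} f_{h+1}(x', a')`, with `f_{H+1} = 0`. -/
def nextMax (f : ValueFn X A H) (h : Fin H) (x' : X) : ℝ :=
  if hh : (h : ℕ) + 1 < H then ⨆ a', f ⟨h + 1, hh⟩ x' a' else 0

/-- The empirical Bellman residual `f_h(x, a) - r - max_{a'} f_{h+1}(x', a')`. -/
def residual (f : ValueFn X A H) (h : Fin H) (s : Transition X A) : ℝ :=
  f h s.1.1 s.1.2 - s.2.1 - nextMax f h s.2.2

/-- Clipping at level `g`: this is `min v g` for `0 ≤ v ≤ ∞`, extended to negative `v` as an odd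
function, so that clipping `-w` gives minus the clipping of `w`. -/
def clip (g : ℝ) (v : EReal) : ℝ := (max (-(g : EReal)) (min v (g : EReal))).toReal

/-- A nonnegative weight function as a signed one. -/
def WeightFn.signed (w : WeightFn X A H) : SignedWeightFn X A H := fun h x a => (w h x a : EReal)

/-- The weight function `w^{(h)}`, equal to `w` at layer `h` and zero at all other layers. -/
def WeightFn.single (w : WeightFn X A H) (h : Fin H) : SignedWeightFn X A H :=
  fun h' x a => if h' = h then (w h x a : EReal) else 0

/-- The augmented class `W ∪ (-W) ∪ ⋃_h (W^{(h)} ∪ (-W^{(h)}))`. -/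
def augmented (W : Finset (WeightFn X A H)) : Set (SignedWeightFn X A H) :=
  {v | ∃ w ∈ W, v = w.signed ∨ v = -w.signed ∨ ∃ h, v = w.single h ∨ v = -w.single h}

/-- Empirical mean over the hybrid data available in round `t` (rounds are numbered `0, …, T - 1`):
the first `t` offline samples together with the `t` online samples gathered in rounds
`0, …, t - 1`. In round `0` there are no data and the mean is `0`. -/
def hybridMean {T : ℕ} (off on : Fin T → Transition X A) (t : Fin T)
    (g : Transition X A → ℝ) : ℝ :=
  (∑ i ∈ Finset.Iio t, (g (off i) + g (on i))) / (2 * (t : ℕ))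

/-- The regularized and clipped objective of MABO.CR for the pair `(f, w)` on the hybrid data of
round `t`, with clipping level `g` and regularization `α = 8 / g`. -/
def maboObjective {T : ℕ} (off on : Fin T → Fin H → Transition X A) (t : Fin T) (g : ℝ)
    (f : ValueFn X A H) (w : SignedWeightFn X A H) : ℝ :=
  ∑ h, (|hybridMean (fun i => off i h) (fun i => on i h) t
            (fun s => clip g (w h s.1.1 s.1.2) * residual f h s)|
        - 8 / g * hybridMean (fun i => off i h) (fun i => on i h) t
            (fun s => clip g (w h s.1.1 s.1.2) ^ 2))

/-- `f̂` is a MABO.CR estimator on the hybrid data of round `t`, with function class `F` and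
augmented weight class: `f̂ ∈ argmin_{f ∈ F} max_w maboObjective f w`. -/
def IsMaboCR {T : ℕ} (F : Finset (ValueFn X A H)) (W : Finset (WeightFn X A H))
    (off on : Fin T → Fin H → Transition X A) (t : Fin T) (g : ℝ) (fhat : ValueFn X A H) : Prop :=
  fhat ∈ F ∧ ∀ f ∈ F,
    (⨆ w : augmented W, maboObjective off on t g fhat w) ≤
      ⨆ w : augmented W, maboObjective off on t g f w

end Algorithm

section Run

variable {X A : Type*} [MeasurableSpace X] [MeasurableSpace A] [DiscreteMeasurableSpace X] {H : ℕ}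

/-- What is known just before the trajectory of round `t` is collected: the offline data, the
trajectories of the earlier rounds, and the value functions computed up to round `t`. -/
@[reducible] def history {T : ℕ} {Ω : Type*} (off : Fin T → Fin H → Ω → Transition X A)
    (on : Fin T → Ω → Fin H → Transition X A) (f : Fin T → Ω → ValueFn X A H) (t : Fin T) :
    MeasurableSpace Ω :=
  (⨆ i, ⨆ h, MeasurableSpace.comap (off i h) inferInstance) ⊔
    (⨆ i ∈ Set.Iio t, MeasurableSpace.comap (on i) inferInstance) ⊔
    (⨆ i ∈ Set.Iic t, MeasurableSpace.comap (f i) inferInstance)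

/-- A run of HyGlow with `T` rounds and clipping scale `γ` on the MDP `M`, with offline data
distribution `ν`: `off i h` is the `i`-th offline sample of layer `h`, `f t` the value function
computed in round `t`, and `on t` the single trajectory collected in round `t`. -/
structure IsHyGlowRun (M : MDP X A H) (ν : Fin H → ProbabilityMeasure (X × A))
    (F : Finset (ValueFn X A H)) (W : Finset (WeightFn X A H))
    (greedy : ValueFn X A H → DetPolicy X A H) (T : ℕ) (γ : ℝ)
    {Ω : Type*} [MeasurableSpace Ω] (Pr : Measure Ω)
    (off : Fin T → Fin H → Ω → Transition X A) (f : Fin T → Ω → ValueFn X A H)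
    (on : Fin T → Ω → Fin H → Transition X A) : Prop where
  off_measurable : ∀ i h, Measurable (off i h)
  on_measurable : ∀ t, Measurable (on t)
  f_measurable : ∀ t, Measurable (f t)
  /-- the offline samples of each layer are drawn independently … -/
  off_indep : ∀ h, iIndepFun (fun i => off i h) Pr
  /-- … from the offline data distribution -/
  off_law : ∀ i h, Pr.map (off i h) = M.sampleLaw ν h
  /-- round `t` (the `(t + 1)`-st) runs MABO.CR on the hybrid data at level `γ (t + 1)` -/
  f_mabo : ∀ t ω, IsMaboCR F W (fun i h => off i h ω) (fun i => on i ω) t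
    (γ * ((t : ℕ) + 1)) (f t ω)
  /-- given the past, the trajectory of round `t` is collected with the greedy policy of `f t` -/
  on_law : ∀ t, ∀ B : Set (Fin H → Transition X A), MeasurableSet B →
    ∀ E : Set Ω, MeasurableSet[history off on f t] E →
      Pr (E ∩ on t ⁻¹' B) = ∫⁻ ω in E, M.traj (greedy (f t ω)).toPolicy B ∂Pr

/-- Risk relative to `πstar` of the policy `Unif(π_1, …, π_T)`. -/
def MDP.riskUnif (M : MDP X A H) (πstar : DetPolicy X A H) {T : ℕ}
    (πs : Fin T → DetPolicy X A H) : ℝ :=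
  (∑ t, (M.J πstar.toPolicy - M.J (πs t).toPolicy)) / T

/-- Every run of HyGlow with `T` rounds (hence `T` collected trajectories) and clipping scale `γ`
returns an `ε`-suboptimal policy with probability at least `1 - δ T`. -/
def HyGlowSucceeds {X : Type u₁} {A : Type u₂} [MeasurableSpace X] [MeasurableSpace A]
    [DiscreteMeasurableSpace X] {H : ℕ} (M : MDP X A H)
    (ν : Fin H → ProbabilityMeasure (X × A))
    (F : Finset (ValueFn X A H)) (W : Finset (WeightFn X A H))
    (greedy : ValueFn X A H → DetPolicy X A H) (πstar : DetPolicy X A H) (T : ℕ) (γ ε δ : ℝ) :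
    Prop :=
  ∀ (Ω : Type v) [MeasurableSpace Ω] (Pr : Measure Ω) [IsProbabilityMeasure Pr]
    (off : Fin T → Fin H → Ω → Transition X A) (f : Fin T → Ω → ValueFn X A H)
    (on : Fin T → Ω → Fin H → Transition X A),
    IsHyGlowRun M ν F W greedy T γ Pr off f on →
      ENNReal.ofReal (1 - δ * T) ≤ Pr {ω | M.riskUnif πstar (fun t => greedy (f t ω)) ≤ ε}

end Run

/-- The logarithmic factor hidden in the soft-oh notation: `C` stands for the coverage
coefficients and `L` for `log (|F| |W| / δ)`. -/
def logFactor (H : ℕ) (C L ε : ℝ) : ℝ := Real.log (Real.exp 1 + H * C * L / ε)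

end

end HybridRL

/-!
HyGlow has small regret because of three facts.

*Performance difference.* For a candidate value function `f` with greedy policy `π_f`, the regret
`J(π⋆) - J(π_f)` is at most the sum over the layers of the expected Bellman errors of `f` under
`d^{π_f}` minus those under `d^{π⋆}` (`MDP.performance_difference`). So it suffices to estimate the
Bellman errors of `f^{(t)}` under two policies of the class. The Bellman errors of `Q⋆` vanish
(`MDP.IsOptimal.bellmanErr_Q`).

*Estimation.* Given the past, the offline and online samples of a layer have the hybrid mixture as
their average law. The exponentials of centred sums over these samples form a supermartingale
(`IsHyGlowRun.lintegral_prod_exp_le`), and a Bernstein bound gives, with probability `1 - δ` in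
each round and uniformly over `f`, `w` and the layers, deviations of order
`E[w̌²] / g + g β / t`, where `g = γ (t + 1)` is the clipping level and `β ≈ log (H |F| |W| / δ)`
(`IsHyGlowRun.measure_not_good_le`). The regularizer `8 / g` of the objective absorbs the second
moments. Hence the objective is `O(H γ β)` at `Q⋆`, so also at its minimizer, and testing the
minimizer against the density ratio of a policy bounds its Bellman errors under that policy, up to
the second moment of the clipped ratio and the mass lost to clipping (`MDP.abs_integral_occ_le`).
With joint realizability all layers are tested at once, at total price `O(H γ β)`; with layerwise
realizability each layer is tested separately and the price is `O(H² γ β)`.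

*Coverage.* The remaining costs are summed over the rounds at each state-action pair. For `π⋆` they
are at most `O(C⋆ / g)`, as the offline half of the mixture covers `π⋆`. For `π^{(t)}` the online
half contains the previous occupancies, all dominated by `C_cov μ`, and a one-dimensional elliptic
potential (`sum_div_add_le_log`, `clipCost_le_potential`) gives `O((C_cov / γ) log T)` in total
(`MDP.sum_roundCost_le`).

The cumulative regret is thus `O(T D γ β + H C log T / γ)` with `D = H` or `D = H²`
(`sum_regret_le`), and the prescribed `γ` and `T` make its average at most `ε` (`tuning`).
-/

namespace HybridRL

noncomputable section

set_option linter.unusedSectionVars false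

/-! ### Laws of single transitions -/

section Laws

variable {X A : Type*} [MeasurableSpace X] [MeasurableSpace A] {H : ℕ}

theorem MDP.lintegral_step (M : MDP X A H) (π : Policy X A H) (h : Fin H) (x : X)
    {G : Transition X A → ℝ≥0∞} (hG : Measurable G) :
    ∫⁻ s, G s ∂(M.step π h x) =
      ∫⁻ a, ∫⁻ q, G ((x, a), q) ∂(M.trans h (x, a)) ∂(π.act h x) := by
  have h1 : Measurable (fun z : X × A => ∫⁻ q, G (z, q) ∂(M.trans h z)) :=
    Measurable.lintegral_kernel_prod_right' hG
  unfold MDP.step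
  rw [Kernel.lintegral_compProd _ _ _ hG]
  simp only [Kernel.prodMkLeft_apply]
  rw [Kernel.lintegral_prod _ _ _ h1, Kernel.lintegral_id']
  exact Measurable.lintegral_kernel_prod_right' (κ := Kernel.const X (π.act h x)) h1

theorem MDP.lintegral_rollout_succ (M : MDP X A H) (π : Policy X A H) {n : ℕ} (hn : n + 1 ≤ H)
    (x : X) {G : (Fin (n + 1) → Transition X A) → ℝ≥0∞} (hG : Measurable G) :
    ∫⁻ τ, G τ ∂(M.rollout π (n + 1) hn x) =
      ∫⁻ s, ∫⁻ τ, G (Fin.cons s τ) ∂(M.rollout π n (by omega) s.2.2)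
        ∂(M.step π ⟨H - (n + 1), by omega⟩ x) := by
  rw [MDP.rollout, Kernel.map_apply _ (measurable_cons_transition n),
    lintegral_map hG (measurable_cons_transition n),
    Kernel.lintegral_compProd _ _ _
      (f := fun q : Transition X A × (Fin n → Transition X A) => G (Fin.cons q.1 q.2))
      (hG.comp (measurable_cons_transition n))]
  rfl

/-- Each transition of a rollout is drawn from the one-step kernel at the current state. -/
theorem MDP.lintegral_rollout_apply [DiscreteMeasurableSpace X] [Countable X]
    (M : MDP X A H) (π : Policy X A H) {n : ℕ}
    (hn : n ≤ H) (i : Fin n) (x : X) {G : Transition X A → ℝ≥0∞} (hG : Measurable G) :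
    ∫⁻ τ, G (τ i) ∂(M.rollout π n hn x) =
      ∫⁻ τ, ∫⁻ s, G s ∂(M.step π ⟨H - n + i, by omega⟩ (τ i).1.1) ∂(M.rollout π n hn x) := by
  induction n generalizing x with
  | zero => exact i.elim0
  | succ n ih =>
    have hm : ∀ k : Fin H, Measurable (fun y : X => ∫⁻ s, G s ∂(M.step π k y)) := fun k =>
      Measurable.of_discrete
    have hm' : ∀ (k : Fin H) (j : Fin (n + 1)), Measurable
        (fun τ : Fin (n + 1) → Transition X A => ∫⁻ s, G s ∂(M.step π k (τ j).1.1)) := fun k j =>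
      (hm k).comp (measurable_fst.comp (measurable_fst.comp (measurable_pi_apply j)))
    rw [M.lintegral_rollout_succ π hn x (G := fun τ => G (τ i)) (by fun_prop),
      M.lintegral_rollout_succ π hn x (hm' _ i)]
    refine Fin.cases ?_ (fun j => ?_) i
    · simp only [Fin.cons_zero, lintegral_const, measure_univ, mul_one, Fin.val_zero, add_zero]
      rw [M.lintegral_step π _ x (G := fun s => ∫⁻ s', G s' ∂(M.step π _ s.1.1))
        ((hm _).comp (measurable_fst.comp measurable_fst))]
      simp
    · simp only [Fin.cons_succ]
      refine lintegral_congr fun s => ?_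
      rw [ih (by omega) j s.2.2]
      have : (⟨H - n + j, by omega⟩ : Fin H) = ⟨H - (n + 1) + (j.succ : ℕ), by
          have := j.succ.2; omega⟩ := by
        ext; simp; omega
      rw [this]

theorem MDP.lintegral_rollout_head [DiscreteMeasurableSpace X] [Countable X]
    (M : MDP X A H) (π : Policy X A H) {n : ℕ} (hn : n + 1 ≤ H) (x : X) (G : X → ℝ≥0∞) :
    ∫⁻ τ, G (τ 0).1.1 ∂(M.rollout π (n + 1) hn x) = G x := by
  have hG : Measurable G := Measurable.of_discrete
  rw [M.lintegral_rollout_succ π hn x (G := fun τ => G (τ 0).1.1) (by fun_prop)]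
  simp only [Fin.cons_zero, lintegral_const, measure_univ, mul_one]
  rw [M.lintegral_step π _ x (G := fun s => G s.1.1)
    (by fun_prop)]
  simp

/-- The next state of one transition is the current state of the following one. -/
theorem MDP.lintegral_rollout_next [DiscreteMeasurableSpace X] [Countable X]
    (M : MDP X A H) (π : Policy X A H) {n : ℕ} (hn : n ≤ H) (i : ℕ) (hi : i + 1 < n) (x : X)
    (G : X → ℝ≥0∞) :
    ∫⁻ τ, G (τ ⟨i + 1, hi⟩).1.1 ∂(M.rollout π n hn x) =
      ∫⁻ τ, G (τ ⟨i, by omega⟩).2.2 ∂(M.rollout π n hn x) := by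
  have hG : Measurable G := Measurable.of_discrete
  induction n generalizing x i with
  | zero => omega
  | succ n ih =>
    rw [M.lintegral_rollout_succ π hn x (G := fun τ => G (τ ⟨i + 1, hi⟩).1.1) (by fun_prop),
      M.lintegral_rollout_succ π hn x (G := fun τ => G (τ ⟨i, by omega⟩).2.2) (by fun_prop)]
    refine lintegral_congr fun s => ?_
    have e1 : (⟨i + 1, hi⟩ : Fin (n + 1)) = Fin.succ ⟨i, by omega⟩ := rfl
    rw [e1]
    simp only [Fin.cons_succ]
    cases i with
    | zero =>
      obtain ⟨m, rfl⟩ : ∃ m, n = m + 1 := ⟨n - 1, by omega⟩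
      have := M.lintegral_rollout_head π (n := m) (by omega) s.2.2 G
      simpa using this
    | succ i =>
      have e2 : (⟨i + 1, by omega⟩ : Fin (n + 1)) = Fin.succ ⟨i, by omega⟩ := rfl
      rw [e2]
      simp only [Fin.cons_succ]
      exact ih (by omega) i (by omega) s.2.2

/-- Law of the transition at layer `h` under `π`. -/
def MDP.law (M : MDP X A H) (π : Policy X A H) (h : Fin H) : Measure (Transition X A) :=
  (M.traj π).map (fun τ => τ h)

/-- Law of the state at layer `h` under `π`. -/
def MDP.stateOcc (M : MDP X A H) (π : Policy X A H) (h : Fin H) : Measure X :=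
  (M.traj π).map (fun τ => (τ h).1.1)

instance (M : MDP X A H) (π : Policy X A H) : IsProbabilityMeasure (M.traj π) := by
  unfold MDP.traj; infer_instance

instance (M : MDP X A H) (π : Policy X A H) (h : Fin H) : IsProbabilityMeasure (M.law π h) :=
  Measure.isProbabilityMeasure_map (measurable_pi_apply h).aemeasurable

instance (M : MDP X A H) (π : Policy X A H) (h : Fin H) : IsProbabilityMeasure (M.stateOcc π h) :=
  Measure.isProbabilityMeasure_map (Measurable.aemeasurable (by fun_prop))

instance (M : MDP X A H) (π : Policy X A H) (h : Fin H) : IsProbabilityMeasure (M.occ π h) :=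
  Measure.isProbabilityMeasure_map (Measurable.aemeasurable (by fun_prop))

theorem MDP.lintegral_traj (M : MDP X A H) (π : Policy X A H)
    {G : (Fin H → Transition X A) → ℝ≥0∞} (hG : Measurable G) :
    ∫⁻ τ, G τ ∂(M.traj π) = ∫⁻ x, ∫⁻ τ, G τ ∂(M.rollout π H le_rfl x) ∂M.init := by
  unfold MDP.traj
  rw [Measure.lintegral_bind (Kernel.aemeasurable _) hG.aemeasurable]

theorem MDP.lintegral_law (M : MDP X A H) (π : Policy X A H) (h : Fin H)
    {G : Transition X A → ℝ≥0∞} (hG : Measurable G) :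
    ∫⁻ s, G s ∂(M.law π h) = ∫⁻ τ, G (τ h) ∂(M.traj π) :=
  lintegral_map hG (measurable_pi_apply h)

theorem MDP.lintegral_stateOcc (M : MDP X A H) (π : Policy X A H) (h : Fin H)
    {G : X → ℝ≥0∞} (hG : Measurable G) :
    ∫⁻ s, G s ∂(M.stateOcc π h) = ∫⁻ τ, G (τ h).1.1 ∂(M.traj π) :=
  lintegral_map hG (by fun_prop)

section Discrete

variable [DiscreteMeasurableSpace X] [Countable X]

theorem MDP.lintegral_law_eq_step (M : MDP X A H) (π : Policy X A H) (h : Fin H)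
    {G : Transition X A → ℝ≥0∞} (hG : Measurable G) :
    ∫⁻ s, G s ∂(M.law π h) = ∫⁻ x, ∫⁻ s, G s ∂(M.step π h x) ∂(M.stateOcc π h) := by
  have hm : Measurable (fun y : X => ∫⁻ s, G s ∂(M.step π h y)) := Measurable.of_discrete
  rw [M.lintegral_law π h hG, M.lintegral_stateOcc π h hm,
    M.lintegral_traj π (G := fun τ => G (τ h)) (by fun_prop),
    M.lintegral_traj π (G := fun τ => ∫⁻ s, G s ∂(M.step π h (τ h).1.1))
      (hm.comp (measurable_fst.comp (measurable_fst.comp (measurable_pi_apply h))))]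
  refine lintegral_congr fun x => ?_
  have := M.lintegral_rollout_apply π le_rfl h x hG
  simpa using this

theorem MDP.occ_eq_compProd (M : MDP X A H) (π : Policy X A H) (h : Fin H) :
    M.occ π h = M.stateOcc π h ⊗ₘ π.act h := by
  refine Measure.ext_of_lintegral _ fun G hG => ?_
  have h1 : ∫⁻ z, G z ∂(M.occ π h) = ∫⁻ s, G s.1 ∂(M.law π h) := by
    unfold MDP.occ
    rw [lintegral_map hG (by fun_prop), M.lintegral_law π h (G := fun s => G s.1) (by fun_prop)]
  rw [h1, M.lintegral_law_eq_step π h (G := fun s => G s.1) (by fun_prop), Measure.lintegral_compProd hG]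
  refine lintegral_congr fun x => ?_
  rw [M.lintegral_step π h x (G := fun s => G s.1) (by fun_prop)]
  simp

/-- Given the state-action pair, the reward and the next state are drawn from the MDP. -/
theorem MDP.law_eq_compProd (M : MDP X A H) (π : Policy X A H) (h : Fin H) :
    M.law π h = M.occ π h ⊗ₘ M.trans h := by
  refine Measure.ext_of_lintegral _ fun G hG => ?_
  have h1 : Measurable (fun z : X × A => ∫⁻ q, G (z, q) ∂(M.trans h z)) :=
    Measurable.lintegral_kernel_prod_right' hG
  rw [M.lintegral_law_eq_step π h hG, Measure.lintegral_compProd hG, M.occ_eq_compProd,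
    Measure.lintegral_compProd h1]
  exact lintegral_congr fun x => M.lintegral_step π h x hG

theorem MDP.stateOcc_zero (M : MDP X A H) (π : Policy X A H) (h : Fin H) (h0 : (h : ℕ) = 0) :
    M.stateOcc π h = M.init := by
  refine Measure.ext_of_lintegral _ fun G hG => ?_
  rw [M.lintegral_stateOcc π h hG, M.lintegral_traj π
    (G := fun τ => G (τ h).1.1) (by fun_prop)]
  refine lintegral_congr fun x => ?_
  obtain ⟨k, hk⟩ := h
  obtain rfl : k = 0 := h0
  obtain ⟨m, rfl⟩ : ∃ m, H = m + 1 := ⟨H - 1, by omega⟩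
  exact M.lintegral_rollout_head π le_rfl x G

theorem MDP.map_law_next (M : MDP X A H) (π : Policy X A H) (h : Fin H) (hh : (h : ℕ) + 1 < H) :
    (M.law π h).map (fun s => s.2.2) = M.stateOcc π ⟨h + 1, hh⟩ := by
  refine Measure.ext_of_lintegral _ fun G hG => ?_
  rw [lintegral_map hG (by fun_prop), M.lintegral_stateOcc π _ hG,
    M.lintegral_law π h (G := fun s => G s.2.2) (by fun_prop),
    M.lintegral_traj π (G := fun τ => G (τ ⟨h + 1, hh⟩).1.1) (by fun_prop),
    M.lintegral_traj π (G := fun τ => G (τ h).2.2) (by fun_prop)]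
  refine lintegral_congr fun x => ?_
  exact (M.lintegral_rollout_next π le_rfl h hh x G).symm

end Discrete

theorem MDP.reward_mem_step (M : MDP X A H) (π : Policy X A H) (h : Fin H) (x : X) :
    ∀ᵐ s ∂(M.step π h x), s.2.1 ∈ Set.Icc (0 : ℝ) 1 := by
  have hS : MeasurableSet {s : Transition X A | ¬ s.2.1 ∈ Set.Icc (0 : ℝ) 1} :=
    ((measurable_fst.comp measurable_snd) measurableSet_Icc).compl
  rw [ae_iff, ← lintegral_indicator_one hS,
    M.lintegral_step π h x (measurable_one.indicator hS)]
  refine lintegral_eq_zero_of_ae_eq_zero (Filter.Eventually.of_forall fun a => ?_)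
  refine lintegral_eq_zero_of_ae_eq_zero ?_
  have : ∀ᵐ q ∂(M.trans h (x, a)), q.1 ∈ Set.Icc (0 : ℝ) 1 := by
    unfold MDP.trans
    rw [Kernel.prod_apply]
    exact Measure.quasiMeasurePreserving_fst.ae (M.R_mem h (x, a))
  filter_upwards [this] with q hq
  simp only [Set.indicator_apply, Set.mem_ofPred_eq, hq, not_true, if_false, Pi.zero_apply]

end Laws

/-! ### Bellman errors and the performance difference -/

section Bellman

variable {X A : Type*} [MeasurableSpace X] [MeasurableSpace A] {H : ℕ}

theorem MDP.reward_mem_trans (M : MDP X A H) (h : Fin H) (z : X × A) :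
    ∀ᵐ q ∂(M.trans h z), q.1 ∈ Set.Icc (0 : ℝ) 1 := by
  unfold MDP.trans
  rw [Kernel.prod_apply]
  exact Measure.quasiMeasurePreserving_fst.ae (M.R_mem h z)

theorem MDP.reward_mem_compProd (M : MDP X A H) (h : Fin H) (μ : Measure (X × A)) :
    ∀ᵐ s ∂(μ ⊗ₘ M.trans h), s.2.1 ∈ Set.Icc (0 : ℝ) 1 := by
  refine Measure.ae_compProd_of_ae_ae ?_ (Filter.Eventually.of_forall fun z =>
    M.reward_mem_trans h z)
  exact (measurable_fst.comp measurable_snd) measurableSet_Icc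

/-- The expected Bellman residual `f_h(x, a) - E[r + max_{a'} f_{h+1}(x', a')]`. -/
def MDP.bellmanErr (M : MDP X A H) (f : ValueFn X A H) (h : Fin H) (z : X × A) : ℝ :=
  f h z.1 z.2 - (∫ r, r ∂(M.R h z)) - ∫ x', nextMax f h x' ∂(M.P h z)

theorem nextMax_mem {f : ValueFn X A H} (hf : ∀ h x a, f h x a ∈ Set.Icc (0 : ℝ) 1) (h : Fin H)
    (x : X) : nextMax f h x ∈ Set.Icc (0 : ℝ) 1 := by
  unfold nextMax
  split_ifs with hh
  · exact ⟨Real.iSup_nonneg fun a => (hf _ _ _).1, Real.iSup_le (fun a => (hf _ _ _).2) zero_le_one⟩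
  · simp

theorem abs_residual_le {f : ValueFn X A H} (hf : ∀ h x a, f h x a ∈ Set.Icc (0 : ℝ) 1) (h : Fin H)
    {s : Transition X A} (hs : s.2.1 ∈ Set.Icc (0 : ℝ) 1) : |residual f h s| ≤ 2 := by
  have h1 := hf h s.1.1 s.1.2
  have h2 := nextMax_mem hf h s.2.2
  unfold residual
  rw [abs_le]
  constructor <;> linarith [h1.1, h1.2, h2.1, h2.2, hs.1, hs.2]

variable [DiscreteMeasurableSpace X] [Countable X] [DiscreteMeasurableSpace A] [Countable A]

theorem measurable_residual (f : ValueFn X A H) (h : Fin H) :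
    Measurable (residual f h) := by
  have h1 : Measurable (fun z : X × A => f h z.1 z.2) := Measurable.of_discrete
  have h2 : Measurable (nextMax f h) := Measurable.of_discrete
  unfold residual
  exact ((h1.comp measurable_fst).sub (measurable_fst.comp measurable_snd)).sub
    (h2.comp (measurable_snd.comp measurable_snd))

theorem MDP.integral_residual_trans (M : MDP X A H) {f : ValueFn X A H}
    (hf : ∀ h x a, f h x a ∈ Set.Icc (0 : ℝ) 1) (h : Fin H) (z : X × A) :
    ∫ q, residual f h (z, q) ∂(M.trans h z) = M.bellmanErr f h z := by
  have h2 : Measurable (nextMax f h) := Measurable.of_discrete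
  have hr : Integrable (fun q : ℝ × X => q.1) (M.trans h z) := by
    refine Integrable.of_bound measurable_fst.aestronglyMeasurable 1 ?_
    filter_upwards [M.reward_mem_trans h z] with q hq
    rw [Real.norm_eq_abs, abs_of_nonneg hq.1]; exact hq.2
  have hm : Integrable (fun q : ℝ × X => nextMax f h q.2) (M.trans h z) := by
    refine Integrable.of_bound (h2.comp measurable_snd).aestronglyMeasurable 1 ?_
    refine Filter.Eventually.of_forall fun q => ?_
    have := nextMax_mem hf h q.2
    rw [Real.norm_eq_abs, abs_of_nonneg this.1]; exact this.2
  unfold residual MDP.bellmanErr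
  have e1 := integral_sub ((integrable_const (μ := M.trans h z) (f h z.1 z.2)).sub hr) hm
  have e2 := integral_sub (integrable_const (μ := M.trans h z) (f h z.1 z.2)) hr
  simp only [Pi.sub_apply] at e1
  rw [e1, e2, integral_const]
  unfold MDP.trans
  rw [Kernel.prod_apply, integral_fun_fst (f := fun r : ℝ => r), integral_fun_snd (f := nextMax f h)]
  simp

theorem MDP.abs_bellmanErr_le (M : MDP X A H) {f : ValueFn X A H}
    (hf : ∀ h x a, f h x a ∈ Set.Icc (0 : ℝ) 1) (h : Fin H) (z : X × A) :
    |M.bellmanErr f h z| ≤ 2 := by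
  rw [← M.integral_residual_trans hf h z]
  have := norm_integral_le_of_norm_le_const (μ := M.trans h z)
    (f := fun q => residual f h (z, q)) (C := 2) (by
      filter_upwards [M.reward_mem_trans h z] with q hq
      exact abs_residual_le hf h hq)
  simpa using this

/-- Averaging a weighted residual over transitions leaves the weighted Bellman error. -/
theorem MDP.integral_mul_residual (M : MDP X A H) {f : ValueFn X A H}
    (hf : ∀ h x a, f h x a ∈ Set.Icc (0 : ℝ) 1) (h : Fin H) (μ : Measure (X × A))
    [IsProbabilityMeasure μ] {c : X × A → ℝ} {g : ℝ} (hc : ∀ z, |c z| ≤ g) :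
    ∫ s, c s.1 * residual f h s ∂(μ ⊗ₘ M.trans h) = ∫ z, c z * M.bellmanErr f h z ∂μ := by
  have hcm : Measurable c := Measurable.of_discrete
  have hi : Integrable (fun s : Transition X A => c s.1 * residual f h s) (μ ⊗ₘ M.trans h) := by
    refine Integrable.of_bound
      ((hcm.comp measurable_fst).mul (measurable_residual f h)).aestronglyMeasurable (g * 2) ?_
    filter_upwards [M.reward_mem_compProd h μ] with s hs
    rw [Real.norm_eq_abs, abs_mul]
    exact mul_le_mul (hc _) (abs_residual_le hf h hs) (abs_nonneg _) ((abs_nonneg _).trans (hc s.1))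
  rw [Measure.integral_compProd hi]
  refine integral_congr_ae (Filter.Eventually.of_forall fun z => ?_)
  simp only
  rw [integral_const_mul, M.integral_residual_trans hf h z]

theorem integrable_of_abs_le {μ : Measure (X × A)} [IsFiniteMeasure μ] {c : X × A → ℝ} {g : ℝ}
    (hc : ∀ z, |c z| ≤ g) : Integrable c μ :=
  Integrable.of_bound Measurable.of_discrete.aestronglyMeasurable g
    (Filter.Eventually.of_forall hc)

theorem MDP.integral_bellmanErr_occ (M : MDP X A H) (π : Policy X A H) {f : ValueFn X A H}
    (hf : ∀ h x a, f h x a ∈ Set.Icc (0 : ℝ) 1) (h : Fin H) :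
    ∫ z, M.bellmanErr f h z ∂(M.occ π h) =
      (∫ z, f h z.1 z.2 ∂(M.occ π h)) - (∫ s, s.2.1 ∂(M.law π h)) -
        ∫ s, nextMax f h s.2.2 ∂(M.law π h) := by
  have e := M.integral_mul_residual hf h (M.occ π h) (c := fun _ => 1) (g := 1) (by simp)
  simp only [one_mul, ← M.law_eq_compProd] at e
  rw [← e]
  have hm1 : Measurable (fun z : X × A => f h z.1 z.2) := Measurable.of_discrete
  have hm2 : Measurable (nextMax f h) := Measurable.of_discrete
  have i1 : Integrable (fun s : Transition X A => f h s.1.1 s.1.2) (M.law π h) := by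
    refine Integrable.of_bound (hm1.comp measurable_fst).aestronglyMeasurable 1 ?_
    refine Filter.Eventually.of_forall fun s => ?_
    rw [Real.norm_eq_abs, abs_of_nonneg (hf _ _ _).1]; exact (hf _ _ _).2
  have i2 : Integrable (fun s : Transition X A => s.2.1) (M.law π h) := by
    refine Integrable.of_bound (measurable_fst.comp measurable_snd).aestronglyMeasurable 1 ?_
    rw [M.law_eq_compProd]
    filter_upwards [M.reward_mem_compProd h _] with s hs
    rw [Real.norm_eq_abs, abs_of_nonneg hs.1]; exact hs.2
  have i3 : Integrable (fun s : Transition X A => nextMax f h s.2.2) (M.law π h) := by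
    refine Integrable.of_bound (hm2.comp (measurable_snd.comp measurable_snd)).aestronglyMeasurable
      1 ?_
    refine Filter.Eventually.of_forall fun s => ?_
    have := nextMax_mem hf h s.2.2
    rw [Real.norm_eq_abs, abs_of_nonneg this.1]; exact this.2
  have e1 := integral_sub (i1.sub i2) i3
  have e2 := integral_sub i1 i2
  simp only [Pi.sub_apply] at e1
  unfold residual
  rw [e1, e2]
  congr 2
  have : M.occ π h = (M.law π h).map Prod.fst := by
    rw [M.law_eq_compProd]; exact (Measure.fst_compProd _ _).symm
  rw [this, integral_map measurable_fst.aemeasurable hm1.aestronglyMeasurable]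

theorem MDP.integrable_reward_traj (M : MDP X A H) (π : Policy X A H) (h : Fin H) :
    Integrable (fun τ : Fin H → Transition X A => (τ h).2.1) (M.traj π) := by
  refine Integrable.of_bound (C := 1)
    (measurable_fst.comp (measurable_snd.comp (measurable_pi_apply h))).aestronglyMeasurable ?_
  have h1 : ∀ᵐ s ∂(M.law π h), s.2.1 ∈ Set.Icc (0 : ℝ) 1 := by
    rw [M.law_eq_compProd]; exact M.reward_mem_compProd h _
  filter_upwards [ae_of_ae_map (measurable_pi_apply h).aemeasurable h1] with τ hτ
  rw [Real.norm_eq_abs, abs_of_nonneg hτ.1]; exact hτ.2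

theorem MDP.J_eq_sum (M : MDP X A H) (π : Policy X A H) :
    M.J π = ∑ h, ∫ s, s.2.1 ∂(M.law π h) := by
  unfold MDP.J
  rw [integral_finsetSum _ fun h _ => M.integrable_reward_traj π h]
  refine Finset.sum_congr rfl fun h _ => ?_
  unfold MDP.law
  rw [integral_map (measurable_pi_apply h).aemeasurable
    (measurable_fst.comp measurable_snd).aestronglyMeasurable]

theorem MDP.J_mem (M : MDP X A H) (hM : M.NormalizedRewards) (π : Policy X A H) :
    M.J π ∈ Set.Icc (0 : ℝ) 1 := by
  have hi : Integrable (fun τ : Fin H → Transition X A => ∑ h, (τ h).2.1) (M.traj π) :=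
    integrable_finsetSum _ fun h _ => M.integrable_reward_traj π h
  unfold MDP.J
  constructor
  · refine integral_nonneg_of_ae ?_
    filter_upwards [hM π] with τ hτ using hτ.1
  · calc _ ≤ ∫ _, (1 : ℝ) ∂(M.traj π) := integral_mono_ae hi (integrable_const _) (by
          filter_upwards [hM π] with τ hτ using hτ.2)
      _ = 1 := by simp

theorem MDP.integral_occ_det (M : MDP X A H) (π : DetPolicy X A H) (h : Fin H) {c : X × A → ℝ}
    {g : ℝ} (hc : ∀ z, |c z| ≤ g) :
    ∫ z, c z ∂(M.occ π.toPolicy h) = ∫ x, c (x, π h x) ∂(M.stateOcc π.toPolicy h) := by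
  rw [M.occ_eq_compProd, Measure.integral_compProd (by
    rw [← M.occ_eq_compProd]; exact integrable_of_abs_le hc)]
  refine integral_congr_ae (Filter.Eventually.of_forall fun x => ?_)
  simp only [DetPolicy.toPolicy, Kernel.deterministic_apply]
  exact integral_dirac _ _

/-- Under the greedy policy of `f` the residuals telescope to the predicted initial value minus
the return; under any other policy the telescoping sum is smaller. -/
theorem MDP.performance_difference (M : MDP X A H) {f : ValueFn X A H}
    (hf : ∀ h x a, f h x a ∈ Set.Icc (0 : ℝ) 1) {πf π : DetPolicy X A H}
    (hgr : ∀ h x a, f h x a ≤ f h x (πf h x)) :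
    M.J π.toPolicy - M.J πf.toPolicy ≤
      ∑ h, ∫ z, M.bellmanErr f h z ∂(M.occ πf.toPolicy h) -
        ∑ h, ∫ z, M.bellmanErr f h z ∂(M.occ π.toPolicy h) := by
  have hfa : ∀ h (z : X × A), |f h z.1 z.2| ≤ 1 := fun h z => by
    rw [abs_of_nonneg (hf _ _ _).1]; exact (hf _ _ _).2
  have hsup : ∀ h x, (⨆ a, f h x a) = f h x (πf h x) := fun h x => by
    have : Nonempty A := ⟨πf h x⟩
    exact le_antisymm (ciSup_le (hgr h x)) (le_ciSup (f := fun a => f h x a)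
      ⟨1, by rintro _ ⟨a, rfl⟩; exact (hf _ _ _).2⟩ (πf h x))
  let v : DetPolicy X A H → ℕ → ℝ := fun π k =>
    if hk : k < H then ∫ x, f ⟨k, hk⟩ x (πf ⟨k, hk⟩ x) ∂(M.stateOcc π.toPolicy ⟨k, hk⟩) else 0
  have hnext : ∀ (π : DetPolicy X A H) (h : Fin H),
      ∫ s, nextMax f h s.2.2 ∂(M.law π.toPolicy h) = v π (h + 1) := by
    intro π h
    simp only [v, nextMax]
    split_ifs with hh
    · rw [← M.map_law_next π.toPolicy h hh, integral_map
        (Measurable.aemeasurable (by fun_prop))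
        Measurable.of_discrete.aestronglyMeasurable]
      simp only [hsup]
    · simp
  have htel : ∀ π : DetPolicy X A H, ∑ h : Fin H, (v π h - v π (h + 1)) = v π 0 := by
    intro π
    rw [Fin.sum_univ_eq_sum_range (fun k => v π k - v π (k + 1)) H, Finset.sum_range_sub']
    simp [v]
  have hv0 : v π 0 = v πf 0 := by
    simp only [v]
    split_ifs with h0
    · rw [M.stateOcc_zero _ _ rfl, M.stateOcc_zero _ _ rfl]
    · rfl
  have hfg : ∀ h : Fin H, ∫ z, f h z.1 z.2 ∂(M.occ πf.toPolicy h) = v πf h := fun h => by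
    rw [M.integral_occ_det πf h (hfa h)]
    simp [v]
  have hfl : ∀ h : Fin H, ∫ z, f h z.1 z.2 ∂(M.occ π.toPolicy h) ≤ v π h := fun h => by
    rw [M.integral_occ_det π h (hfa h)]
    simp only [v, h.2, dif_pos]
    refine integral_mono ?_ ?_ fun x => hgr h x _
    · exact Integrable.of_bound Measurable.of_discrete.aestronglyMeasurable 1
        (Filter.Eventually.of_forall fun x => hfa h (x, π h x))
    · exact Integrable.of_bound Measurable.of_discrete.aestronglyMeasurable 1
        (Filter.Eventually.of_forall fun x => hfa h (x, πf h x))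
  have h1 : ∑ h, ∫ z, M.bellmanErr f h z ∂(M.occ πf.toPolicy h) = v πf 0 - M.J πf.toPolicy := by
    rw [M.J_eq_sum, ← htel, ← Finset.sum_sub_distrib]
    refine Finset.sum_congr rfl fun h _ => ?_
    rw [M.integral_bellmanErr_occ _ hf, hnext, hfg]; ring
  have h2 : ∑ h, ∫ z, M.bellmanErr f h z ∂(M.occ π.toPolicy h) ≤ v π 0 - M.J π.toPolicy := by
    rw [M.J_eq_sum, ← htel, ← Finset.sum_sub_distrib]
    refine Finset.sum_le_sum fun h _ => ?_
    rw [M.integral_bellmanErr_occ _ hf, hnext]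
    linarith [hfl h]
  linarith

end Bellman

/-! ### The Bellman equation of an optimal policy -/

section Optimal

variable {X A : Type*} [MeasurableSpace X] [MeasurableSpace A] {H : ℕ}

/-- A rollout from layer `H - n` only uses the actions at layers `H - n` and later. -/
theorem MDP.rollout_congr (M : MDP X A H) {π π' : Policy X A H} {n : ℕ} (hn : n ≤ H)
    (hπ : ∀ h : Fin H, H - n ≤ h → π.act h = π'.act h) : M.rollout π n hn = M.rollout π' n hn := by
  induction n with
  | zero => rfl
  | succ n ih =>
    have h1 := ih (by omega) fun h hh => hπ h (by omega)
    have h2 : M.step π ⟨H - (n + 1), by omega⟩ = M.step π' ⟨H - (n + 1), by omega⟩ := by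
      unfold MDP.step; rw [hπ _ le_rfl]
    ext x : 1
    refine Measure.ext_of_lintegral _ fun G hG => ?_
    rw [M.lintegral_rollout_succ π hn x hG, M.lintegral_rollout_succ π' hn x hG, h1, h2]

variable [DiscreteMeasurableSpace X] [Countable X]

theorem MDP.reward_mem_rollout (M : MDP X A H) (π : Policy X A H) {n : ℕ} (hn : n ≤ H)
    (i : Fin n) (x : X) :
    ∀ᵐ τ ∂(M.rollout π n hn x), (τ i).2.1 ∈ Set.Icc (0 : ℝ) 1 := by
  have hS : MeasurableSet {s : Transition X A | ¬ s.2.1 ∈ Set.Icc (0 : ℝ) 1} :=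
    ((measurable_fst.comp measurable_snd) measurableSet_Icc).compl
  have key := M.lintegral_rollout_apply π hn i x (measurable_one.indicator hS)
  have h0 : ∀ (k : Fin H) (y : X), ∫⁻ s, ({s : Transition X A | ¬ s.2.1 ∈ Set.Icc (0 : ℝ) 1}).indicator
      (1 : Transition X A → ℝ≥0∞) s ∂(M.step π k y) = 0 := fun k y => by
    rw [lintegral_indicator_one hS]
    exact M.reward_mem_step π k y
  simp only [h0, lintegral_zero] at key
  have hind : Measurable (fun τ : Fin n → Transition X A =>
      ({s : Transition X A | ¬ s.2.1 ∈ Set.Icc (0 : ℝ) 1}).indicator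
        (1 : Transition X A → ℝ≥0∞) (τ i)) :=
    (measurable_one.indicator hS).comp (measurable_pi_apply i)
  rw [lintegral_eq_zero_iff hind] at key
  filter_upwards [key] with τ hτ
  by_contra hc
  simp only [Set.indicator_apply, Set.mem_ofPred_eq, hc, not_false_eq_true, if_true,
    Pi.one_apply, Pi.zero_apply, one_ne_zero] at hτ

theorem MDP.integrable_reward_rollout (M : MDP X A H) (π : Policy X A H) {n : ℕ} (hn : n ≤ H)
    (i : Fin n) (x : X) :
    Integrable (fun τ : Fin n → Transition X A => (τ i).2.1) (M.rollout π n hn x) := by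
  refine Integrable.of_bound (C := 1)
    (measurable_fst.comp (measurable_snd.comp (measurable_pi_apply i))).aestronglyMeasurable ?_
  filter_upwards [M.reward_mem_rollout π hn i x] with τ hτ
  rw [Real.norm_eq_abs, abs_of_nonneg hτ.1]; exact hτ.2

theorem MDP.abs_valueToGo_le (M : MDP X A H) (π : Policy X A H) {n : ℕ} (hn : n ≤ H) (x : X) :
    |M.valueToGo π n hn x| ≤ n := by
  have h1 : ∀ᵐ τ ∂(M.rollout π n hn x), ‖∑ i, (τ i).2.1‖ ≤ (n : ℝ) := by
    filter_upwards [ae_all_iff.2 fun i => M.reward_mem_rollout π hn i x] with τ hτ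
    refine (norm_sum_le _ _).trans ?_
    calc ∑ i, ‖(τ i).2.1‖ ≤ ∑ _i : Fin n, (1 : ℝ) := Finset.sum_le_sum fun i _ => by
          rw [Real.norm_eq_abs, abs_of_nonneg (hτ i).1]; exact (hτ i).2
      _ = n := by simp
  have := norm_integral_le_of_norm_le_const h1
  simpa [MDP.valueToGo] using this

theorem MDP.valueToGo_succ (M : MDP X A H) (π : DetPolicy X A H) {n : ℕ} (hn : n + 1 ≤ H) (x : X) :
    M.valueToGo π.toPolicy (n + 1) hn x =
      (∫ r, r ∂(M.R ⟨H - (n + 1), by omega⟩ (x, π ⟨H - (n + 1), by omega⟩ x))) +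
        ∫ x', M.valueToGo π.toPolicy n (by omega) x'
          ∂(M.P ⟨H - (n + 1), by omega⟩ (x, π ⟨H - (n + 1), by omega⟩ x)) := by
  set h : Fin H := ⟨H - (n + 1), by omega⟩
  have hroll : M.rollout π.toPolicy (n + 1) hn = (M.step π.toPolicy h ⊗ₖ
      Kernel.prodMkLeft X ((M.rollout π.toPolicy n (by omega)).comap
        (fun s : Transition X A => s.2.2) (measurable_snd.comp measurable_snd))).map
        (fun q : Transition X A × (Fin n → Transition X A) =>
          (Fin.cons q.1 q.2 : Fin (n + 1) → Transition X A)) := rfl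
  have hV : Measurable (M.valueToGo π.toPolicy n (by omega)) := Measurable.of_discrete
  have hm := measurable_cons_transition (X := X) (A := A) n
  have hsum : Measurable (fun τ : Fin (n + 1) → Transition X A => ∑ i, (τ i).2.1) := by fun_prop
  have hint := integrable_finsetSum Finset.univ
    (fun i (_ : i ∈ Finset.univ) => M.integrable_reward_rollout π.toPolicy hn i x)
  have hint2 := hint
  unfold MDP.valueToGo
  rw [hroll, Kernel.map_apply _ hm] at hint2 ⊢
  rw [integrable_map_measure hsum.aestronglyMeasurable hm.aemeasurable] at hint2
  rw [integral_map hm.aemeasurable hsum.aestronglyMeasurable, ProbabilityTheory.integral_compProd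
    (f := fun q : Transition X A × (Fin n → Transition X A) =>
      ∑ i, ((Fin.cons q.1 q.2 : Fin (n + 1) → Transition X A) i).2.1) hint2]
  have inner : ∀ s : Transition X A, ∫ τ, ∑ i, ((Fin.cons s τ : Fin (n + 1) → Transition X A) i).2.1
      ∂(M.rollout π.toPolicy n (by omega) s.2.2) =
      s.2.1 + M.valueToGo π.toPolicy n (by omega) s.2.2 := by
    intro s
    simp only [Fin.sum_univ_succ, Fin.cons_zero, Fin.cons_succ]
    rw [integral_add (integrable_const _) (integrable_finsetSum _ fun i _ =>
      M.integrable_reward_rollout π.toPolicy _ i _)]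
    simp [MDP.valueToGo]
  refine Eq.trans (integral_congr_ae (Filter.Eventually.of_forall inner)) ?_
  have hstep : M.step π.toPolicy h x = (M.trans h (x, π h x)).map (fun q => ((x, π h x), q)) := by
    refine Measure.ext_of_lintegral _ fun G hG => ?_
    rw [M.lintegral_step _ h x hG, lintegral_map hG (by fun_prop)]
    simp only [DetPolicy.toPolicy, Kernel.deterministic_apply]
    have hGm : Measurable (fun z : X × A => ∫⁻ q, G (z, q) ∂(M.trans h z)) :=
      Measurable.lintegral_kernel_prod_right' hG
    exact lintegral_dirac' _ (hGm.comp measurable_prodMk_left)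
  have hVb := fun y => M.abs_valueToGo_le π.toPolicy (n := n) (by omega) y
  have hr : Integrable (fun q : ℝ × X => q.1) (M.trans h (x, π h x)) := by
    refine Integrable.of_bound measurable_fst.aestronglyMeasurable 1 ?_
    filter_upwards [M.reward_mem_trans h (x, π h x)] with q hq
    rw [Real.norm_eq_abs, abs_of_nonneg hq.1]; exact hq.2
  have hv : Integrable (fun q : ℝ × X => M.valueToGo π.toPolicy n (by omega) q.2)
      (M.trans h (x, π h x)) :=
    Integrable.of_bound (hV.comp measurable_snd).aestronglyMeasurable n
      (Filter.Eventually.of_forall fun q => hVb _)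
  rw [hstep, integral_map (Measurable.aemeasurable (by fun_prop))
    (f := fun s : Transition X A => s.2.1 + M.valueToGo π.toPolicy n (by omega) s.2.2)
    (Measurable.aestronglyMeasurable (by fun_prop)),
    integral_add hr hv]
  unfold MDP.trans
  rw [Kernel.prod_apply, integral_fun_fst (f := fun r : ℝ => r),
    integral_fun_snd (f := M.valueToGo π.toPolicy n (by omega))]
  simp [MDP.valueToGo]

theorem MDP.valueToGo_cast (M : MDP X A H) (π : Policy X A H) {m n : ℕ} (hmn : m = n)
    (hm : m ≤ H) (x : X) : M.valueToGo π m hm x = M.valueToGo π n (hmn ▸ hm) x := by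
  subst hmn; rfl

theorem MDP.V_eq_Q (M : MDP X A H) (π : DetPolicy X A H) (h : Fin H) (x : X) :
    M.V π.toPolicy h x = M.Q π.toPolicy h x (π h x) := by
  have hh := h.2
  have e : H - (h : ℕ) = H - (h + 1) + 1 := by omega
  have eh : (⟨H - (H - (h + 1) + 1), by omega⟩ : Fin H) = h := by ext; simp; omega
  unfold MDP.V MDP.Q
  rw [M.valueToGo_cast _ e, M.valueToGo_succ, eh]

/-- An optimal policy takes an action of maximal value: otherwise deviating once, at layer `h` and
state `x`, would improve on it. -/
theorem MDP.IsOptimal.Q_le_V {M : MDP X A H} {π : DetPolicy X A H} (hπ : M.IsOptimal π.toPolicy)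
    (h : Fin H) (x : X) (a : A) : M.Q π.toPolicy h x a ≤ M.V π.toPolicy h x := by
  classical
  let π' : DetPolicy X A H := fun k y => if k = h then a else π k y
  have h1 : M.V π'.toPolicy h x = M.Q π.toPolicy h x a := by
    rw [M.V_eq_Q]
    have ha : π' h x = a := by simp [π']
    unfold MDP.Q MDP.valueToGo
    rw [ha]
    have hr := M.rollout_congr (π := π'.toPolicy) (π' := π.toPolicy) (n := H - (h + 1))
      (Nat.sub_le _ _) (fun k hk => by
        have hne : k ≠ h := by rintro rfl; omega
        have : π' k = π k := by funext y; simp [π', hne]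
        simp [DetPolicy.toPolicy, this])
    rw [hr]
  rw [← h1]
  exact hπ _ h x

theorem MDP.IsOptimal.bellmanErr_Q {M : MDP X A H} {π : DetPolicy X A H}
    (hπ : M.IsOptimal π.toPolicy) (h : Fin H) (z : X × A) :
    M.bellmanErr (M.Q π.toPolicy) h z = 0 := by
  have hnext : ∀ x', nextMax (M.Q π.toPolicy) h x' =
      M.valueToGo π.toPolicy (H - (h + 1)) (Nat.sub_le _ _) x' := by
    intro x'
    unfold nextMax
    split_ifs with hh
    · have : Nonempty A := ⟨π ⟨h + 1, hh⟩ x'⟩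
      have hle := hπ.Q_le_V ⟨h + 1, hh⟩ x'
      change _ = M.V π.toPolicy ⟨h + 1, hh⟩ x'
      refine le_antisymm (ciSup_le hle) ?_
      rw [M.V_eq_Q]
      exact le_ciSup (f := fun a => M.Q π.toPolicy ⟨h + 1, hh⟩ x' a)
        ⟨_, by rintro _ ⟨a, rfl⟩; exact hle a⟩ _
    · rw [M.valueToGo_cast _ (show H - ((h : ℕ) + 1) = 0 by omega)]
      simp [MDP.valueToGo]
  unfold MDP.bellmanErr
  simp only [hnext]
  simp [MDP.Q]

end Optimal

/-! ### Exponential moments along a run -/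

section Moments

/-- The one-step exponential moment bound behind Bernstein's inequality. -/
theorem lintegral_exp_le {S : Type*} [MeasurableSpace S] {Λ : Measure S} [IsProbabilityMeasure Λ]
    {Z : S → ℝ} (hZ : Measurable Z) (hb : ∀ᵐ s ∂Λ, |Z s| ≤ 1) :
    ∫⁻ s, ENNReal.ofReal (Real.exp (Z s)) ∂Λ ≤
      ENNReal.ofReal (Real.exp ((∫ s, Z s ∂Λ) + ∫ s, Z s ^ 2 ∂Λ)) := by
  have i1 : Integrable Z Λ := Integrable.of_bound hZ.aestronglyMeasurable 1 hb
  have i2 : Integrable (fun s => Z s ^ 2) Λ := by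
    refine Integrable.of_bound (hZ.pow_const 2).aestronglyMeasurable 1 ?_
    filter_upwards [hb] with s hs
    rw [Real.norm_eq_abs, abs_of_nonneg (sq_nonneg _)]
    exact (sq_le_one_iff_abs_le_one _).2 hs
  have i3 : Integrable (fun s => 1 + Z s + Z s ^ 2) Λ := ((integrable_const 1).add i1).add i2
  have e : ∫ s, (1 + Z s + Z s ^ 2) ∂Λ = 1 + (∫ s, Z s ∂Λ) + ∫ s, Z s ^ 2 ∂Λ := by
    have e1 := integral_add ((integrable_const (μ := Λ) (1 : ℝ)).add i1) i2
    have e2 := integral_add (integrable_const (μ := Λ) (1 : ℝ)) i1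
    simp only [Pi.add_apply] at e1
    rw [e1, e2]; simp
  have hle : ∀ᵐ s ∂Λ, Real.exp (Z s) ≤ 1 + Z s + Z s ^ 2 := by
    filter_upwards [hb] with s hs
    have := (abs_le.1 (Real.abs_exp_sub_one_sub_id_le hs)).2
    linarith
  calc ∫⁻ s, ENNReal.ofReal (Real.exp (Z s)) ∂Λ
      ≤ ∫⁻ s, ENNReal.ofReal (1 + Z s + Z s ^ 2) ∂Λ := lintegral_mono_ae (by
        filter_upwards [hle] with s hs using ENNReal.ofReal_le_ofReal hs)
    _ = ENNReal.ofReal (∫ s, (1 + Z s + Z s ^ 2) ∂Λ) := (ofReal_integral_eq_lintegral_ofReal i3 (by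
        filter_upwards [hle] with s hs using (Real.exp_pos _).le.trans hs)).symm
    _ ≤ _ := ENNReal.ofReal_le_ofReal (by
        rw [e]
        linarith [Real.add_one_le_exp ((∫ s, Z s ∂Λ) + ∫ s, Z s ^ 2 ∂Λ)])

/-- A function that only takes finitely many values is measurable after any post-composition. -/
theorem measurable_comp_of_mem_finset {Ω Y Z : Type*} {m : MeasurableSpace Ω} [MeasurableSpace Y]
    [MeasurableSingletonClass Y] [MeasurableSpace Z] {f : Ω → Y} (hf : Measurable f) (F : Finset Y)
    (hF : ∀ ω, f ω ∈ F) (k : Y → Z) : Measurable (fun ω => k (f ω)) := by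
  classical
  intro S _
  have : (fun ω => k (f ω)) ⁻¹' S = f ⁻¹' ((F.filter fun y => k y ∈ S : Finset Y) : Set Y) := by
    ext ω; simp [hF ω]
  rw [this]
  exact hf (Finset.measurableSet _)

end Moments

section RunMoments

variable {X A : Type*} [MeasurableSpace X] [MeasurableSpace A] [DiscreteMeasurableSpace X]
  [Countable X] [DiscreteMeasurableSpace A] [Countable A] {H : ℕ}
  {M : MDP X A H} {ν : Fin H → ProbabilityMeasure (X × A)}
  {F : Finset (ValueFn X A H)} {W : Finset (WeightFn X A H)}
  {greedy : ValueFn X A H → DetPolicy X A H} {T : ℕ} {γ : ℝ}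
  {Ω : Type*} [mΩ : MeasurableSpace Ω] {Pr : Measure Ω} [IsProbabilityMeasure Pr]
  {off : Fin T → Fin H → Ω → Transition X A} {f : Fin T → Ω → ValueFn X A H}
  {on : Fin T → Ω → Fin H → Transition X A}

instance (h : Fin H) : IsProbabilityMeasure (M.sampleLaw ν h) := by
  unfold MDP.sampleLaw; infer_instance

theorem IsHyGlowRun.history_le (run : IsHyGlowRun M ν F W greedy T γ Pr off f on) (t : Fin T) :
    history off on f t ≤ mΩ := by
  refine sup_le (sup_le ?_ ?_) ?_
  · exact iSup_le fun i => iSup_le fun h => (run.off_measurable i h).comap_le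
  · exact iSup_le fun i => iSup_le fun _ => (run.on_measurable i).comap_le
  · exact iSup_le fun i => iSup_le fun _ => (run.f_measurable i).comap_le

theorem measurable_off_history (t i : Fin T) (h : Fin H) :
    Measurable[history off on f t] (off i h) := by
  rw [measurable_iff_comap_le]
  exact (le_iSup₂ (f := fun i h => MeasurableSpace.comap (off i h) inferInstance) i h).trans
    (le_sup_left.trans le_sup_left)

theorem measurable_on_history {t i : Fin T} (hi : i < t) :
    Measurable[history off on f t] (on i) := by
  rw [measurable_iff_comap_le]
  exact (le_iSup₂ (f := fun i (_ : i ∈ Set.Iio t) => MeasurableSpace.comap (on i) inferInstance)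
    i hi).trans (le_sup_right.trans le_sup_left)

theorem measurable_f_history {t i : Fin T} (hi : i ≤ t) :
    Measurable[history off on f t] (f i) := by
  rw [measurable_iff_comap_le]
  exact (le_iSup₂ (f := fun i (_ : i ∈ Set.Iic t) => MeasurableSpace.comap (f i) inferInstance)
    i hi).trans le_sup_right

/-- Conditioning on the history: the new trajectory may be averaged out. -/
theorem IsHyGlowRun.lintegral_mul_online (run : IsHyGlowRun M ν F W greedy T γ Pr off f on)
    (t : Fin T) {U : Ω → ℝ≥0∞} (hU : Measurable[history off on f t] U)
    {G : (Fin H → Transition X A) → ℝ≥0∞} (hG : Measurable G) :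
    ∫⁻ ω, U ω * G (on t ω) ∂Pr =
      ∫⁻ ω, U ω * ∫⁻ τ, G τ ∂(M.traj (greedy (f t ω)).toPolicy) ∂Pr := by
  have hle := run.history_le t
  have hU' : Measurable U := hU.mono hle le_rfl
  have hκ : Measurable (fun ω => M.traj (greedy (f t ω)).toPolicy) :=
    measurable_comp_of_mem_finset (run.f_measurable t) F (fun ω => (run.f_mabo t ω).1)
      (fun f => M.traj (greedy f).toPolicy)
  have hB : ∀ B, MeasurableSet B → ∫⁻ ω in on t ⁻¹' B, U ω ∂Pr =
      ∫⁻ ω, U ω * M.traj (greedy (f t ω)).toPolicy B ∂Pr := by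
    intro B hB
    have hκB : Measurable (fun ω => M.traj (greedy (f t ω)).toPolicy B) :=
      (Measure.measurable_coe hB).comp hκ
    have hm : (Pr.restrict (on t ⁻¹' B)).trim hle =
        (Pr.withDensity fun ω => M.traj (greedy (f t ω)).toPolicy B).trim hle := by
      refine @Measure.ext _ (history off on f t) _ _ fun E hE => ?_
      rw [trim_measurableSet_eq hle hE, trim_measurableSet_eq hle hE,
        Measure.restrict_apply (hle _ hE), withDensity_apply _ (hle _ hE)]
      exact run.on_law t B hB E hE
    rw [← lintegral_trim hle hU, hm, lintegral_trim hle hU,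
      lintegral_withDensity_eq_lintegral_mul _ hκB hU']
    exact lintegral_congr fun ω => mul_comm _ _
  have hmeas : (Pr.withDensity U).map (on t) =
      (Pr.withDensity U).bind (fun ω => M.traj (greedy (f t ω)).toPolicy) := by
    ext B hBm
    have hκB : Measurable (fun ω => M.traj (greedy (f t ω)).toPolicy B) :=
      (Measure.measurable_coe hBm).comp hκ
    rw [Measure.map_apply (run.on_measurable t) hBm, Measure.bind_apply hBm hκ.aemeasurable,
      withDensity_apply _ (run.on_measurable t hBm), hB B hBm,
      lintegral_withDensity_eq_lintegral_mul _ hU' hκB]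
    rfl
  have h1 := lintegral_map (μ := Pr.withDensity U) hG (run.on_measurable t)
  rw [hmeas, Measure.lintegral_bind hκ.aemeasurable hG.aemeasurable] at h1
  have hκG : Measurable (fun ω => ∫⁻ τ, G τ ∂(M.traj (greedy (f t ω)).toPolicy)) :=
    (Measure.measurable_lintegral hG).comp hκ
  rw [lintegral_withDensity_eq_lintegral_mul _ hU' hκG,
    lintegral_withDensity_eq_lintegral_mul _ hU' (g := fun ω => G (on t ω))
      (hG.comp (run.on_measurable t))] at h1
  exact h1.symm

/-- The exponential supermartingale of a run. The offline samples enter through independence, and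
the online samples are peeled off one round at a time. -/
theorem IsHyGlowRun.lintegral_prod_exp_le (run : IsHyGlowRun M ν F W greedy T γ Pr off f on)
    (t : Fin T) (h : Fin H) {φ : Transition X A → ℝ} (hφ : Measurable φ) {bν : ℝ}
    (hoff : ∫⁻ s, ENNReal.ofReal (Real.exp (φ s)) ∂(M.sampleLaw ν h) ≤
      ENNReal.ofReal (Real.exp bν)) {bp : ValueFn X A H → ℝ}
    (hon : ∀ f ∈ F, ∫⁻ s, ENNReal.ofReal (Real.exp (φ s)) ∂(M.law (greedy f).toPolicy h) ≤
      ENNReal.ofReal (Real.exp (bp f))) :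
    ∫⁻ ω, (∏ i ∈ Finset.Iio t, ENNReal.ofReal (Real.exp (φ (off i h ω) - bν))) *
      ∏ i ∈ Finset.Iio t, ENNReal.ofReal (Real.exp (φ (on i ω h) - bp (f i ω))) ∂Pr ≤ 1 := by
  classical
  have hsub : ∀ a b : ℝ, ENNReal.ofReal (Real.exp (a - b)) =
      ENNReal.ofReal (Real.exp (-b)) * ENNReal.ofReal (Real.exp a) := fun a b => by
    rw [← ENNReal.ofReal_mul (Real.exp_pos _).le, ← Real.exp_add]; congr 2; ring
  have hcancel : ∀ b : ℝ, ENNReal.ofReal (Real.exp (-b)) * ENNReal.ofReal (Real.exp b) = 1 :=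
    fun b => by rw [← hsub]; simp
  have hD : ∫⁻ ω, ∏ i ∈ Finset.Iio t, ENNReal.ofReal (Real.exp (φ (off i h ω) - bν)) ∂Pr ≤ 1 := by
    have hg : Measurable (fun s : Transition X A => ENNReal.ofReal (Real.exp (φ s - bν))) := by
      fun_prop
    have hind := (run.off_indep h).comp (fun _ s => ENNReal.ofReal (Real.exp (φ s - bν)))
      (fun _ => hg)
    have := lintegral_prod_eq_prod_lintegral_of_indepFun (Finset.Iio t) _ hind
      (fun i => hg.comp (run.off_measurable i h))
    simp only [Function.comp] at this
    rw [this]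
    refine Finset.prod_le_one' fun i _ => ?_
    rw [← lintegral_map (μ := Pr) hg (run.off_measurable i h), run.off_law]
    simp only [hsub]
    rw [lintegral_const_mul _ (by fun_prop)]
    exact (mul_le_mul_right hoff _).trans (hcancel bν).le
  have key : ∀ k : ℕ, k ≤ T →
      ∫⁻ ω, (∏ i ∈ Finset.Iio t, ENNReal.ofReal (Real.exp (φ (off i h ω) - bν))) *
        ∏ i ∈ Finset.univ.filter (fun i : Fin T => (i : ℕ) < k),
          ENNReal.ofReal (Real.exp (φ (on i ω h) - bp (f i ω))) ∂Pr ≤ 1 := by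
    intro k
    induction k with
    | zero => intro _; simpa using hD
    | succ k ih =>
      intro hk
      set s : Fin T := ⟨k, by omega⟩ with hs
      have hins : Finset.univ.filter (fun i : Fin T => (i : ℕ) < k + 1) =
          insert s (Finset.univ.filter (fun i : Fin T => (i : ℕ) < k)) := by
        ext i; simp [hs, Fin.ext_iff]; omega
      have hnot : s ∉ Finset.univ.filter (fun i : Fin T => (i : ℕ) < k) := by simp [hs]
      set U : Ω → ℝ≥0∞ := fun ω =>
        (∏ i ∈ Finset.Iio t, ENNReal.ofReal (Real.exp (φ (off i h ω) - bν))) *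
        ∏ i ∈ Finset.univ.filter (fun i : Fin T => (i : ℕ) < k),
          ENNReal.ofReal (Real.exp (φ (on i ω h) - bp (f i ω))) with hUdef
      have hbp : ∀ i ≤ s, Measurable[history off on f s] (fun ω => bp (f i ω)) := fun i hi =>
        measurable_comp_of_mem_finset (m := history off on f s) (measurable_f_history hi) F
          (fun ω => (run.f_mabo i ω).1) bp
      have hU : Measurable[history off on f s] U := by
        refine Measurable.mul ?_ ?_
        · refine Finset.measurable_fun_prod _ fun i _ => ?_
          exact ENNReal.measurable_ofReal.comp (Real.measurable_exp.comp
            ((hφ.comp (measurable_off_history s i h)).sub_const _))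
        · refine Finset.measurable_fun_prod _ fun i hi => ?_
          have hi' : i < s := by simpa [hs, Fin.lt_def] using hi
          exact ENNReal.measurable_ofReal.comp (Real.measurable_exp.comp
            ((hφ.comp ((measurable_pi_apply h).comp (measurable_on_history hi'))).sub
              (hbp i hi'.le)))
      have hUb : Measurable[history off on f s]
          (fun ω => U ω * ENNReal.ofReal (Real.exp (-bp (f s ω)))) :=
        hU.mul (ENNReal.measurable_ofReal.comp (Real.measurable_exp.comp (hbp s le_rfl).neg))
      calc _ = ∫⁻ ω, (U ω * ENNReal.ofReal (Real.exp (-bp (f s ω)))) *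
            ENNReal.ofReal (Real.exp (φ (on s ω h))) ∂Pr := by
            refine lintegral_congr fun ω => ?_
            rw [hins, Finset.prod_insert hnot, hsub (φ (on s ω h)), hUdef]
            ring
        _ = ∫⁻ ω, (U ω * ENNReal.ofReal (Real.exp (-bp (f s ω)))) *
            ∫⁻ τ, ENNReal.ofReal (Real.exp (φ (τ h))) ∂(M.traj (greedy (f s ω)).toPolicy) ∂Pr :=
            run.lintegral_mul_online s hUb
              (G := fun τ => ENNReal.ofReal (Real.exp (φ (τ h)))) (by fun_prop)
        _ ≤ ∫⁻ ω, U ω ∂Pr := by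
            refine lintegral_mono fun ω => ?_
            have h1 := hon _ (run.f_mabo s ω).1
            rw [M.lintegral_law _ h (by fun_prop)] at h1
            calc _ ≤ (U ω * ENNReal.ofReal (Real.exp (-bp (f s ω)))) *
                  ENNReal.ofReal (Real.exp (bp (f s ω))) := by gcongr
              _ = U ω := by rw [mul_assoc, hcancel, mul_one]
        _ ≤ 1 := ih (by omega)
  have := key t t.2.le
  have hset : Finset.univ.filter (fun i : Fin T => (i : ℕ) < t) = Finset.Iio t := by
    ext i; simp
  rwa [hset] at this

/-- Chernoff bound for the hybrid data of one round. -/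
theorem IsHyGlowRun.measure_sum_ge_le (run : IsHyGlowRun M ν F W greedy T γ Pr off f on)
    (t : Fin T) (h : Fin H) {φ : Transition X A → ℝ} (hφ : Measurable φ) {bν : ℝ}
    (hoff : ∫⁻ s, ENNReal.ofReal (Real.exp (φ s)) ∂(M.sampleLaw ν h) ≤
      ENNReal.ofReal (Real.exp bν)) {bp : ValueFn X A H → ℝ}
    (hon : ∀ f ∈ F, ∫⁻ s, ENNReal.ofReal (Real.exp (φ s)) ∂(M.law (greedy f).toPolicy h) ≤
      ENNReal.ofReal (Real.exp (bp f))) (β : ℝ) :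
    Pr {ω | ∑ i ∈ Finset.Iio t, (bν + bp (f i ω)) + β ≤
      ∑ i ∈ Finset.Iio t, (φ (off i h ω) + φ (on i ω h))} ≤ ENNReal.ofReal (Real.exp (-β)) := by
  have h1 := run.lintegral_prod_exp_le t h hφ hoff hon
  set Y : Ω → ℝ := fun ω => ∑ i ∈ Finset.Iio t, (φ (off i h ω) + φ (on i ω h)) -
    ∑ i ∈ Finset.Iio t, (bν + bp (f i ω)) with hY
  have e : ∀ ω, (∏ i ∈ Finset.Iio t, ENNReal.ofReal (Real.exp (φ (off i h ω) - bν))) *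
      ∏ i ∈ Finset.Iio t, ENNReal.ofReal (Real.exp (φ (on i ω h) - bp (f i ω))) =
      ENNReal.ofReal (Real.exp (Y ω)) := by
    intro ω
    rw [← ENNReal.ofReal_prod_of_nonneg fun i _ => (Real.exp_pos _).le,
      ← ENNReal.ofReal_prod_of_nonneg fun i _ => (Real.exp_pos _).le,
      ← ENNReal.ofReal_mul (Finset.prod_nonneg fun i _ => (Real.exp_pos _).le),
      ← Real.exp_sum, ← Real.exp_sum, ← Real.exp_add]
    simp only [hY, Finset.sum_sub_distrib, Finset.sum_add_distrib]
    congr 2; ring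
  simp only [e] at h1
  have hYm : Measurable Y := by
    refine Measurable.sub ?_ ?_
    · refine Finset.measurable_fun_sum _ fun i _ => ?_
      exact (hφ.comp (run.off_measurable i h)).add
        (hφ.comp ((measurable_pi_apply h).comp (run.on_measurable i)))
    · refine Finset.measurable_fun_sum _ fun i _ => ?_
      exact measurable_const.add (measurable_comp_of_mem_finset (run.f_measurable i) F
        (fun ω => (run.f_mabo i ω).1) bp)
  have hM := mul_meas_ge_le_lintegral (μ := Pr)
    (f := fun ω => ENNReal.ofReal (Real.exp (Y ω))) (by fun_prop) (ENNReal.ofReal (Real.exp β))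
  have hset : {ω | ∑ i ∈ Finset.Iio t, (bν + bp (f i ω)) + β ≤
      ∑ i ∈ Finset.Iio t, (φ (off i h ω) + φ (on i ω h))} ⊆
      {ω | ENNReal.ofReal (Real.exp β) ≤ ENNReal.ofReal (Real.exp (Y ω))} := by
    intro ω hω
    refine ENNReal.ofReal_le_ofReal (Real.exp_le_exp.2 ?_)
    have : ∑ i ∈ Finset.Iio t, (bν + bp (f i ω)) + β ≤
      ∑ i ∈ Finset.Iio t, (φ (off i h ω) + φ (on i ω h)) := hω
    simp only [hY]; linarith
  refine (measure_mono hset).trans ?_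
  have h2 := hM.trans h1
  have hpos : ENNReal.ofReal (Real.exp (-β)) * ENNReal.ofReal (Real.exp β) = 1 := by
    rw [← ENNReal.ofReal_mul (Real.exp_pos _).le, ← Real.exp_add]; simp
  calc _ = ENNReal.ofReal (Real.exp (-β)) * (ENNReal.ofReal (Real.exp β) *
        Pr {ω | ENNReal.ofReal (Real.exp β) ≤ ENNReal.ofReal (Real.exp (Y ω))}) := by
        rw [← mul_assoc, hpos, one_mul]
    _ ≤ ENNReal.ofReal (Real.exp (-β)) * 1 := by gcongr
    _ = _ := mul_one _

end RunMoments

/-! ### Uniform concentration of the hybrid data -/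

section Clip

variable {X A : Type*} {H : ℕ}

theorem clip_mem {g : ℝ} (hg : 0 ≤ g) (x : ℝ≥0∞) : clip g (x : EReal) ∈ Set.Icc 0 g := by
  have hx : (0 : EReal) ≤ x := EReal.coe_ennreal_nonneg x
  have hg' : (0 : EReal) ≤ (g : EReal) := by exact_mod_cast hg
  unfold clip
  have h1 : (0 : EReal) ≤ max (-(g : EReal)) (min (x : EReal) g) := le_max_of_le_right (le_min hx hg')
  have h2 : max (-(g : EReal)) (min (x : EReal) g) ≤ g := by
    refine max_le ?_ (min_le_right _ _)
    have : -(g : EReal) ≤ 0 := by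
      rw [← EReal.coe_neg]; exact_mod_cast (neg_nonpos.2 hg)
    exact this.trans hg'
  refine ⟨EReal.toReal_nonneg h1, ?_⟩
  exact EReal.toReal_le_toReal h2 (ne_of_gt (lt_of_lt_of_le EReal.bot_lt_zero h1))
    (EReal.coe_ne_top g)

theorem clip_ofReal {g x : ℝ} (hg : 0 ≤ g) (hx : 0 ≤ x) :
    clip g ((ENNReal.ofReal x : ℝ≥0∞) : EReal) = min x g := by
  unfold clip
  rw [EReal.coe_ennreal_ofReal, max_eq_left hx, ← EReal.coe_strictMono.monotone.map_min, ← EReal.coe_neg,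
    ← EReal.coe_strictMono.monotone.map_max,
    EReal.toReal_coe, max_eq_right]
  exact (neg_nonpos.2 hg).trans (le_min hx hg)

theorem clip_neg (g : ℝ) (hg : 0 ≤ g) (x : EReal) : clip g (-x) = -clip g x := by
  unfold clip
  rw [← EReal.toReal_neg_eq]
  congr 1
  have h : -(g : EReal) ≤ g := by
    rw [← EReal.coe_neg]; exact_mod_cast (by linarith : -g ≤ g)
  rw [← EReal.min_neg_neg, ← EReal.max_neg_neg, neg_neg, max_min_distrib_left, max_eq_right h,
    min_comm, max_comm]

theorem clip_zero {g : ℝ} (hg : 0 ≤ g) : clip g 0 = 0 := by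
  have := clip_ofReal hg (le_refl (0 : ℝ))
  simpa [hg] using this

/-- The clipped weight function as a real function on state-action pairs. -/
def WeightFn.clipped (w : WeightFn X A H) (g : ℝ) (h : Fin H) (z : X × A) : ℝ :=
  clip g (w h z.1 z.2 : EReal)

theorem WeightFn.abs_clipped_le (w : WeightFn X A H) {g : ℝ} (hg : 0 ≤ g) (h : Fin H) (z : X × A) :
    |w.clipped g h z| ≤ g := by
  have := clip_mem hg (w h z.1 z.2)
  unfold WeightFn.clipped
  rw [abs_of_nonneg this.1]; exact this.2

end Clip

section Concentration

variable {X A : Type*} [MeasurableSpace X] [MeasurableSpace A] [DiscreteMeasurableSpace X]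
  [Countable X] [DiscreteMeasurableSpace A] [Countable A] {H : ℕ}

theorem MDP.integral_fst_compProd (M : MDP X A H) (h : Fin H) (μ : Measure (X × A))
    [IsProbabilityMeasure μ] (c : X × A → ℝ) :
    ∫ s, c s.1 ∂(μ ⊗ₘ M.trans h) = ∫ z, c z ∂μ := by
  have hc : Measurable c := Measurable.of_discrete
  conv_rhs => rw [← Measure.fst_compProd μ (M.trans h)]
  rw [Measure.fst, integral_map measurable_fst.aemeasurable hc.aestronglyMeasurable]

theorem MDP.lintegral_exp_weighted_residual_le (M : MDP X A H) {f : ValueFn X A H}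
    (hf : ∀ h x a, f h x a ∈ Set.Icc (0 : ℝ) 1) (h : Fin H) (μ : Measure (X × A))
    [IsProbabilityMeasure μ] {c : X × A → ℝ} {g : ℝ} (hg : 0 < g) (hc : ∀ z, |c z| ≤ g)
    {σ : ℝ} (hσ : |σ| = 1) :
    ∫⁻ s, ENNReal.ofReal (Real.exp (σ * (c s.1 * residual f h s) / (2 * g)))
        ∂(μ ⊗ₘ M.trans h) ≤
      ENNReal.ofReal (Real.exp (σ * (∫ z, c z * M.bellmanErr f h z ∂μ) / (2 * g) +
        (∫ z, c z ^ 2 ∂μ) / g ^ 2)) := by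
  have hcm : Measurable c := Measurable.of_discrete
  have hrm := measurable_residual (X := X) (A := A) f h
  have hZm : Measurable (fun s : Transition X A => σ * (c s.1 * residual f h s) / (2 * g)) := by
    fun_prop
  have hb : ∀ᵐ s ∂(μ ⊗ₘ M.trans h), |c s.1 * residual f h s| ≤ |c s.1| * 2 := by
    filter_upwards [M.reward_mem_compProd h μ] with s hs
    rw [abs_mul]
    exact mul_le_mul_of_nonneg_left (abs_residual_le hf h hs) (abs_nonneg _)
  have hb1 : ∀ᵐ s ∂(μ ⊗ₘ M.trans h), |σ * (c s.1 * residual f h s) / (2 * g)| ≤ 1 := by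
    filter_upwards [hb] with s hs
    rw [abs_div, abs_mul, hσ, one_mul, abs_of_pos (by positivity : 0 < 2 * g), div_le_one
      (by positivity)]
    linarith [hc s.1]
  refine (lintegral_exp_le hZm hb1).trans (ENNReal.ofReal_le_ofReal (Real.exp_le_exp.2 ?_))
  refine add_le_add ?_ ?_
  · rw [integral_div, integral_const_mul, M.integral_mul_residual hf h μ hc]
  · rw [← M.integral_fst_compProd h μ (fun z => c z ^ 2), ← integral_div]
    refine integral_mono_of_nonneg (Filter.Eventually.of_forall fun s => sq_nonneg _) ?_ ?_
    · refine Integrable.of_bound (C := 1) (Measurable.aestronglyMeasurable (by fun_prop))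
        (Filter.Eventually.of_forall fun s => ?_)
      rw [Real.norm_eq_abs, abs_of_nonneg (by positivity), div_le_one (by positivity), sq_le_sq,
        abs_of_pos hg]
      exact hc s.1
    · filter_upwards [hb] with s hs
      have hσ2 : σ ^ 2 = 1 := by rw [← sq_abs, hσ, one_pow]
      have h2 : (c s.1 * residual f h s) ^ 2 ≤ 4 * c s.1 ^ 2 := by
        have := pow_le_pow_left₀ (abs_nonneg _) hs 2
        rw [sq_abs, mul_pow |c s.1|, sq_abs] at this
        linarith
      rw [div_pow, mul_pow, hσ2, one_mul, div_le_div_iff₀ (by positivity) (by positivity)]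
      nlinarith [sq_nonneg g]

theorem MDP.lintegral_exp_sq_le (M : MDP X A H) (h : Fin H) (μ : Measure (X × A))
    [IsProbabilityMeasure μ] {c : X × A → ℝ} {g : ℝ} (hg : 0 < g) (hc : ∀ z, |c z| ≤ g)
    {σ : ℝ} (hσ : |σ| = 1) :
    ∫⁻ s, ENNReal.ofReal (Real.exp (σ * c s.1 ^ 2 / (2 * g ^ 2))) ∂(μ ⊗ₘ M.trans h) ≤
      ENNReal.ofReal (Real.exp ((σ + 1 / 2) * (∫ z, c z ^ 2 ∂μ) / (2 * g ^ 2))) := by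
  have hcm : Measurable c := Measurable.of_discrete
  have hZm : Measurable (fun s : Transition X A => σ * c s.1 ^ 2 / (2 * g ^ 2)) := by
    fun_prop
  have hsq : ∀ z, c z ^ 2 ≤ g ^ 2 := fun z => by
    rw [sq_le_sq, abs_of_pos hg]; exact hc z
  have hb1 : ∀ s : Transition X A, |σ * c s.1 ^ 2 / (2 * g ^ 2)| ≤ 1 := fun s => by
    rw [abs_div, abs_mul, hσ, one_mul, abs_of_pos (by positivity : 0 < 2 * g ^ 2), div_le_one
      (by positivity), abs_of_nonneg (sq_nonneg _)]
    nlinarith [hsq s.1, sq_nonneg g]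
  refine (lintegral_exp_le hZm (Filter.Eventually.of_forall hb1)).trans
    (ENNReal.ofReal_le_ofReal (Real.exp_le_exp.2 ?_))
  have e : (σ + 1 / 2) * (∫ z, c z ^ 2 ∂μ) / (2 * g ^ 2) =
      σ * (∫ z, c z ^ 2 ∂μ) / (2 * g ^ 2) + (∫ z, c z ^ 2 ∂μ) / (4 * g ^ 2) := by
    field_simp; ring
  rw [e]
  refine add_le_add ?_ ?_
  · rw [integral_div, integral_const_mul, M.integral_fst_compProd h μ (fun z => c z ^ 2)]
  · rw [← M.integral_fst_compProd h μ (fun z => c z ^ 2), ← integral_div]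
    refine integral_mono_of_nonneg (Filter.Eventually.of_forall fun s => sq_nonneg _) ?_ ?_
    · refine Integrable.of_bound (C := 1) (Measurable.aestronglyMeasurable (by fun_prop))
        (Filter.Eventually.of_forall fun s => ?_)
      rw [Real.norm_eq_abs, abs_of_nonneg (by positivity), div_le_one (by positivity)]
      nlinarith [hsq s.1, sq_nonneg g]
    · refine Filter.Eventually.of_forall fun s => ?_
      have hσ2 : σ ^ 2 = 1 := by rw [← sq_abs, hσ, one_pow]
      simp only
      rw [div_pow, mul_pow, hσ2, one_mul, div_le_div_iff₀ (by positivity) (by positivity)]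
      have h3 : c s.1 ^ 2 * c s.1 ^ 2 ≤ c s.1 ^ 2 * g ^ 2 :=
        mul_le_mul_of_nonneg_left (hsq s.1) (sq_nonneg _)
      have h4 := mul_le_mul_of_nonneg_right h3 (by positivity : 0 ≤ 4 * g ^ 2)
      nlinarith [h4]

/-- The conditional mean of the hybrid data of round `t`: the population counterpart of
`hybridMean`, for functions of the state-action pair. -/
def MDP.hybridAvg (M : MDP X A H) (ν : Fin H → ProbabilityMeasure (X × A)) {T : ℕ}
    (πs : Fin T → DetPolicy X A H) (t : Fin T) (h : Fin H) (ψ : X × A → ℝ) : ℝ :=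
  (∑ i ∈ Finset.Iio t, ((∫ z, ψ z ∂(ν h : Measure (X × A))) +
    ∫ z, ψ z ∂(M.occ (πs i).toPolicy h))) / (2 * (t : ℕ))

/-- The event of round `t` on which the empirical weighted residuals and the empirical second
moments of the clipped weights are close to their population counterparts, for all `f`, `w` and
`h`. -/
def MDP.GoodRound (M : MDP X A H) (ν : Fin H → ProbabilityMeasure (X × A))
    (F : Finset (ValueFn X A H)) (W : Finset (WeightFn X A H)) {T : ℕ}
    (off on : Fin T → Fin H → Transition X A) (πs : Fin T → DetPolicy X A H) (t : Fin T)
    (g β : ℝ) : Prop :=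
  ∀ f ∈ F, ∀ w ∈ W, ∀ h,
    |hybridMean (fun i => off i h) (fun i => on i h) t
        (fun s => w.clipped g h s.1 * residual f h s) -
        M.hybridAvg ν πs t h (fun z => w.clipped g h z * M.bellmanErr f h z)| ≤
      2 / g * M.hybridAvg ν πs t h (fun z => w.clipped g h z ^ 2) + g * β / (t : ℕ) ∧
    M.hybridAvg ν πs t h (fun z => w.clipped g h z ^ 2) / 2 - g ^ 2 * β / (t : ℕ) ≤
      hybridMean (fun i => off i h) (fun i => on i h) t (fun s => w.clipped g h s.1 ^ 2) ∧
    hybridMean (fun i => off i h) (fun i => on i h) t (fun s => w.clipped g h s.1 ^ 2) ≤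
      3 / 2 * M.hybridAvg ν πs t h (fun z => w.clipped g h z ^ 2) + g ^ 2 * β / (t : ℕ)

variable {M : MDP X A H} {ν : Fin H → ProbabilityMeasure (X × A)}
  {F : Finset (ValueFn X A H)} {W : Finset (WeightFn X A H)}
  {greedy : ValueFn X A H → DetPolicy X A H} {T : ℕ} {γ : ℝ}
  {Ω : Type*} [mΩ : MeasurableSpace Ω] {Pr : Measure Ω} [IsProbabilityMeasure Pr]
  {off : Fin T → Fin H → Ω → Transition X A} {f : Fin T → Ω → ValueFn X A H}
  {on : Fin T → Ω → Fin H → Transition X A}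

theorem IsHyGlowRun.measure_sum_ge_le_of_compProd
    (run : IsHyGlowRun M ν F W greedy T γ Pr off f on)
    (t : Fin T) (h : Fin H) {φ : Transition X A → ℝ} (hφ : Measurable φ)
    (b : Measure (X × A) → ℝ) (hb : ∀ (μ : Measure (X × A)) [IsProbabilityMeasure μ],
      ∫⁻ s, ENNReal.ofReal (Real.exp (φ s)) ∂(μ ⊗ₘ M.trans h) ≤ ENNReal.ofReal (Real.exp (b μ)))
    (β : ℝ) :
    Pr {ω | ∑ i ∈ Finset.Iio t, (b (ν h) + b (M.occ (greedy (f i ω)).toPolicy h)) + β ≤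
      ∑ i ∈ Finset.Iio t, (φ (off i h ω) + φ (on i ω h))} ≤ ENNReal.ofReal (Real.exp (-β)) :=
  run.measure_sum_ge_le t h hφ (bν := b (ν h))
    (bp := fun f => b (M.occ (greedy f).toPolicy h)) (hb _)
    (fun f _ => by rw [M.law_eq_compProd]; exact hb _) β

theorem IsHyGlowRun.measure_not_good_le (run : IsHyGlowRun M ν F W greedy T γ Pr off f on)
    (hF : ∀ f ∈ F, ∀ h x a, f h x a ∈ Set.Icc (0 : ℝ) 1) (t : Fin T) (ht : 0 < (t : ℕ))
    {g : ℝ} (hg : 0 < g) (β : ℝ) :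
    Pr {ω | ¬ M.GoodRound ν F W (fun i h => off i h ω) (fun i => on i ω)
      (fun i => greedy (f i ω)) t g β} ≤
      (F.card * W.card * H * 4 : ℕ) * ENNReal.ofReal (Real.exp (-β)) := by
  classical
  have htR : (0 : ℝ) < (t : ℕ) := by exact_mod_cast ht
  -- the four families of exceptional events, with exponents `±Z / (2 g)` and `±c² / (2 g²)`
  let R : ℝ → ValueFn X A H → WeightFn X A H → Fin H → Set Ω := fun σ f' w h =>
    {ω | ∑ i ∈ Finset.Iio t, ((σ * (∫ z, w.clipped g h z * M.bellmanErr f' h z ∂(ν h : Measure _))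
          / (2 * g) + (∫ z, w.clipped g h z ^ 2 ∂(ν h : Measure _)) / g ^ 2) +
        (σ * (∫ z, w.clipped g h z * M.bellmanErr f' h z
          ∂(M.occ (greedy (f i ω)).toPolicy h)) / (2 * g) +
          (∫ z, w.clipped g h z ^ 2 ∂(M.occ (greedy (f i ω)).toPolicy h)) / g ^ 2)) + β ≤
      ∑ i ∈ Finset.Iio t,
        (σ * (w.clipped g h (off i h ω).1 * residual f' h (off i h ω)) / (2 * g) +
         σ * (w.clipped g h (on i ω h).1 * residual f' h (on i ω h)) / (2 * g))}
  let S : ℝ → WeightFn X A H → Fin H → Set Ω := fun σ w h =>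
    {ω | ∑ i ∈ Finset.Iio t,
        ((σ + 1 / 2) * (∫ z, w.clipped g h z ^ 2 ∂(ν h : Measure _)) / (2 * g ^ 2) +
        (σ + 1 / 2) * (∫ z, w.clipped g h z ^ 2 ∂(M.occ (greedy (f i ω)).toPolicy h)) /
          (2 * g ^ 2)) + β ≤
      ∑ i ∈ Finset.Iio t, (σ * w.clipped g h (off i h ω).1 ^ 2 / (2 * g ^ 2) +
         σ * w.clipped g h (on i ω h).1 ^ 2 / (2 * g ^ 2))}
  have hR : ∀ σ : ℝ, |σ| = 1 → ∀ f' ∈ F, ∀ w h,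
      Pr (R σ f' w h) ≤ ENNReal.ofReal (Real.exp (-β)) := by
    intro σ hσ f' hf' w h
    have hcm : Measurable (w.clipped g h) := Measurable.of_discrete
    have hrm := measurable_residual (X := X) (A := A) f' h
    exact run.measure_sum_ge_le_of_compProd t h
      (φ := fun s => σ * (w.clipped g h s.1 * residual f' h s) / (2 * g)) (by fun_prop)
      (fun μ => σ * (∫ z, w.clipped g h z * M.bellmanErr f' h z ∂μ) / (2 * g) +
        (∫ z, w.clipped g h z ^ 2 ∂μ) / g ^ 2)
      (fun μ _ => M.lintegral_exp_weighted_residual_le (hF f' hf') h μ hg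
        (w.abs_clipped_le hg.le h) hσ) β
  have hS : ∀ σ : ℝ, |σ| = 1 → ∀ w h, Pr (S σ w h) ≤ ENNReal.ofReal (Real.exp (-β)) := by
    intro σ hσ w h
    have hcm : Measurable (w.clipped g h) := Measurable.of_discrete
    exact run.measure_sum_ge_le_of_compProd t h
      (φ := fun s => σ * w.clipped g h s.1 ^ 2 / (2 * g ^ 2)) (by fun_prop)
      (fun μ => (σ + 1 / 2) * (∫ z, w.clipped g h z ^ 2 ∂μ) / (2 * g ^ 2))
      (fun μ _ => M.lintegral_exp_sq_le h μ hg (w.abs_clipped_le hg.le h) hσ) β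
  have hsub : {ω | ¬ M.GoodRound ν F W (fun i h => off i h ω) (fun i => on i ω)
      (fun i => greedy (f i ω)) t g β} ⊆
      ⋃ p ∈ F ×ˢ W ×ˢ (Finset.univ : Finset (Fin H)),
        ((R 1 p.1 p.2.1 p.2.2 ∪ R (-1) p.1 p.2.1 p.2.2) ∪
          (S 1 p.2.1 p.2.2 ∪ S (-1) p.2.1 p.2.2)) := by
    intro ω hω
    by_contra hcon
    refine hω fun f' hf' w hw h => ?_
    have hnot : ω ∉ ((R 1 f' w h ∪ R (-1) f' w h) ∪ (S 1 w h ∪ S (-1) w h)) := by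
      intro hmem
      exact hcon (Set.mem_biUnion (x := (f', w, h)) (by simp [hf', hw]) hmem)
    simp only [Set.mem_union, not_or] at hnot
    obtain ⟨⟨n1, n2⟩, n3, n4⟩ := hnot
    simp only [R, S, Set.mem_ofPred_eq, not_le, Finset.sum_add_distrib, ← Finset.sum_div,
      ← Finset.mul_sum] at n1 n2 n3 n4
    unfold MDP.hybridAvg hybridMean
    simp only [Finset.sum_add_distrib]
    generalize (∑ i ∈ Finset.Iio t, ∫ z, w.clipped g h z * M.bellmanErr f' h z ∂(ν h : Measure _))
      = a1 at *
    generalize (∑ i ∈ Finset.Iio t, ∫ z, w.clipped g h z * M.bellmanErr f' h z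
      ∂(M.occ (greedy (f i ω)).toPolicy h)) = a2 at *
    generalize (∑ i ∈ Finset.Iio t, ∫ z, w.clipped g h z ^ 2 ∂(ν h : Measure _)) = b1 at *
    generalize (∑ i ∈ Finset.Iio t, ∫ z, w.clipped g h z ^ 2
      ∂(M.occ (greedy (f i ω)).toPolicy h)) = b2 at *
    generalize (∑ i ∈ Finset.Iio t, w.clipped g h (off i h ω).1 * residual f' h (off i h ω))
      = c1 at *
    generalize (∑ i ∈ Finset.Iio t, w.clipped g h (on i ω h).1 * residual f' h (on i ω h))
      = c2 at *
    generalize (∑ i ∈ Finset.Iio t, w.clipped g h (off i h ω).1 ^ 2) = d1 at *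
    generalize (∑ i ∈ Finset.Iio t, w.clipped g h (on i ω h).1 ^ 2) = d2 at *
    generalize ((t : ℕ) : ℝ) = n at *
    have g2 : (0 : ℝ) < g ^ 2 := by positivity
    have m1 : c1 + c2 < a1 + a2 + 2 / g * (b1 + b2) + 2 * g * β := by
      have := mul_lt_mul_of_pos_right n1 (by positivity : 0 < 2 * g)
      field_simp at this ⊢
      linarith
    have m2 : -(c1 + c2) < -(a1 + a2) + 2 / g * (b1 + b2) + 2 * g * β := by
      have := mul_lt_mul_of_pos_right n2 (by positivity : 0 < 2 * g)
      field_simp at this ⊢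
      linarith
    have m3 : d1 + d2 < 3 / 2 * (b1 + b2) + 2 * g ^ 2 * β := by
      have := mul_lt_mul_of_pos_right n3 (by positivity : 0 < 2 * g ^ 2)
      field_simp at this ⊢
      linarith
    have m4 : (b1 + b2) / 2 - 2 * g ^ 2 * β < d1 + d2 := by
      have := mul_lt_mul_of_pos_right n4 (by positivity : 0 < 2 * g ^ 2)
      field_simp at this ⊢
      linarith
    refine ⟨?_, ?_, ?_⟩
    · have e : 2 / g * ((b1 + b2) / (2 * n)) + g * β / n =
          (2 / g * (b1 + b2) + 2 * g * β) / (2 * n) := by field_simp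
      rw [e, ← sub_div, abs_div, abs_of_pos (by positivity : 0 < 2 * n)]
      refine div_le_div_of_nonneg_right ?_ (by positivity)
      rw [abs_le]; constructor <;> linarith
    · have e : (b1 + b2) / (2 * n) / 2 - g ^ 2 * β / n =
          ((b1 + b2) / 2 - 2 * g ^ 2 * β) / (2 * n) := by field_simp
      rw [e]
      exact div_le_div_of_nonneg_right m4.le (by positivity)
    · have e : 3 / 2 * ((b1 + b2) / (2 * n)) + g ^ 2 * β / n =
          (3 / 2 * (b1 + b2) + 2 * g ^ 2 * β) / (2 * n) := by field_simp
      rw [e]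
      exact div_le_div_of_nonneg_right m3.le (by positivity)
  refine (measure_mono hsub).trans ((measure_biUnion_finset_le _ _).trans ?_)
  have hone : |(1 : ℝ)| = 1 := abs_one
  have hneg : |(-1 : ℝ)| = 1 := by simp
  calc _ ≤ ∑ p ∈ F ×ˢ W ×ˢ (Finset.univ : Finset (Fin H)),
        4 * ENNReal.ofReal (Real.exp (-β)) := by
        refine Finset.sum_le_sum fun p hp => ?_
        have hp1 : p.1 ∈ F := (Finset.mem_product.1 hp).1
        calc _ ≤ (ENNReal.ofReal (Real.exp (-β)) + ENNReal.ofReal (Real.exp (-β))) +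
              (ENNReal.ofReal (Real.exp (-β)) + ENNReal.ofReal (Real.exp (-β))) :=
              (measure_union_le _ _).trans (add_le_add
                ((measure_union_le _ _).trans (add_le_add (hR 1 hone _ hp1 _ _)
                  (hR _ hneg _ hp1 _ _)))
                ((measure_union_le _ _).trans (add_le_add (hS 1 hone _ _) (hS _ hneg _ _))))
          _ = _ := by ring
    _ = _ := by
        simp only [Finset.sum_const, Finset.card_product, Finset.card_univ, Fintype.card_fin,
          nsmul_eq_mul]
        push_cast; ring

end Concentration

/-! ### The minimax estimator on the good event -/

section Estimator

variable {X A : Type*} {H T : ℕ}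

theorem finite_augmented (W : Finset (WeightFn X A H)) : (augmented W).Finite := by
  classical
  refine Set.Finite.subset (Set.finite_range
    (fun p : W × Bool × Option (Fin H) =>
      let v : SignedWeightFn X A H := p.2.2.elim p.1.1.signed (fun h => p.1.1.single h)
      if p.2.1 then v else -v)) ?_
  rintro v ⟨w, hw, rfl | rfl | ⟨h, rfl | rfl⟩⟩
  · exact ⟨(⟨w, hw⟩, true, none), rfl⟩
  · exact ⟨(⟨w, hw⟩, false, none), rfl⟩
  · exact ⟨(⟨w, hw⟩, true, some h), rfl⟩
  · exact ⟨(⟨w, hw⟩, false, some h), rfl⟩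

/-- The contribution of layer `h` to `maboObjective`. -/
def layerObjective (off on : Fin T → Fin H → Transition X A) (t : Fin T) (g : ℝ)
    (f : ValueFn X A H) (h : Fin H) (v : X → A → EReal) : ℝ :=
  |hybridMean (fun i => off i h) (fun i => on i h) t
      (fun s => clip g (v s.1.1 s.1.2) * residual f h s)| -
    8 / g * hybridMean (fun i => off i h) (fun i => on i h) t
      (fun s => clip g (v s.1.1 s.1.2) ^ 2)

theorem maboObjective_eq_sum (off on : Fin T → Fin H → Transition X A) (t : Fin T) (g : ℝ)
    (f : ValueFn X A H) (w : SignedWeightFn X A H) :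
    maboObjective off on t g f w = ∑ h, layerObjective off on t g f h (w h) := rfl

theorem layerObjective_neg (off on : Fin T → Fin H → Transition X A) (t : Fin T) {g : ℝ}
    (hg : 0 ≤ g) (f : ValueFn X A H) (h : Fin H) (v : X → A → EReal) :
    layerObjective off on t g f h (-v) = layerObjective off on t g f h v := by
  unfold layerObjective hybridMean
  simp only [Pi.neg_apply, clip_neg g hg, neg_sq, neg_mul]
  congr 1
  simp only [← neg_add, Finset.sum_neg_distrib, neg_div, abs_neg]

theorem layerObjective_zero (off on : Fin T → Fin H → Transition X A) (t : Fin T) {g : ℝ}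
    (hg : 0 ≤ g) (f : ValueFn X A H) (h : Fin H) :
    layerObjective off on t g f h 0 = 0 := by
  simp [layerObjective, hybridMean, clip_zero hg]

variable [MeasurableSpace X] [MeasurableSpace A] [DiscreteMeasurableSpace X]
  {M : MDP X A H} {ν : Fin H → ProbabilityMeasure (X × A)}
  {F : Finset (ValueFn X A H)} {W : Finset (WeightFn X A H)}
  {off on : Fin T → Fin H → Transition X A} {πs : Fin T → DetPolicy X A H} {t : Fin T} {g β : ℝ}

theorem MDP.GoodRound.layerObjective_le (hG : M.GoodRound ν F W off on πs t g β) (hg : 0 < g)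
    {f : ValueFn X A H} (hf : f ∈ F) (hQ : ∀ h z, M.bellmanErr f h z = 0)
    {w : WeightFn X A H} (hw : w ∈ W) (h : Fin H) :
    layerObjective off on t g f h (w.signed h) ≤ 9 * (g * β / (t : ℕ)) := by
  obtain ⟨h1, h2, -⟩ := hG f hf w hw h
  have hz : M.hybridAvg ν πs t h (fun z => w.clipped g h z * M.bellmanErr f h z) = 0 := by
    simp [MDP.hybridAvg, hQ]
  rw [hz, sub_zero] at h1
  change |hybridMean (fun i => off i h) (fun i => on i h) t
      (fun s => w.clipped g h s.1 * residual f h s)| -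
    8 / g * hybridMean (fun i => off i h) (fun i => on i h) t
      (fun s => w.clipped g h s.1 ^ 2) ≤ _
  have h3 := mul_le_mul_of_nonneg_left h2 (by positivity : 0 ≤ 8 / g)
  have e1 : 8 / g * (M.hybridAvg ν πs t h (fun z => w.clipped g h z ^ 2) / 2 -
      g ^ 2 * β / (t : ℕ)) = 2 * (2 / g * M.hybridAvg ν πs t h (fun z => w.clipped g h z ^ 2)) -
        8 * (g * β / (t : ℕ)) := by
    field_simp; ring
  have h4 : 0 ≤ M.hybridAvg ν πs t h (fun z => w.clipped g h z ^ 2) := by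
    unfold MDP.hybridAvg
    refine div_nonneg (Finset.sum_nonneg fun i _ => add_nonneg ?_ ?_) (by positivity) <;>
      exact integral_nonneg fun z => sq_nonneg _
  have h5 : 0 ≤ 2 / g * M.hybridAvg ν πs t h (fun z => w.clipped g h z ^ 2) := by positivity
  rw [e1] at h3
  linarith

theorem MDP.GoodRound.le_layerObjective (hG : M.GoodRound ν F W off on πs t g β) (hg : 0 < g)
    {f : ValueFn X A H} (hf : f ∈ F) {w : WeightFn X A H} (hw : w ∈ W) (h : Fin H) :
    |M.hybridAvg ν πs t h (fun z => w.clipped g h z * M.bellmanErr f h z)| ≤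
      layerObjective off on t g f h (w.signed h) +
        14 / g * M.hybridAvg ν πs t h (fun z => w.clipped g h z ^ 2) +
        9 * (g * β / (t : ℕ)) := by
  obtain ⟨h1, -, h2⟩ := hG f hf w hw h
  change _ ≤ |hybridMean (fun i => off i h) (fun i => on i h) t
      (fun s => w.clipped g h s.1 * residual f h s)| -
    8 / g * hybridMean (fun i => off i h) (fun i => on i h) t
      (fun s => w.clipped g h s.1 ^ 2) + _ + _
  have h3 := mul_le_mul_of_nonneg_left h2 (by positivity : 0 ≤ 8 / g)
  have e1 : 8 / g * (3 / 2 * M.hybridAvg ν πs t h (fun z => w.clipped g h z ^ 2) +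
      g ^ 2 * β / (t : ℕ)) = 12 / g * M.hybridAvg ν πs t h (fun z => w.clipped g h z ^ 2) +
        8 * (g * β / (t : ℕ)) := by
    field_simp; ring
  have e2 : 14 / g * M.hybridAvg ν πs t h (fun z => w.clipped g h z ^ 2) =
      12 / g * M.hybridAvg ν πs t h (fun z => w.clipped g h z ^ 2) +
      2 / g * M.hybridAvg ν πs t h (fun z => w.clipped g h z ^ 2) := by ring
  have h4 := abs_sub_abs_le_abs_sub
    (M.hybridAvg ν πs t h (fun z => w.clipped g h z * M.bellmanErr f h z))
    (hybridMean (fun i => off i h) (fun i => on i h) t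
      (fun s => w.clipped g h s.1 * residual f h s))
  rw [abs_sub_comm] at h4
  rw [e1] at h3
  rw [e2]
  linarith

/-- On the good event, the minimax value of the estimator is small, because that of a function
without Bellman error is. -/
theorem IsMaboCR.maboObjective_le {fhat : ValueFn X A H} (hm : IsMaboCR F W off on t g fhat)
    (hG : M.GoodRound ν F W off on πs t g β) (hg : 0 < g) (hβ : 0 ≤ β)
    {Q : ValueFn X A H} (hQF : Q ∈ F) (hQ : ∀ h z, M.bellmanErr Q h z = 0)
    {v : SignedWeightFn X A H} (hv : v ∈ augmented W) :
    maboObjective off on t g fhat v ≤ H * (9 * (g * β / (t : ℕ))) := by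
  have hfin := (finite_augmented W).to_subtype
  have hne : Nonempty (augmented W) := ⟨⟨v, hv⟩⟩
  have hnn : 0 ≤ 9 * (g * β / ((t : ℕ) : ℝ)) := by positivity
  refine (le_ciSup (f := fun w : augmented W => maboObjective off on t g fhat w)
    (Set.finite_range _).bddAbove ⟨v, hv⟩).trans ((hm.2 Q hQF).trans (ciSup_le ?_))
  rintro ⟨v, w, hw, hv⟩
  simp only
  rw [maboObjective_eq_sum]
  have hlayer : ∀ h, layerObjective off on t g Q h (v h) ≤ 9 * (g * β / (t : ℕ)) := by
    intro h
    have h0 := hG.layerObjective_le hg hQF hQ hw h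
    have hs : ∀ k, w.single k h = w.signed h ∨ w.single k h = 0 := by
      intro k
      by_cases hk : h = k
      · left; funext x a; simp [WeightFn.single, WeightFn.signed, hk]
      · right; funext x a; simp [WeightFn.single, hk]
    rcases hv with rfl | rfl | ⟨k, rfl | rfl⟩
    · exact h0
    · rw [Pi.neg_apply, layerObjective_neg _ _ _ hg.le]; exact h0
    · rcases hs k with e | e <;> rw [e]
      · exact h0
      · rw [layerObjective_zero _ _ _ hg.le]; exact hnn
    · rw [Pi.neg_apply, layerObjective_neg _ _ _ hg.le]
      rcases hs k with e | e <;> rw [e]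
      · exact h0
      · rw [layerObjective_zero _ _ _ hg.le]; exact hnn
  calc _ ≤ ∑ _h : Fin H, 9 * (g * β / ((t : ℕ) : ℝ)) := Finset.sum_le_sum fun h _ => hlayer h
    _ = _ := by simp

/-- Testing the estimator against a weight function on all layers at once. -/
theorem IsMaboCR.sum_abs_hybridAvg_le {fhat : ValueFn X A H} (hm : IsMaboCR F W off on t g fhat)
    (hG : M.GoodRound ν F W off on πs t g β) (hg : 0 < g) (hβ : 0 ≤ β)
    {Q : ValueFn X A H} (hQF : Q ∈ F) (hQ : ∀ h z, M.bellmanErr Q h z = 0)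
    {w : WeightFn X A H} (hw : w ∈ W) :
    ∑ h, |M.hybridAvg ν πs t h (fun z => w.clipped g h z * M.bellmanErr fhat h z)| ≤
      ∑ h, 14 / g * M.hybridAvg ν πs t h (fun z => w.clipped g h z ^ 2) +
        18 * H * (g * β / (t : ℕ)) := by
  have h1 := hm.maboObjective_le hG hg hβ hQF hQ ⟨w, hw, Or.inl rfl⟩
  rw [maboObjective_eq_sum] at h1
  have h2 := Finset.sum_le_sum fun h (_ : h ∈ (Finset.univ : Finset (Fin H))) =>
    hG.le_layerObjective hg hm.1 hw h
  simp only [Finset.sum_add_distrib, Finset.sum_const, Finset.card_univ, Fintype.card_fin,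
    nsmul_eq_mul] at h2
  linarith

/-- Testing the estimator against a weight function on a single layer. -/
theorem IsMaboCR.abs_hybridAvg_le {fhat : ValueFn X A H} (hm : IsMaboCR F W off on t g fhat)
    (hG : M.GoodRound ν F W off on πs t g β) (hg : 0 < g) (hβ : 0 ≤ β)
    {Q : ValueFn X A H} (hQF : Q ∈ F) (hQ : ∀ h z, M.bellmanErr Q h z = 0)
    {w : WeightFn X A H} (hw : w ∈ W) (h : Fin H) :
    |M.hybridAvg ν πs t h (fun z => w.clipped g h z * M.bellmanErr fhat h z)| ≤
      14 / g * M.hybridAvg ν πs t h (fun z => w.clipped g h z ^ 2) +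
        18 * H * (g * β / (t : ℕ)) := by
  have h1 := hm.maboObjective_le hG hg hβ hQF hQ
    ⟨w, hw, Or.inr (Or.inr ⟨h, Or.inl rfl⟩)⟩
  rw [maboObjective_eq_sum, Finset.sum_eq_single h] at h1
  · have e : w.single h h = w.signed h := by
      funext x a; simp [WeightFn.single, WeightFn.signed]
    rw [e] at h1
    have h2 := hG.le_layerObjective hg hm.1 hw h
    have hH : (1 : ℝ) ≤ H := by exact_mod_cast (Nat.succ_le_of_lt (Fin.pos h))
    have hnn : 0 ≤ g * β / ((t : ℕ) : ℝ) := by positivity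
    nlinarith [mul_le_mul_of_nonneg_right hH hnn]
  · intro k _ hk
    have e : w.single h k = 0 := by
      funext x a; simp [WeightFn.single, hk]
    rw [e, layerObjective_zero _ _ _ hg.le]
  · simp

end Estimator

/-! ### Clipped density ratios and the coverage potential -/

section Potential

/-- Clipping the density ratio `p / q` at level `g` loses no mass unless `p > g q`. -/
theorem mul_clip_ratio {p q : ℝ≥0∞} (hp : p ≠ ⊤) (hq : q ≠ ⊤) {g : ℝ} (hg : 0 < g) :
    q.toReal * clip g (ratio p q : EReal) ≤ p.toReal ∧
      (p.toReal ≤ g * q.toReal → q.toReal * clip g (ratio p q : EReal) = p.toReal) := by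
  by_cases h0 : q = 0
  · subst h0
    simp only [ENNReal.toReal_zero, zero_mul, mul_zero]
    exact ⟨ENNReal.toReal_nonneg, fun h => (le_antisymm h ENNReal.toReal_nonneg).symm⟩
  · have hqpos : 0 < q.toReal := ENNReal.toReal_pos h0 hq
    have e : ratio p q = ENNReal.ofReal (p.toReal / q.toReal) := by
      rw [ratio, if_neg h0, ENNReal.ofReal_div_of_pos hqpos, ENNReal.ofReal_toReal hp,
        ENNReal.ofReal_toReal hq]
    have hd : 0 ≤ p.toReal / q.toReal := by positivity
    rw [e, clip_ofReal hg.le hd]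
    constructor
    · calc _ ≤ q.toReal * (p.toReal / q.toReal) := by
            gcongr; exact min_le_left _ _
        _ = p.toReal := mul_div_cancel₀ _ hqpos.ne'
    · intro h
      rw [min_eq_left ((div_le_iff₀ hqpos).2 h), mul_div_cancel₀ _ hqpos.ne']

/-- The elliptic potential argument in dimension one. -/
theorem sum_div_add_le_log {d : ℕ → ℝ} {a : ℝ} (ha : 0 < a) (hd : ∀ n, 0 ≤ d n)
    (hda : ∀ n, d n ≤ a) (T : ℕ) :
    ∑ t ∈ Finset.range T, d t / (∑ i ∈ Finset.range t, d i + a) ≤ 2 * Real.log (T + 1) := by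
  have hS : ∀ n, 0 ≤ ∑ i ∈ Finset.range n, d i := fun n => Finset.sum_nonneg fun i _ => hd i
  have key : ∀ n, ∑ t ∈ Finset.range n, d t / (∑ i ∈ Finset.range t, d i + a) ≤
      2 * (Real.log (∑ i ∈ Finset.range n, d i + a) - Real.log a) := by
    intro n
    induction n with
    | zero => simp
    | succ n ih =>
      rw [Finset.sum_range_succ, Finset.sum_range_succ (fun i => d i)]
      set S := ∑ i ∈ Finset.range n, d i with hSdef
      have hSa : 0 < S + a := by have := hS n; linarith
      set u := d n / (S + a) with hu
      have hu0 : 0 ≤ u := div_nonneg (hd n) hSa.le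
      have hu1 : u ≤ 1 := by
        rw [hu, div_le_one hSa]; have := hS n; linarith [hda n]
      have hlog := Real.one_sub_inv_le_log_of_pos (by linarith : 0 < 1 + u)
      have e : 1 - (1 + u)⁻¹ = u / (1 + u) := by field_simp; ring
      have h2 : u / 2 ≤ u / (1 + u) := by
        gcongr; linarith
      have e2 : S + d n + a = (S + a) * (1 + u) := by
        rw [hu]; field_simp; ring
      rw [e2, Real.log_mul hSa.ne' (by linarith : 1 + u ≠ 0)]
      linarith
  refine (key T).trans ?_
  have hST : ∑ i ∈ Finset.range T, d i ≤ T * a := by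
    calc _ ≤ ∑ _i ∈ Finset.range T, a := Finset.sum_le_sum fun i _ => hda i
      _ = T * a := by simp
  rw [← Real.log_div (by have := hS T; linarith) ha.ne']
  have hpos : 0 < ∑ i ∈ Finset.range T, d i + a := by have := hS T; linarith
  have : (∑ i ∈ Finset.range T, d i + a) / a ≤ T + 1 := by
    rw [div_le_iff₀ ha]; linarith
  have := Real.log_le_log (div_pos hpos ha) this
  linarith

/-- The cost, at a single state-action pair, of a clipped weight `c` for the density ratio `d / m`:
the regularization paid for its second moment, plus the mass lost to clipping. -/
def clipCost (g d m c : ℝ) : ℝ := 14 / g * (m * c ^ 2) + 2 * (if g * m < d then d else 0)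

theorem clipCost_nonneg {g d m c : ℝ} (hg : 0 < g) (hd : 0 ≤ d) (hm : 0 ≤ m) :
    0 ≤ clipCost g d m c := by
  unfold clipCost
  split_ifs <;> positivity

theorem clipCost_le {g d m c : ℝ} (hg : 0 < g) (hd : 0 ≤ d) (hc : 0 ≤ c) (hcg : c ≤ g)
    (hmc : m * c ≤ d) : clipCost g d m c ≤ 16 * d := by
  unfold clipCost
  have h1 : m * c ^ 2 ≤ d * g := by
    calc m * c ^ 2 = (m * c) * c := by ring
      _ ≤ d * c := by gcongr
      _ ≤ d * g := by gcongr
  have h2 : 14 / g * (m * c ^ 2) ≤ 14 * d := by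
    rw [div_mul_eq_mul_div, div_le_iff₀ hg]; linarith
  split_ifs <;> linarith

/-- For a density `d` covered by `m` up to the factor `B`, the cost decays with the clipping
level. -/
theorem clipCost_le_of_covered {g d m c B : ℝ} (hg : 0 < g) (hd : 0 ≤ d) (hm : 0 ≤ m) (hc : 0 ≤ c)
    (hmc : m * c ≤ d) (hB : d ≤ B * m) : clipCost g d m c ≤ 16 * (B / g * d) := by
  have h1 : m * c ^ 2 ≤ B * d := by
    rcases hm.eq_or_lt with h0 | hpos
    · subst h0
      have : d = 0 := le_antisymm (by linarith) hd
      simp [this]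
    · have hcB : c ≤ B := by
        have : m * c ≤ m * B := by linarith
        exact le_of_mul_le_mul_left this hpos
      calc m * c ^ 2 = (m * c) * c := by ring
        _ ≤ d * c := by gcongr
        _ ≤ B * d := by rw [mul_comm]; gcongr
  have h2 : 14 / g * (m * c ^ 2) ≤ 14 * (B / g * d) := by
    calc _ ≤ 14 / g * (B * d) := by gcongr
      _ = _ := by ring
  unfold clipCost
  split_ifs with hlt
  · have hm' : 0 < m := by
      rcases hm.eq_or_lt with h0 | hpos
      · subst h0; simp at hB hlt; linarith
      · exact hpos
    have hgB : g < B := by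
      have : g * m < B * m := hlt.trans_le hB
      exact lt_of_mul_lt_mul_right this hm'.le
    have : 1 ≤ B / g := (one_le_div hg).2 hgB.le
    nlinarith [mul_le_mul_of_nonneg_right this hd]
  · have : 0 ≤ B / g * d := by
      rcases hm.eq_or_lt with h0 | hpos
      · subst h0
        have : d = 0 := le_antisymm (by linarith) hd
        simp [this]
      · have : 0 ≤ B := by
          by_contra hneg
          push Not at hneg
          nlinarith
        positivity
    linarith

/-- For a density `d ≤ a` which is itself added to the data, with past mass `S`, the cost is
controlled by the elliptic potential. -/
theorem clipCost_le_potential {γ d m c a S : ℝ} {t : ℕ} (ht : 0 < t) (hγ : 0 < γ) (hγ1 : γ ≤ 1)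
    (hd : 0 ≤ d) (hda : d ≤ a) (hc : 0 ≤ c) (hcg : c ≤ γ * (t + 1)) (hmc : m * c ≤ d)
    (hS : 0 ≤ S) (hm : S / (2 * t) ≤ m) :
    clipCost (γ * (t + 1)) d m c ≤ 64 * a / γ * (d / (S + a)) := by
  have htR : (0 : ℝ) < t := by exact_mod_cast ht
  have hm0 : 0 ≤ m := le_trans (by positivity) hm
  set g := γ * ((t : ℝ) + 1) with hgdef
  have hg : 0 < g := by positivity
  rcases hd.eq_or_lt with h0 | hdpos
  · subst h0
    have := clipCost_le hg le_rfl hc hcg hmc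
    simpa using this
  have ha : 0 < a := hdpos.trans_le hda
  have hSa : 0 < S + a := by linarith
  have hSm : S ≤ 2 * t * m := by
    rw [div_le_iff₀ (by positivity)] at hm; linarith
  have h1 : m * c ^ 2 ≤ d * g := by
    calc m * c ^ 2 = (m * c) * c := by ring
      _ ≤ d * c := by gcongr
      _ ≤ d * g := by gcongr
  -- second moment: pay `d` while `S < a`, and `d² / m` afterwards
  have h2 : m * c ^ 2 / g ≤ 4 * a / γ * (d / (S + a)) := by
    rcases lt_or_ge S a with hlt | hge
    · have e1 : m * c ^ 2 / g ≤ d := by rw [div_le_iff₀ hg]; exact h1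
      have e2 : d ≤ 2 * a * (d / (S + a)) := by
        rw [← mul_div_assoc, le_div_iff₀ hSa]; nlinarith
      have e3 : 2 * a * (d / (S + a)) ≤ 4 * a / γ * (d / (S + a)) := by
        have : 2 * a ≤ 4 * a / γ := by
          rw [le_div_iff₀ hγ]; nlinarith
        gcongr
      linarith
    · have hSpos : 0 < S := ha.trans_le hge
      have hmpos : 0 < m := by nlinarith
      have e1 : m * (m * c ^ 2) ≤ d ^ 2 := by
        have : (m * c) ^ 2 ≤ d ^ 2 := pow_le_pow_left₀ (by positivity) hmc 2
        nlinarith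
      rw [← mul_div_assoc, div_le_div_iff₀ hg hSa]
      -- `S m c² ≤ 2 t m² c² ≤ 2 t d² ≤ 2 (t + 1) a d`
      have e2 : S * (m * c ^ 2) ≤ 2 * t * d ^ 2 := by
        calc S * (m * c ^ 2) ≤ 2 * t * m * (m * c ^ 2) := by gcongr
          _ = 2 * t * (m * (m * c ^ 2)) := by ring
          _ ≤ 2 * t * d ^ 2 := by gcongr
      have e3 : m * c ^ 2 * (S + a) ≤ 2 * (S * (m * c ^ 2)) := by
        have : m * c ^ 2 * (S + a) ≤ m * c ^ 2 * (2 * S) := by gcongr; linarith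
        linarith
      have e4 : 2 * (t : ℝ) * d ^ 2 ≤ 2 * ((t : ℝ) + 1) * (a * d) := by
        have : d ^ 2 ≤ a * d := by nlinarith
        calc 2 * (t : ℝ) * d ^ 2 ≤ 2 * (t : ℝ) * (a * d) := by gcongr
          _ ≤ _ := by gcongr; linarith
      have e5 : 4 * a / γ * d * g = 4 * ((t : ℝ) + 1) * (a * d) := by
        rw [hgdef]; field_simp
      rw [e5]; linarith
  -- clipping only loses mass while `S < 2 a / γ`
  have h3 : (if g * m < d then d else 0) ≤ 4 * a / γ * (d / (S + a)) := by
    split_ifs with hlt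
    · have hSlt : γ * S ≤ 2 * a := by
        have : γ * S ≤ γ * (2 * t * m) := by gcongr
        have h5 : γ * (2 * t * m) ≤ 2 * (g * m) := by
          rw [hgdef]; nlinarith [mul_nonneg hγ.le hm0]
        linarith
      rw [← mul_div_assoc, le_div_iff₀ hSa, div_mul_eq_mul_div, le_div_iff₀ hγ]
      have : γ * (S + a) ≤ 4 * a := by nlinarith
      nlinarith
    · positivity
  unfold clipCost
  have e : 14 / g * (m * c ^ 2) = 14 * (m * c ^ 2 / g) := by ring
  rw [e]
  have e' : 64 * a / γ * (d / (S + a)) = 16 * (4 * a / γ * (d / (S + a))) := by ring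
  rw [e']
  linarith

end Potential

/-! ### From clipped estimates to regret -/

section Regret

variable {X A : Type*} [MeasurableSpace X] [MeasurableSpace A] [DiscreteMeasurableSpace X]
  [Countable X] [DiscreteMeasurableSpace A] [Countable A] {H T : ℕ}

theorem hasSum_integral_of_abs_le (μ : Measure (X × A)) [IsFiniteMeasure μ] {ψ : X × A → ℝ} {B : ℝ}
    (hψ : ∀ z, |ψ z| ≤ B) : HasSum (fun z => μ.real {z} * ψ z) (∫ z, ψ z ∂μ) := by
  have hf : Integrable ψ μ := integrable_of_abs_le hψ
  rw [← Measure.sum_smul_dirac μ] at hf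
  have h := hasSum_integral_measure hf
  rw [Measure.sum_smul_dirac] at h
  simpa only [integral_smul_measure, integral_dirac, ← measureReal_def, smul_eq_mul] using h

theorem hasSum_measureReal_singleton (μ : Measure (X × A)) [IsProbabilityMeasure μ] :
    HasSum (fun z => μ.real {z}) 1 := by
  simpa using hasSum_integral_of_abs_le μ (ψ := fun _ => 1) (B := 1) (by simp)

/-- The mass at `z` of the hybrid mixture of round `t`, as a real number. -/
def MDP.mixMass (M : MDP X A H) (ν : Fin H → ProbabilityMeasure (X × A))
    (πs : Fin T → DetPolicy X A H) (t : Fin T) (h : Fin H) (z : X × A) : ℝ :=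
  ((ν h : Measure (X × A)).real {z} +
    (∑ i ∈ Finset.Iio t, (M.occ (πs i).toPolicy h).real {z}) / (t : ℕ)) / 2

theorem sum_castLE_eq_sum_Iio {α : Type*} [AddCommMonoid α] (t : Fin T) (G : Fin T → α) :
    ∑ i : Fin t, G (Fin.castLE t.2.le i) = ∑ i ∈ Finset.Iio t, G i := by
  refine Finset.sum_bij (fun i _ => Fin.castLE t.2.le i) ?_ ?_ ?_ ?_
  · intro i _; simp [Fin.lt_def]
  · intro i _ j _ h; exact Fin.castLE_injective _ h
  · intro i hi
    exact ⟨⟨i, by simpa using hi⟩, Finset.mem_univ _, rfl⟩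
  · intro i _; rfl

variable (M : MDP X A H) (ν : Fin H → ProbabilityMeasure (X × A)) (πs : Fin T → DetPolicy X A H)

theorem MDP.hybridMixture_ne_top {t : Fin T} (ht : 0 < (t : ℕ)) (h : Fin H) (z : X × A) :
    M.hybridMixture ν (fun i : Fin t => πs (Fin.castLE t.2.le i)) h z ≠ ⊤ := by
  unfold MDP.hybridMixture
  refine ENNReal.div_ne_top (ENNReal.add_ne_top.2 ⟨measure_ne_top _ _, ?_⟩) (by simp)
  refine ENNReal.div_ne_top (ENNReal.sum_ne_top.2 fun i _ => measure_ne_top _ _) ?_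
  simp; omega

theorem MDP.toReal_hybridMixture {t : Fin T} (ht : 0 < (t : ℕ)) (h : Fin H) (z : X × A) :
    (M.hybridMixture ν (fun i : Fin t => πs (Fin.castLE t.2.le i)) h z).toReal =
      M.mixMass ν πs t h z := by
  unfold MDP.hybridMixture MDP.mixMass
  have h1 : ∀ i ∈ (Finset.univ : Finset (Fin t)),
      M.d (πs (Fin.castLE t.2.le i)) h z ≠ ⊤ := fun i _ => measure_ne_top _ _
  rw [ENNReal.toReal_div, ENNReal.toReal_add (measure_ne_top _ _)
    (ENNReal.div_ne_top (ENNReal.sum_ne_top.2 h1) (by simp; omega)), ENNReal.toReal_div,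
    ENNReal.toReal_sum h1,
    sum_castLE_eq_sum_Iio t (fun i => (M.d (πs i) h z).toReal)]
  simp [MDP.d, measureReal_def]

theorem MDP.mixMass_nonneg (t : Fin T) (h : Fin H) (z : X × A) : 0 ≤ M.mixMass ν πs t h z := by
  unfold MDP.mixMass
  have := Finset.sum_nonneg fun i (_ : i ∈ Finset.Iio t) =>
    measureReal_nonneg (μ := M.occ (πs i).toPolicy h) (s := {z})
  positivity

theorem MDP.hasSum_hybridAvg {t : Fin T} (ht : 0 < (t : ℕ)) (h : Fin H) {ψ : X × A → ℝ} {B : ℝ}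
    (hψ : ∀ z, |ψ z| ≤ B) :
    HasSum (fun z => M.mixMass ν πs t h z * ψ z) (M.hybridAvg ν πs t h ψ) := by
  have htR : (0 : ℝ) < (t : ℕ) := by exact_mod_cast ht
  have h1 := (hasSum_sum fun i (_ : i ∈ Finset.Iio t) =>
    (hasSum_integral_of_abs_le (ν h : Measure (X × A)) hψ).add
      (hasSum_integral_of_abs_le (M.occ (πs i).toPolicy h) hψ)).div_const (2 * ((t : ℕ) : ℝ))
  have e : ∀ z, (∑ i ∈ Finset.Iio t, ((ν h : Measure (X × A)).real {z} * ψ z +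
      (M.occ (πs i).toPolicy h).real {z} * ψ z)) / (2 * ((t : ℕ) : ℝ)) =
      M.mixMass ν πs t h z * ψ z := fun z => by
    simp only [MDP.mixMass, Finset.sum_add_distrib, Finset.sum_const, Fin.card_Iio, nsmul_eq_mul,
      ← Finset.sum_mul]
    field_simp
  simp only [e] at h1
  exact h1

/-- The clipped density ratio of `π` against the hybrid mixture of round `t`. -/
def MDP.clippedRatio (t : Fin T) (g : ℝ) (π : DetPolicy X A H) (h : Fin H) (z : X × A) : ℝ :=
  clip g (M.hybridRatio ν (fun i : Fin t => πs (Fin.castLE t.2.le i)) π h z.1 z.2 : EReal)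

/-- The total cost of clipping and regularization at layer `h`, for evaluating Bellman errors under
`π` from the hybrid data of round `t`. The series converges, by `MDP.summable_clipCost`. -/
def MDP.roundCost (t : Fin T) (g : ℝ) (π : DetPolicy X A H) (h : Fin H) : ℝ :=
  ∑' z, clipCost g ((M.occ π.toPolicy h).real {z}) (M.mixMass ν πs t h z)
    (M.clippedRatio ν πs t g π h z)

variable {M ν πs}

theorem MDP.mixMass_mul_clippedRatio {t : Fin T} (ht : 0 < (t : ℕ)) {g : ℝ} (hg : 0 < g)
    (π : DetPolicy X A H) (h : Fin H) (z : X × A) :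
    M.mixMass ν πs t h z * M.clippedRatio ν πs t g π h z ≤ (M.occ π.toPolicy h).real {z} ∧
      ((M.occ π.toPolicy h).real {z} ≤ g * M.mixMass ν πs t h z →
        M.mixMass ν πs t h z * M.clippedRatio ν πs t g π h z = (M.occ π.toPolicy h).real {z}) := by
  have := mul_clip_ratio (p := M.d π h z) (measure_ne_top _ _)
    (M.hybridMixture_ne_top ν πs ht h z) hg
  rw [M.toReal_hybridMixture ν πs ht] at this
  exact this

theorem MDP.clippedRatio_mem (t : Fin T) {g : ℝ} (hg : 0 ≤ g) (π : DetPolicy X A H) (h : Fin H)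
    (z : X × A) : M.clippedRatio ν πs t g π h z ∈ Set.Icc 0 g :=
  clip_mem hg _

theorem MDP.summable_clipCost {t : Fin T} (ht : 0 < (t : ℕ)) {g : ℝ} (hg : 0 < g)
    (π : DetPolicy X A H) (h : Fin H) :
    Summable fun z => clipCost g ((M.occ π.toPolicy h).real {z}) (M.mixMass ν πs t h z)
      (M.clippedRatio ν πs t g π h z) := by
  refine Summable.of_nonneg_of_le
    (fun z => clipCost_nonneg hg measureReal_nonneg (M.mixMass_nonneg ν πs t h z)) (fun z => ?_)
    ((hasSum_measureReal_singleton (M.occ π.toPolicy h)).summable.mul_left 16)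
  have := MDP.clippedRatio_mem (M := M) (ν := ν) (πs := πs) t hg.le π h z
  exact clipCost_le hg measureReal_nonneg this.1 this.2 (MDP.mixMass_mul_clippedRatio ht hg π h z).1

/-- Change of measure from the hybrid data to the occupancy of `π`, with a clipped weight. -/
theorem MDP.abs_integral_occ_le {t : Fin T} (ht : 0 < (t : ℕ)) {g : ℝ} (hg : 0 < g)
    (π : DetPolicy X A H) (h : Fin H) {Δ : X × A → ℝ} (hΔ : ∀ z, |Δ z| ≤ 2) :
    |∫ z, Δ z ∂(M.occ π.toPolicy h)| +
        14 / g * M.hybridAvg ν πs t h (fun z => M.clippedRatio ν πs t g π h z ^ 2) ≤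
      |M.hybridAvg ν πs t h (fun z => M.clippedRatio ν πs t g π h z * Δ z)| +
        M.roundCost ν πs t g π h := by
  set c := M.clippedRatio ν πs t g π h with hc
  have hcm : ∀ z, c z ∈ Set.Icc 0 g := MDP.clippedRatio_mem t hg.le π h
  have hcb : ∀ z, |c z| ≤ g := fun z => by rw [abs_of_nonneg (hcm z).1]; exact (hcm z).2
  have s1 := hasSum_integral_of_abs_le (M.occ π.toPolicy h) hΔ
  have s2 := M.hasSum_hybridAvg ν πs ht h (ψ := fun z => c z * Δ z) (B := g * 2) (fun z => by
    rw [abs_mul]; exact mul_le_mul (hcb z) (hΔ z) (abs_nonneg _) hg.le)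
  have s3 := (M.hasSum_hybridAvg ν πs ht h (ψ := fun z => c z ^ 2) (B := g ^ 2) (fun z => by
    rw [abs_pow]; exact pow_le_pow_left₀ (abs_nonneg _) (hcb z) 2)).mul_left (14 / g)
  have s4 := (MDP.summable_clipCost (M := M) (ν := ν) (πs := πs) ht hg π h).hasSum
  have hle : ∀ z, |(M.occ π.toPolicy h).real {z} * Δ z - M.mixMass ν πs t h z * (c z * Δ z)| ≤
      clipCost g ((M.occ π.toPolicy h).real {z}) (M.mixMass ν πs t h z) (c z) -
        14 / g * (M.mixMass ν πs t h z * c z ^ 2) := by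
    intro z
    obtain ⟨h1, h2⟩ := MDP.mixMass_mul_clippedRatio (M := M) (ν := ν) (πs := πs) ht hg π h z
    have hm := mul_nonneg (M.mixMass_nonneg ν πs t h z) (hcm z).1
    rw [← mul_assoc, ← sub_mul, abs_mul]
    unfold clipCost
    rw [add_sub_cancel_left]
    split_ifs with hlt
    · have : |(M.occ π.toPolicy h).real {z} - M.mixMass ν πs t h z * c z| ≤
          (M.occ π.toPolicy h).real {z} := by
        rw [abs_of_nonneg (sub_nonneg.2 h1)]; linarith
      calc _ ≤ (M.occ π.toPolicy h).real {z} * 2 :=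
            mul_le_mul this (hΔ z) (abs_nonneg _) measureReal_nonneg
        _ = _ := mul_comm _ _
    · rw [h2 (not_lt.1 hlt)]; simp
  have s5 := s4.sub s3
  have s6 := s1.sub s2
  have hup := hasSum_le (fun z => (le_abs_self _).trans (hle z)) s6 s5
  have hdown := hasSum_le (fun z => (neg_le_abs _).trans (hle z)) s6.neg s5
  have habs := abs_le.2 ⟨by linarith, hup⟩
  have h4 := abs_sub_abs_le_abs_sub (∫ z, Δ z ∂(M.occ π.toPolicy h))
    (M.hybridAvg ν πs t h (fun z => c z * Δ z))
  unfold MDP.roundCost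
  linarith

theorem mul_of_ratio_le {p q K : ℝ≥0∞} (hK : K ≠ ⊤) (hq : q ≠ ⊤) (h : ratio p q ≤ K) : p ≤ K * q := by
  unfold ratio at h
  split_ifs at h with h1 h2
  · simp [h2]
  · exact absurd (top_le_iff.1 h) hK
  · exact (ENNReal.div_le_iff h1 hq).1 h

/-- A concentrated comparator is covered by the offline half of every hybrid mixture. -/
theorem MDP.SinglePolicyConcentrability.roundCost_le {πstar : DetPolicy X A H} {Cstar : ℝ}
    (hC : M.SinglePolicyConcentrability πstar ν Cstar) (hC0 : 0 ≤ Cstar) {t : Fin T}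
    (ht : 0 < (t : ℕ)) {g : ℝ} (hg : 0 < g) (h : Fin H) :
    M.roundCost ν πs t g πstar h ≤ 32 * Cstar / g := by
  have hd : ∀ z, (M.occ πstar.toPolicy h).real {z} ≤ 2 * Cstar * M.mixMass ν πs t h z := by
    intro z
    have h1 := mul_of_ratio_le ENNReal.ofReal_ne_top (measure_ne_top _ _) (hC h z)
    have h2 := ENNReal.toReal_mono
      (ENNReal.mul_ne_top ENNReal.ofReal_ne_top (measure_ne_top _ _)) h1
    rw [ENNReal.toReal_mul, ENNReal.toReal_ofReal hC0] at h2
    have h3 : (ν h : Measure (X × A)).real {z} ≤ 2 * M.mixMass ν πs t h z := by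
      unfold MDP.mixMass
      have : 0 ≤ (∑ i ∈ Finset.Iio t, (M.occ (πs i).toPolicy h).real {z}) / ((t : ℕ) : ℝ) :=
        div_nonneg (Finset.sum_nonneg fun i _ => measureReal_nonneg) (by positivity)
      linarith
    calc (M.occ πstar.toPolicy h).real {z} ≤ Cstar * (ν h : Measure (X × A)).real {z} := h2
      _ ≤ Cstar * (2 * M.mixMass ν πs t h z) := by gcongr
      _ = _ := by ring
  have s := ((hasSum_measureReal_singleton (M.occ πstar.toPolicy h)).mul_left
    (2 * Cstar / g)).mul_left 16
  have := hasSum_le (fun z => clipCost_le_of_covered hg measureReal_nonneg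
    (M.mixMass_nonneg ν πs t h z) (MDP.clippedRatio_mem t hg.le πstar h z).1
    (MDP.mixMass_mul_clippedRatio ht hg πstar h z).1 (hd z))
    (MDP.summable_clipCost ht hg πstar h).hasSum s
  unfold MDP.roundCost
  calc _ ≤ _ := this
    _ = _ := by ring

theorem sum_Iio_eq_sum_range (t : Fin T) (G : Fin T → ℝ) :
    ∑ i ∈ Finset.Iio t, G i = ∑ n ∈ Finset.range t, if hn : n < T then G ⟨n, hn⟩ else 0 := by
  rw [← sum_castLE_eq_sum_Iio, Finset.sum_range]
  refine Finset.sum_congr rfl fun i _ => ?_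
  have := i.2.trans t.2
  rw [dif_pos this]; rfl

/-- Coverability bounds the total cost of evaluating each policy from the data of its
predecessors. -/
theorem MDP.sum_roundCost_le {γ K : ℝ} (hγ : 0 < γ) (hγ1 : γ ≤ 1) (h : Fin H)
    {μ : Measure (X × A)} [IsProbabilityMeasure μ]
    (hμ : ∀ t z, (M.occ (πs t).toPolicy h).real {z} ≤ K * μ.real {z}) :
    ∑ t ∈ Finset.univ.filter (fun t : Fin T => 0 < (t : ℕ)), M.roundCost ν πs t (γ * ((t : ℕ) + 1)) (πs t) h ≤
      128 * K / γ * Real.log (T + 1) := by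
  have hg : ∀ t : Fin T, 0 < γ * (((t : ℕ) : ℝ) + 1) := fun t => by positivity
  have hsum := hasSum_sum fun t (ht : t ∈ Finset.univ.filter fun t : Fin T => 0 < (t : ℕ)) =>
    (MDP.summable_clipCost (M := M) (ν := ν) (πs := πs) (Finset.mem_filter.1 ht).2 (hg t)
      (πs t) h).hasSum
  have hb := (hasSum_measureReal_singleton μ).mul_left (128 * K / γ * Real.log (T + 1))
  rw [mul_one] at hb
  refine hasSum_le (fun z => ?_) hsum hb
  set a := K * μ.real {z} with ha
  let d : ℕ → ℝ := fun n => if hn : n < T then (M.occ (πs ⟨n, hn⟩).toPolicy h).real {z} else 0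
  have hdt : ∀ t : Fin T, d t = (M.occ (πs t).toPolicy h).real {z} := fun t => by simp [d]
  have hS : ∀ t : Fin T, ∑ i ∈ Finset.Iio t, (M.occ (πs i).toPolicy h).real {z} =
      ∑ n ∈ Finset.range t, d n := fun t => sum_Iio_eq_sum_range t _
  have hd0 : ∀ n, 0 ≤ d n := fun n => by
    simp only [d]; split_ifs
    · exact measureReal_nonneg
    · exact le_rfl
  have hterm : ∀ t : Fin T, 0 < (t : ℕ) →
      clipCost (γ * ((t : ℕ) + 1)) ((M.occ (πs t).toPolicy h).real {z}) (M.mixMass ν πs t h z)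
        (M.clippedRatio ν πs t (γ * ((t : ℕ) + 1)) (πs t) h z) ≤
      64 * a / γ * (d t / (∑ n ∈ Finset.range t, d n + a)) := by
    intro t ht
    have hc := MDP.clippedRatio_mem (M := M) (ν := ν) (πs := πs) t (hg t).le (πs t) h z
    rw [hdt]
    refine clipCost_le_potential ht hγ hγ1 measureReal_nonneg (hμ t z) hc.1 hc.2
      (MDP.mixMass_mul_clippedRatio ht (hg t) (πs t) h z).1
      (Finset.sum_nonneg fun n _ => hd0 n) ?_
    unfold MDP.mixMass
    rw [hS]
    have h1 : 0 ≤ (ν h : Measure (X × A)).real {z} := measureReal_nonneg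
    have h2 : (∑ n ∈ Finset.range t, d n) / (2 * ((t : ℕ) : ℝ)) =
        ((∑ n ∈ Finset.range t, d n) / ((t : ℕ) : ℝ)) / 2 := by
      rw [div_div, mul_comm]
    rw [h2]; linarith
  by_cases hT : T = 0
  · subst hT
    simp
  have ha0 : 0 ≤ a := (measureReal_nonneg).trans (hμ ⟨0, by omega⟩ z)
  have hnn : ∀ n, 0 ≤ 64 * a / γ * (d n / (∑ i ∈ Finset.range n, d i + a)) := fun n =>
    mul_nonneg (by positivity) (div_nonneg (hd0 n)
      (add_nonneg (Finset.sum_nonneg fun i _ => hd0 i) ha0))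
  calc _ ≤ ∑ t ∈ Finset.univ.filter (fun t : Fin T => 0 < (t : ℕ)),
        64 * a / γ * (d t / (∑ n ∈ Finset.range t, d n + a)) :=
        Finset.sum_le_sum fun t ht => hterm t (Finset.mem_filter.1 ht).2
    _ ≤ ∑ t : Fin T, 64 * a / γ * (d t / (∑ n ∈ Finset.range t, d n + a)) :=
        Finset.sum_le_sum_of_subset_of_nonneg (Finset.filter_subset _ _) fun t _ _ => hnn t
    _ = 64 * a / γ * ∑ n ∈ Finset.range T, d n / (∑ i ∈ Finset.range n, d i + a) := by
        rw [Fin.sum_univ_eq_sum_range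
          (fun n => 64 * a / γ * (d n / (∑ i ∈ Finset.range n, d i + a))) T, Finset.mul_sum]
    _ ≤ 64 * a / γ * (2 * Real.log (T + 1)) := by
        rcases ha0.eq_or_lt with h0 | hpos
        · rw [← h0]; simp
        · gcongr
          refine sum_div_add_le_log hpos hd0 (fun n => ?_) T
          simp only [d]; split_ifs
          · exact hμ _ z
          · exact ha0
    _ = _ := by rw [ha]; ring

variable (M) in
theorem MDP.coverability_ne_top {Pi : Set (DetPolicy X A H)} (hPi : Pi.Finite)
    (hne : Pi.Nonempty) : M.coverability Pi ≠ ⊤ := by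
  classical
  set S := hPi.toFinset with hS
  have hScard : S.card ≠ 0 := by
    rw [Finset.card_ne_zero]; exact (Set.Finite.toFinset_nonempty hPi).2 hne
  have hn0 : (S.card : ℝ≥0∞) ≠ 0 := by exact_mod_cast hScard
  have hnt : (S.card : ℝ≥0∞) ≠ ⊤ := ENNReal.natCast_ne_top _
  let μ : Fin H → ProbabilityMeasure (X × A) := fun h =>
    ⟨(S.card : ℝ≥0∞)⁻¹ • ∑ π ∈ S, M.occ π.toPolicy h, ⟨by
      rw [Measure.smul_apply, Measure.finsetSum_apply]
      simp [ENNReal.inv_mul_cancel hn0 hnt]⟩⟩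
  have hle : M.coverability Pi ≤ S.card := by
    refine (iInf_le _ μ).trans (iSup₂_le fun π hπ => iSup_le fun h => iSup_le fun z => ?_)
    have hmem : π ∈ S := by simpa [hS] using hπ
    have e : ((μ h : Measure (X × A)) {z}) =
        (S.card : ℝ≥0∞)⁻¹ * ∑ π ∈ S, M.occ π.toPolicy h {z} := by
      simp only [μ, ProbabilityMeasure.coe_mk]
      rw [Measure.smul_apply, Measure.finsetSum_apply, smul_eq_mul]
    have hd : M.d π h z ≤ S.card * ((μ h : Measure (X × A)) {z}) := by
      rw [e, ← mul_assoc, ENNReal.mul_inv_cancel hn0 hnt, one_mul]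
      exact Finset.single_le_sum (f := fun π : DetPolicy X A H => M.occ π.toPolicy h {z})
        (fun _ _ => zero_le) hmem
    unfold ratio
    split_ifs with h1 h2
    · exact_mod_cast Nat.one_le_iff_ne_zero.2 hScard
    · rw [h1, mul_zero] at hd
      exact absurd (le_antisymm hd (zero_le)) h2
    · exact (ENNReal.div_le_iff h1 (measure_ne_top _ _)).2 hd
  exact ne_top_of_le_ne_top hnt hle

theorem one_le_of_forall_le_mul {μ₁ μ₂ : Measure (X × A)} [IsProbabilityMeasure μ₁]
    [IsProbabilityMeasure μ₂] {K : ℝ} (h : ∀ z, μ₁.real {z} ≤ K * μ₂.real {z}) : 1 ≤ K := by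
  simpa using hasSum_le h (hasSum_measureReal_singleton μ₁)
    ((hasSum_measureReal_singleton μ₂).mul_left K)

variable (M) in
theorem MDP.one_le_coverability {Pi : Set (DetPolicy X A H)} (hne : Pi.Nonempty) (h : Fin H) :
    1 ≤ M.coverability Pi := by
  obtain ⟨π, hπ⟩ := hne
  refine le_iInf fun μ => ?_
  set K := ⨆ π ∈ Pi, ⨆ h : Fin H, ⨆ z : X × A, ratio (M.d π h z) ((μ h : Measure (X × A)) {z})
    with hK
  by_cases hKt : K = ⊤
  · rw [hKt]; exact le_top
  have h1 : ∀ z, (M.occ π.toPolicy h).real {z} ≤ K.toReal * (μ h : Measure (X × A)).real {z} := by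
    intro z
    have h2 : ratio (M.d π h z) ((μ h : Measure (X × A)) {z}) ≤ K :=
      (le_iSup (fun z => ratio (M.d π h z) ((μ h : Measure (X × A)) {z})) z).trans
        ((le_iSup (fun h : Fin H => ⨆ z, ratio (M.d π h z) ((μ h : Measure (X × A)) {z})) h).trans
          (le_iSup₂ (f := fun π (_ : π ∈ Pi) => ⨆ h : Fin H, ⨆ z,
            ratio (M.d π h z) ((μ h : Measure (X × A)) {z})) π hπ))
    have h3 := ENNReal.toReal_mono (ENNReal.mul_ne_top hKt (measure_ne_top _ _))
      (mul_of_ratio_le hKt (measure_ne_top _ _) h2)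
    rwa [ENNReal.toReal_mul] at h3
  have := one_le_of_forall_le_mul h1
  rw [← ENNReal.toReal_one] at this
  exact (ENNReal.toReal_le_toReal ENNReal.one_ne_top hKt).1 this

variable (M) in
/-- The infimum defining coverability need not be attained, but it is up to a factor of two. -/
theorem MDP.exists_covering {Pi : Set (DetPolicy X A H)} (hPi : Pi.Finite) (hne : Pi.Nonempty)
    (h₀ : Fin H) : ∃ μ : Fin H → ProbabilityMeasure (X × A), ∀ π ∈ Pi, ∀ h z,
      (M.occ π.toPolicy h).real {z} ≤
        2 * (M.coverability Pi).toReal * (μ h : Measure (X × A)).real {z} := by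
  have ht := M.coverability_ne_top hPi hne
  have h1 := M.one_le_coverability hne h₀
  have hlt : M.coverability Pi < 2 * M.coverability Pi := by
    rw [two_mul]
    exact ENNReal.lt_add_right ht (ne_of_gt (zero_lt_one.trans_le h1))
  conv_lhs at hlt => unfold MDP.coverability
  obtain ⟨μ, hμ⟩ := iInf_lt_iff.1 hlt
  refine ⟨μ, fun π hπ h z => ?_⟩
  have h2t : 2 * M.coverability Pi ≠ ⊤ := ENNReal.mul_ne_top (by simp) ht
  have h2 : ratio (M.d π h z) ((μ h : Measure (X × A)) {z}) ≤ 2 * M.coverability Pi :=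
    ((le_iSup (fun z => ratio (M.d π h z) ((μ h : Measure (X × A)) {z})) z).trans
      ((le_iSup (fun h : Fin H => ⨆ z, ratio (M.d π h z) ((μ h : Measure (X × A)) {z})) h).trans
        (le_iSup₂ (f := fun π (_ : π ∈ Pi) => ⨆ h : Fin H, ⨆ z,
          ratio (M.d π h z) ((μ h : Measure (X × A)) {z})) π hπ))).trans hμ.le
  have h3 := ENNReal.toReal_mono (ENNReal.mul_ne_top h2t (measure_ne_top _ _))
    (mul_of_ratio_le h2t (measure_ne_top _ _) h2)
  rw [ENNReal.toReal_mul, ENNReal.toReal_mul] at h3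
  exact h3

end Regret

/-! ### Regret of a run -/

section RunRegret

variable {X A : Type*} [MeasurableSpace X] [MeasurableSpace A] [DiscreteMeasurableSpace X]
  [Countable X] [DiscreteMeasurableSpace A] [Countable A] {H T : ℕ}
  {M : MDP X A H} {ν : Fin H → ProbabilityMeasure (X × A)}
  {F : Finset (ValueFn X A H)} {W : Finset (WeightFn X A H)}
  {greedy : ValueFn X A H → DetPolicy X A H} {Pi : Set (DetPolicy X A H)}

/-- `W` can test the Bellman errors of any estimate under any policy of `Pi`: on the good event of
each round they are bounded by the clipping costs, up to an estimation error proportional to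
`D`. -/
def MDP.Testable (M : MDP X A H) (ν : Fin H → ProbabilityMeasure (X × A))
    (F : Finset (ValueFn X A H)) (W : Finset (WeightFn X A H)) (Pi : Set (DetPolicy X A H))
    (T : ℕ) (D : ℝ) : Prop :=
  ∀ (off on : Fin T → Fin H → Transition X A) (πs : Fin T → DetPolicy X A H) (t : Fin T)
    (g β : ℝ) (fhat : ValueFn X A H), 0 < (t : ℕ) → 0 < g → 0 ≤ β → (∀ i, πs i ∈ Pi) →
    M.GoodRound ν F W off on πs t g β → IsMaboCR F W off on t g fhat →
    ∀ π ∈ Pi, ∑ h, |∫ z, M.bellmanErr fhat h z ∂(M.occ π.toPolicy h)| ≤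
      ∑ h, M.roundCost ν πs t g π h + 18 * D * (g * β / (t : ℕ))

theorem MDP.RatioRealizable.testable (hW : M.RatioRealizable ν Pi W T)
    (hF : ∀ f ∈ F, ∀ h x a, f h x a ∈ Set.Icc (0 : ℝ) 1)
    {Q : ValueFn X A H} (hQF : Q ∈ F) (hQ : ∀ h z, M.bellmanErr Q h z = 0) :
    M.Testable ν F W Pi T H := by
  intro off on πs t g β fhat ht hg hβ hπs hG hm π hπ
  have hw := hW t ht t.2.le (fun i : Fin t => πs (Fin.castLE t.2.le i)) (fun i => hπs _) π hπ
  have h1 := hm.sum_abs_hybridAvg_le hG hg hβ hQF hQ hw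
  have h2 := Finset.sum_le_sum fun h (_ : h ∈ (Finset.univ : Finset (Fin H))) =>
    MDP.abs_integral_occ_le (M := M) (ν := ν) (πs := πs) ht hg π h
      (M.abs_bellmanErr_le (hF fhat hm.1) h)
  simp only [Finset.sum_add_distrib] at h2
  change ∑ h, |M.hybridAvg ν πs t h (fun z => M.clippedRatio ν πs t g π h z *
    M.bellmanErr fhat h z)| ≤ ∑ h, 14 / g * M.hybridAvg ν πs t h
      (fun z => M.clippedRatio ν πs t g π h z ^ 2) + _ at h1
  linarith

theorem MDP.RatioRealizableLayerwise.testable (hW : M.RatioRealizableLayerwise ν Pi W T)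
    (hF : ∀ f ∈ F, ∀ h x a, f h x a ∈ Set.Icc (0 : ℝ) 1)
    {Q : ValueFn X A H} (hQF : Q ∈ F) (hQ : ∀ h z, M.bellmanErr Q h z = 0) :
    M.Testable ν F W Pi T (H ^ 2) := by
  intro off on πs t g β fhat ht hg hβ hπs hG hm π hπ
  have h1 : ∀ h, |∫ z, M.bellmanErr fhat h z ∂(M.occ π.toPolicy h)| ≤
      M.roundCost ν πs t g π h + 18 * H * (g * β / (t : ℕ)) := by
    intro h
    obtain ⟨w, hw, e⟩ := hW t ht t.2.le (fun i : Fin t => πs (Fin.castLE t.2.le i))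
      (fun i => hπs _) π hπ h
    have h1 := hm.abs_hybridAvg_le hG hg hβ hQF hQ hw h
    have ec : w.clipped g h = M.clippedRatio ν πs t g π h := by
      funext z; unfold WeightFn.clipped MDP.clippedRatio; rw [e]
    simp only [ec] at h1
    have h2 := MDP.abs_integral_occ_le (M := M) (ν := ν) (πs := πs) ht hg π h
      (M.abs_bellmanErr_le (hF fhat hm.1) h)
    linarith
  calc _ ≤ ∑ h, (M.roundCost ν πs t g π h + 18 * H * (g * β / (t : ℕ))) :=
        Finset.sum_le_sum fun h _ => h1 h
    _ = _ := by
        rw [Finset.sum_add_distrib]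
        simp only [Finset.sum_const, Finset.card_univ, Fintype.card_fin, nsmul_eq_mul]
        ring

/-- Cumulative regret of a run on the intersection of the good events. -/
theorem sum_regret_le (hM : M.NormalizedRewards)
    (hF : ∀ f ∈ F, ∀ h x a, f h x a ∈ Set.Icc (0 : ℝ) 1) (hgr : IsGreedyRule F greedy)
    {πstar : DetPolicy X A H} (hstar : πstar ∈ policyClass F greedy) {Cstar : ℝ}
    (hC : M.SinglePolicyConcentrability πstar ν Cstar) (hC0 : 0 ≤ Cstar) (hH : 1 ≤ H)
    {D : ℝ} (hD : 0 ≤ D) (htest : M.Testable ν F W (policyClass F greedy) T D)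
    {γ β : ℝ} (hγ : 0 < γ) (hγ1 : γ ≤ 1) (hβ : 0 ≤ β)
    {off on : Fin T → Fin H → Transition X A} {f : Fin T → ValueFn X A H}
    (hm : ∀ t, IsMaboCR F W off on t (γ * ((t : ℕ) + 1)) (f t))
    (hG : ∀ t : Fin T, 0 < (t : ℕ) →
      M.GoodRound ν F W off on (fun i => greedy (f i)) t (γ * ((t : ℕ) + 1)) β) :
    ∑ t, (M.J πstar.toPolicy - M.J (greedy (f t)).toPolicy) ≤
      72 * D * γ * β * T + 256 * H *
        ((M.coverability (policyClass F greedy)).toReal + Cstar) * Real.log (T + 1) / γ + 1 := by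
  classical
  set πs : Fin T → DetPolicy X A H := fun i => greedy (f i) with hπs
  have hPi : ∀ i, πs i ∈ policyClass F greedy := fun i => ⟨f i, (hm i).1, rfl⟩
  obtain ⟨μ, hμ⟩ := M.exists_covering (F.finite_toSet.image greedy) ⟨πstar, hstar⟩ ⟨0, hH⟩
  set K := (M.coverability (policyClass F greedy)).toReal with hK
  set lg := Real.log ((T : ℝ) + 1) with hlg
  have hlg0 : 0 ≤ lg := Real.log_nonneg (by linarith [Nat.cast_nonneg (α := ℝ) T])
  set P := Finset.univ.filter (fun t : Fin T => 0 < (t : ℕ)) with hP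
  have hround : ∀ t ∈ P, M.J πstar.toPolicy - M.J (πs t).toPolicy ≤
      ∑ h, M.roundCost ν πs t (γ * ((t : ℕ) + 1)) (πs t) h +
        32 * H * Cstar / γ * (1 / (((t : ℕ) : ℝ) + 1)) + 72 * D * γ * β := by
    intro t htP
    have ht : 0 < (t : ℕ) := (Finset.mem_filter.1 htP).2
    have htR : (1 : ℝ) ≤ (t : ℕ) := by exact_mod_cast ht
    have hg : 0 < γ * (((t : ℕ) : ℝ) + 1) := by positivity
    have e1 := htest off on πs t _ β (f t) ht hg hβ hPi (hG t ht) (hm t) (πs t) (hPi t)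
    have e2 := htest off on πs t _ β (f t) ht hg hβ hPi (hG t ht) (hm t) πstar hstar
    have e3 := M.performance_difference (hF _ (hm t).1) (π := πstar) (hgr _ (hm t).1)
    have e4 : ∑ h, ∫ z, M.bellmanErr (f t) h z ∂(M.occ (πs t).toPolicy h) ≤
        ∑ h, |∫ z, M.bellmanErr (f t) h z ∂(M.occ (πs t).toPolicy h)| :=
      Finset.sum_le_sum fun h _ => le_abs_self _
    have e5 : -∑ h, ∫ z, M.bellmanErr (f t) h z ∂(M.occ πstar.toPolicy h) ≤
        ∑ h, |∫ z, M.bellmanErr (f t) h z ∂(M.occ πstar.toPolicy h)| := by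
      rw [← Finset.sum_neg_distrib]
      exact Finset.sum_le_sum fun h _ => neg_le_abs _
    have e6 : ∑ h, M.roundCost ν πs t (γ * ((t : ℕ) + 1)) πstar h ≤
        32 * H * Cstar / γ * (1 / (((t : ℕ) : ℝ) + 1)) := by
      calc _ ≤ ∑ _h : Fin H, 32 * Cstar / (γ * (((t : ℕ) : ℝ) + 1)) :=
            Finset.sum_le_sum fun h _ => hC.roundCost_le hC0 ht hg h
        _ = _ := by
            simp only [Finset.sum_const, Finset.card_univ, Fintype.card_fin, nsmul_eq_mul]
            field_simp
    have e7 : γ * (((t : ℕ) : ℝ) + 1) * β / ((t : ℕ) : ℝ) ≤ 2 * γ * β := by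
      rw [div_le_iff₀ (by linarith)]
      have := mul_nonneg hγ.le hβ
      nlinarith
    have e8 : 18 * D * (γ * (((t : ℕ) : ℝ) + 1) * β / ((t : ℕ) : ℝ)) ≤
        18 * D * (2 * γ * β) := by gcongr
    linarith
  have hfirst : ∑ t ∈ Finset.univ.filter (fun t : Fin T => ¬ 0 < (t : ℕ)),
      (M.J πstar.toPolicy - M.J (πs t).toPolicy) ≤ 1 := by
    have hcard : (Finset.univ.filter (fun t : Fin T => ¬ 0 < (t : ℕ))).card ≤ 1 := by
      refine Finset.card_le_one.2 fun a ha b hb => ?_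
      simp only [Finset.mem_filter, Finset.mem_univ, true_and] at ha hb
      ext; omega
    calc _ ≤ ∑ _t ∈ Finset.univ.filter (fun t : Fin T => ¬ 0 < (t : ℕ)), (1 : ℝ) :=
          Finset.sum_le_sum fun t _ => by
            have h1 := M.J_mem hM πstar.toPolicy
            have h2 := M.J_mem hM (πs t).toPolicy
            linarith [h1.2, h2.1]
      _ ≤ 1 := by
          rw [Finset.sum_const, nsmul_eq_mul, mul_one]; exact_mod_cast hcard
  have hcost : ∑ t ∈ P, ∑ h, M.roundCost ν πs t (γ * ((t : ℕ) + 1)) (πs t) h ≤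
      256 * H * K * lg / γ := by
    rw [Finset.sum_comm]
    calc _ ≤ ∑ _h : Fin H, 128 * (2 * K) / γ * lg := Finset.sum_le_sum fun h _ =>
          MDP.sum_roundCost_le hγ hγ1 h (μ := μ h) fun t z => hμ _ (hPi t) h z
      _ = _ := by
          simp only [Finset.sum_const, Finset.card_univ, Fintype.card_fin, nsmul_eq_mul]
          ring
  have hharm : ∑ t ∈ P, 1 / (((t : ℕ) : ℝ) + 1) ≤ 2 * lg := by
    have := sum_div_add_le_log (d := fun _ => 1) (a := 1) one_pos (fun _ => zero_le_one)
      (fun _ => le_rfl) T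
    simp only [Finset.sum_const, Finset.card_range, nsmul_eq_mul, mul_one] at this
    rw [← Fin.sum_univ_eq_sum_range (fun n => 1 / ((n : ℝ) + 1)) T] at this
    exact (Finset.sum_le_sum_of_subset_of_nonneg (Finset.filter_subset _ _)
      fun t _ _ => by positivity).trans this
  rw [← Finset.sum_filter_add_sum_filter_not Finset.univ (fun t : Fin T => 0 < (t : ℕ))]
  have hmain := Finset.sum_le_sum hround
  simp only [Finset.sum_add_distrib, ← Finset.mul_sum, Finset.sum_const, nsmul_eq_mul] at hmain
  have hcardP : (P.card : ℝ) ≤ T := by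
    have := Finset.card_le_univ P
    simpa using this
  have h1 : (P.card : ℝ) * (72 * D * γ * β) ≤ 72 * D * γ * β * T := by
    rw [mul_comm]; gcongr
  have h2 : 32 * H * Cstar / γ * ∑ t ∈ P, 1 / (((t : ℕ) : ℝ) + 1) ≤
      256 * H * Cstar * lg / γ := by
    calc _ ≤ 32 * H * Cstar / γ * (2 * lg) := by gcongr
      _ = 64 * H * Cstar * lg / γ := by ring
      _ ≤ _ := by gcongr; norm_num
  have h3 : 256 * H * (K + Cstar) * lg / γ =
      256 * H * K * lg / γ + 256 * H * Cstar * lg / γ := by ring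
  rw [h3]
  linarith

theorem hyGlowSucceeds_of_riskUnif_le {πstar : DetPolicy X A H} {γ ε δ : ℝ} (hδ : 0 ≤ δ)
    (h : ∀ f : Fin T → ValueFn X A H, (∀ t, f t ∈ F) →
      M.riskUnif πstar (fun t => greedy (f t)) ≤ ε) :
    HyGlowSucceeds.{v} M ν F W greedy πstar T γ ε δ := by
  intro Ω _ Pr _ off f on run
  have : {ω | M.riskUnif πstar (fun t => greedy (f t ω)) ≤ ε} = Set.univ :=
    Set.eq_univ_of_forall fun ω => h _ fun t => (run.f_mabo t ω).1
  rw [this, measure_univ, ENNReal.ofReal_le_one]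
  have : 0 ≤ δ * T := by positivity
  linarith

/-- A run succeeds once its regret bound on the good events is at most `T ε`. -/
theorem hyGlowSucceeds_of_regret_le (hM : M.NormalizedRewards)
    (hF : ∀ f ∈ F, ∀ h x a, f h x a ∈ Set.Icc (0 : ℝ) 1) (hgr : IsGreedyRule F greedy)
    {πstar : DetPolicy X A H} (hstar : πstar ∈ policyClass F greedy) {Cstar : ℝ}
    (hC : M.SinglePolicyConcentrability πstar ν Cstar) (hC0 : 0 ≤ Cstar) (hH : 1 ≤ H)
    {D : ℝ} (hD : 0 ≤ D) (htest : M.Testable ν F W (policyClass F greedy) T D)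
    {γ β ε δ : ℝ} (hγ : 0 < γ) (hγ1 : γ ≤ 1) (hβ : 0 ≤ β) (hδ : 0 < δ) (hT : 0 < T)
    (hβδ : (F.card * W.card * H * 4 : ℕ) * Real.exp (-β) ≤ δ)
    (hε : 72 * D * γ * β * T + 256 * H *
        ((M.coverability (policyClass F greedy)).toReal + Cstar) * Real.log (T + 1) / γ + 1 ≤
          T * ε) :
    HyGlowSucceeds.{v} M ν F W greedy πstar T γ ε δ := by
  classical
  intro Ω _ Pr _ off f on run
  set bad : Set Ω := ⋃ t ∈ Finset.univ.filter (fun t : Fin T => 0 < (t : ℕ)),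
    {ω | ¬ M.GoodRound ν F W (fun i h => off i h ω) (fun i => on i ω)
      (fun i => greedy (f i ω)) t (γ * ((t : ℕ) + 1)) β} with hbad
  have hPbad : Pr bad ≤ ENNReal.ofReal (δ * T) := by
    refine (measure_biUnion_finset_le _ _).trans ?_
    calc _ ≤ ∑ _t ∈ Finset.univ.filter (fun t : Fin T => 0 < (t : ℕ)), ENNReal.ofReal δ := by
          refine Finset.sum_le_sum fun t ht => ?_
          refine (run.measure_not_good_le hF t (Finset.mem_filter.1 ht).2 (by positivity) β).trans ?_
          rw [← ENNReal.ofReal_natCast, ← ENNReal.ofReal_mul (Nat.cast_nonneg _)]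
          exact ENNReal.ofReal_le_ofReal hβδ
      _ ≤ ∑ _t : Fin T, ENNReal.ofReal δ :=
          Finset.sum_le_sum_of_subset (Finset.filter_subset _ _)
      _ = ENNReal.ofReal (δ * T) := by
          rw [Finset.sum_const, Finset.card_univ, Fintype.card_fin, nsmul_eq_mul, mul_comm,
            ENNReal.ofReal_mul hδ.le, ENNReal.ofReal_natCast]
  have hsub : badᶜ ⊆ {ω | M.riskUnif πstar (fun t => greedy (f t ω)) ≤ ε} := by
    intro ω hω
    have hG : ∀ t : Fin T, 0 < (t : ℕ) → M.GoodRound ν F W (fun i h => off i h ω)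
        (fun i => on i ω) (fun i => greedy (f i ω)) t (γ * ((t : ℕ) + 1)) β := by
      intro t ht
      by_contra hcon
      exact hω (Set.mem_biUnion (x := t) (by simpa using ht) hcon)
    have h1 := sum_regret_le hM hF hgr hstar hC hC0 hH hD htest hγ hγ1 hβ
      (fun t => run.f_mabo t ω) hG
    have hTR : (0 : ℝ) < T := by exact_mod_cast hT
    change M.riskUnif πstar (fun t => greedy (f t ω)) ≤ ε
    unfold MDP.riskUnif
    rw [div_le_iff₀ hTR]
    linarith
  have h1 : (1 : ℝ≥0∞) ≤ Pr {ω | M.riskUnif πstar (fun t => greedy (f t ω)) ≤ ε} +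
      ENNReal.ofReal (δ * T) := by
    calc (1 : ℝ≥0∞) = Pr Set.univ := measure_univ.symm
      _ ≤ Pr ({ω | M.riskUnif πstar (fun t => greedy (f t ω)) ≤ ε} ∪ bad) := by
          refine measure_mono fun ω _ => ?_
          by_cases hω : ω ∈ bad
          · exact Or.inr hω
          · exact Or.inl (hsub hω)
      _ ≤ _ := (measure_union_le _ _).trans (add_le_add le_rfl hPbad)
  rw [ENNReal.ofReal_sub _ (by positivity), ENNReal.ofReal_one]
  exact tsub_le_iff_right.2 h1

end RunRegret

/-! ### Tuning -/

/-- The number of rounds and the clipping scale balance the two terms of the regret bound. Here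
`D` is `H` under joint and `H ^ 2` under layerwise realizability. -/
theorem tuning {N D C L ε T ℓ β γ : ℝ} (hN : 1 ≤ N) (hND : N ≤ D) (hDN : D ≤ N ^ 2) (hC : 2 ≤ C)
    (hL : Real.log 2 ≤ L) (hε : 0 < ε) (hε1 : ε ≤ 1)
    (hℓ : ℓ = Real.log (Real.exp 1 + N * C * L / ε))
    (hT : 1073741824 * (D ^ 2 * C / ε ^ 2 * L) * ℓ ^ 2 ≤ T)
    (hT' : T ≤ 1073741824 * (D ^ 2 * C / ε ^ 2 * L) * ℓ ^ 2 + 1)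
    (hβ : β = Real.log (4 * N) + L) (hγ : γ = N / D * Real.sqrt (C / (T * L))) :
    0 < γ ∧ γ ≤ 1 ∧
      72 * D * γ * β * T + 256 * N * C * Real.log (T + 1) / γ + 1 ≤ T * ε := by
  have hlog2 : 0.6931471803 < Real.log 2 := Real.log_two_gt_d9
  have hlog2' : Real.log 2 < 0.6931471808 := Real.log_two_lt_d9
  have hL0 : 1 / 2 < L := by linarith
  have hLpos : 0 < L := by linarith
  have hCpos : 0 < C := by linarith
  have hNpos : 0 < N := by linarith
  have hDpos : 0 < D := by linarith
  have hD1 : 1 ≤ D := by linarith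
  have hCL : 1 ≤ C * L := by
    calc (1 : ℝ) = 2 * (1 / 2) := by norm_num
      _ ≤ C * L := mul_le_mul hC hL0.le (by norm_num) hCpos.le
  -- `y = C L / ε ≥ 1` and `u = N y`
  set y := C * L / ε with hy
  have hy1 : 1 ≤ y := by rw [hy, le_div_iff₀ hε]; linarith
  have hu : N * C * L / ε = N * y := by rw [hy]; ring
  rw [hu] at hℓ
  set w := Real.exp 1 + N * y with hw
  have he : 2 < Real.exp 1 := by linarith [Real.exp_one_gt_d9]
  have hNy : N ≤ N * y := le_mul_of_one_le_right hNpos.le hy1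
  have hw1 : 1 ≤ w := by linarith
  have hwpos : 0 < w := by linarith
  have hℓ1 : 1 ≤ ℓ := by
    rw [hℓ]
    calc (1 : ℝ) = Real.log (Real.exp 1) := (Real.log_exp 1).symm
      _ ≤ _ := Real.log_le_log (Real.exp_pos 1) (by linarith)
  have hℓpos : 0 < ℓ := by linarith
  have hℓw : ℓ ≤ w := by rw [hℓ]; linarith [Real.log_le_sub_one_of_pos hwpos]
  set B := D ^ 2 * C / ε ^ 2 * L with hB
  have hB' : B = D ^ 2 * (C * L) / ε ^ 2 := by rw [hB]; ring
  have hBpos : 0 < B := by positivity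
  have hBCL : C * L ≤ B := by
    rw [hB', le_div_iff₀ (by positivity)]
    have h1 : ε ^ 2 ≤ 1 := pow_le_one₀ hε.le hε1
    have h2 : 1 ≤ D ^ 2 := one_le_pow₀ hD1
    calc C * L * ε ^ 2 ≤ C * L * 1 := by gcongr
      _ = 1 * (C * L) := by ring
      _ ≤ D ^ 2 * (C * L) := by gcongr
  have hTpos : 0 < T := lt_of_lt_of_le (by positivity) hT
  have hℓ2 : 1 ≤ ℓ ^ 2 := one_le_pow₀ hℓ1
  have hTB : 1073741824 * B ≤ T := (le_mul_of_one_le_right (by positivity) hℓ2).trans hT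
  -- the logarithm of the number of rounds
  have hlogT : Real.log (T + 1) ≤ 28 * ℓ := by
    have hBw : B ≤ w ^ 4 := by
      have h1 : D ^ 2 ≤ N ^ 4 := by
        calc D ^ 2 ≤ (N ^ 2) ^ 2 := by gcongr
          _ = N ^ 4 := by ring
      have h2 : C * L / ε ^ 2 ≤ y ^ 4 := by
        have h3 : C * L / ε ^ 2 ≤ y ^ 2 := by
          rw [hy, div_pow]; gcongr; exact le_self_pow₀ hCL two_ne_zero
        have h4 : y ^ 2 ≤ y ^ 4 := pow_le_pow_right₀ hy1 (by norm_num)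
        linarith
      calc B = D ^ 2 * (C * L / ε ^ 2) := by rw [hB']; ring
        _ ≤ N ^ 4 * y ^ 4 := by gcongr
        _ = (N * y) ^ 4 := by ring
        _ ≤ w ^ 4 := by gcongr; linarith
    have hT1 : T + 1 ≤ 2147483648 * w ^ 6 := by
      have h1 : B * ℓ ^ 2 ≤ w ^ 4 * w ^ 2 := by gcongr
      have h2 : 1 ≤ w ^ 6 := one_le_pow₀ hw1
      have h3 : w ^ 4 * w ^ 2 = w ^ 6 := by ring
      rw [h3] at h1
      linarith
    calc Real.log (T + 1) ≤ Real.log (2147483648 * w ^ 6) := Real.log_le_log (by linarith) hT1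
      _ = 31 * Real.log 2 + 6 * ℓ := by
          rw [Real.log_mul (by norm_num) (by positivity), Real.log_pow,
            show (2147483648 : ℝ) = 2 ^ 31 by norm_num, Real.log_pow, hℓ]
          norm_num
      _ ≤ 28 * ℓ := by linarith
  have hlogT0 : Real.log 2 ≤ Real.log (T + 1) := by
    refine Real.log_le_log (by norm_num) ?_
    linarith
  -- the union bound costs a factor `ℓ` in `β`
  have hβℓ : β ≤ 6 * ℓ * L := by
    have h1 : Real.log (4 * N) = 2 * Real.log 2 + Real.log N := by
      rw [Real.log_mul (by norm_num) hNpos.ne', show (4 : ℝ) = 2 ^ 2 by norm_num, Real.log_pow]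
      norm_num
    have h2 : Real.log N ≤ ℓ := by rw [hℓ]; exact Real.log_le_log hNpos (by linarith)
    have h3 : L ≤ ℓ * L := le_mul_of_one_le_left hLpos.le hℓ1
    have h4 : ℓ ≤ ℓ * (2 * L) := le_mul_of_one_le_right hℓpos.le (by linarith)
    rw [hβ, h1]; linarith
  set s := Real.sqrt (C * L / T) with hs
  have hspos : 0 < s := Real.sqrt_pos.2 (by positivity)
  have hs2 : s ^ 2 = C * L / T := Real.sq_sqrt (by positivity)
  have hsL : Real.sqrt (C / (T * L)) = s / L := by
    rw [hs, Real.sqrt_eq_iff_eq_sq (by positivity) (by positivity), div_pow,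
      Real.sq_sqrt (by positivity)]
    field_simp
  rw [hsL] at hγ
  have hγpos : 0 < γ := by rw [hγ]; positivity
  have hγ1 : γ ≤ 1 := by
    have h1 : N / D ≤ 1 := (div_le_one hDpos).2 hND
    have h2 : s ≤ L := by
      rw [hs, Real.sqrt_le_left hLpos.le, div_le_iff₀ hTpos]
      have h3 : C * L ≤ (1 / 2) ^ 2 * (1073741824 * B) := by linarith
      calc C * L ≤ (1 / 2) ^ 2 * (1073741824 * B) := h3
        _ ≤ L ^ 2 * T := by gcongr
    have h3 : s / L ≤ 1 := (div_le_one hLpos).2 h2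
    rw [hγ]
    calc _ ≤ 1 * 1 := mul_le_mul h1 h3 (by positivity) zero_le_one
      _ = 1 := one_mul 1
  refine ⟨hγpos, hγ1, ?_⟩
  have hDs : 32768 * ℓ * (D * s) ≤ ε := by
    refine le_of_sq_le_sq ?_ hε.le
    rw [mul_pow, mul_pow, mul_pow, hs2, ← mul_div_assoc, ← mul_div_assoc, div_le_iff₀ hTpos]
    calc 32768 ^ 2 * ℓ ^ 2 * (D ^ 2 * (C * L)) = ε ^ 2 * (1073741824 * B * ℓ ^ 2) := by
          rw [hB']; field_simp; norm_num
      _ ≤ ε ^ 2 * T := by gcongr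
  have hDγ : D * γ = N * (s / L) := by rw [hγ]; field_simp
  have hCγ : N * C / γ = D * s * T := by
    rw [hγ, div_eq_iff (by positivity)]
    have : s * s = C * L / T := by rw [← hs2]; ring
    calc N * C = N * (C * L / T) * T / L := by field_simp
      _ = N * (s * s) * T / L := by rw [this]
      _ = _ := by field_simp
  have h1 : 72 * D * γ * β * T ≤ 432 * ℓ * (D * s) * T := by
    have : D * γ * β ≤ 6 * ℓ * (D * s) := by
      rw [hDγ]
      calc N * (s / L) * β ≤ D * (s / L) * (6 * ℓ * L) := by
            have : 0 ≤ β := by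
              rw [hβ]; linarith [Real.log_nonneg (by linarith : 1 ≤ 4 * N)]
            gcongr
        _ = 6 * ℓ * (D * s) := by field_simp
    calc 72 * D * γ * β * T = 72 * (D * γ * β) * T := by ring
      _ ≤ 72 * (6 * ℓ * (D * s)) * T := by gcongr
      _ = _ := by ring
  have h2 : 256 * N * C * Real.log (T + 1) / γ = 256 * (D * s * T) * Real.log (T + 1) := by
    rw [← hCγ]; ring
  have h3 : (1 : ℝ) ≤ 2 * (D * s * T) * Real.log (T + 1) := by
    have h4 : 2 ≤ D * s * T := by
      rw [← hCγ, le_div_iff₀ hγpos]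
      linarith [le_mul_of_one_le_left hCpos.le hN]
    calc (1 : ℝ) ≤ 2 * 2 * Real.log 2 := by linarith
      _ ≤ 2 * (D * s * T) * Real.log (T + 1) := by gcongr
  have h5 : 258 * (D * s * T) * Real.log (T + 1) ≤ 258 * (D * s * T) * (28 * ℓ) := by
    gcongr
  rw [h2]
  have h6 : T * (32768 * ℓ * (D * s)) ≤ T * ε := by gcongr
  have h7 : 0 ≤ ℓ * (D * s) * T := by positivity
  linarith

section Main

variable {X A : Type*} [MeasurableSpace X] [MeasurableSpace A] [DiscreteMeasurableSpace X]
  [Countable X] [DiscreteMeasurableSpace A] [Countable A] {H T : ℕ}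
  {M : MDP X A H} {ν : Fin H → ProbabilityMeasure (X × A)}
  {F : Finset (ValueFn X A H)} {W : Finset (WeightFn X A H)}
  {greedy : ValueFn X A H → DetPolicy X A H}

theorem MDP.SinglePolicyConcentrability.one_le {π : DetPolicy X A H} {Cstar : ℝ}
    (hC : M.SinglePolicyConcentrability π ν Cstar) (h : Fin H) : 1 ≤ Cstar := by
  have h1 : 1 ≤ (ENNReal.ofReal Cstar).toReal := by
    refine one_le_of_forall_le_mul (μ₁ := M.occ π.toPolicy h) (μ₂ := (ν h : Measure (X × A)))
      fun z => ?_
    have h2 := ENNReal.toReal_mono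
      (ENNReal.mul_ne_top ENNReal.ofReal_ne_top (measure_ne_top _ _))
      (mul_of_ratio_le ENNReal.ofReal_ne_top (measure_ne_top _ _) (hC h z))
    rwa [ENNReal.toReal_mul] at h2
  rw [ENNReal.toReal_ofReal', le_max_iff] at h1
  rcases h1 with h1 | h1
  · exact h1
  · linarith

/-- The tuned algorithm succeeds, whatever the kind of realizability. A single value function, or
an accuracy `ε ≥ 1`, leaves nothing to prove; otherwise `L ≥ log 2`, as `tuning` needs. -/
theorem hyGlowSucceeds_of_testable (hM : M.NormalizedRewards)
    (hF : ∀ f ∈ F, ∀ h x a, f h x a ∈ Set.Icc (0 : ℝ) 1) (hW : W.Nonempty)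
    (hgr : IsGreedyRule F greedy) {πstar : DetPolicy X A H}
    (hstar : πstar ∈ policyClass F greedy) {Cstar : ℝ}
    (hC : M.SinglePolicyConcentrability πstar ν Cstar) (hH : 1 ≤ H) {ε δ : ℝ} (hε : 0 < ε)
    (hδ : 0 < δ) (hδ1 : δ < 1) {C L D γ : ℝ}
    (hCdef : C = (M.coverability (policyClass F greedy)).toReal + Cstar)
    (hLdef : L = Real.log (F.card * W.card / δ)) (hHD : H ≤ D) (hDH : D ≤ (H : ℝ) ^ 2)
    (hT : T = ⌈(1073741824 : ℝ) * (D ^ 2 * C / ε ^ 2 * L) * logFactor H C L ε ^ 2⌉₊)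
    (hγ : γ = H / D * Real.sqrt (C / (T * L)))
    (htest : M.Testable ν F W (policyClass F greedy) T D) :
    HyGlowSucceeds.{v} M ν F W greedy πstar T γ ε δ := by
  obtain ⟨fstar, hfstar, hfs⟩ := hstar
  have hfstar' : fstar ∈ F := hfstar
  rcases le_or_gt F.card 1 with hF1 | hF2
  · refine hyGlowSucceeds_of_riskUnif_le hδ.le fun f hf => ?_
    have : ∀ t, greedy (f t) = πstar := fun t => by
      rw [← hfs, Finset.card_le_one.1 hF1 _ (hf t) _ hfstar']
    simp only [MDP.riskUnif, this, sub_self, Finset.sum_const_zero, zero_div]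
    exact hε.le
  rcases le_or_gt 1 ε with hε1 | hε1
  · refine hyGlowSucceeds_of_riskUnif_le hδ.le fun f hf => le_trans ?_ hε1
    unfold MDP.riskUnif
    refine div_le_one_of_le₀ ?_ (Nat.cast_nonneg _)
    calc _ ≤ ∑ _t : Fin T, (1 : ℝ) := Finset.sum_le_sum fun t _ => by
          have h1 := M.J_mem hM πstar.toPolicy
          have h2 := M.J_mem hM (greedy (f t)).toPolicy
          linarith [h1.2, h2.1]
      _ = T := by simp
  have hstar : πstar ∈ policyClass F greedy := ⟨fstar, hfstar, hfs⟩
  have hCs := hC.one_le ⟨0, hH⟩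
  have hCcov : 1 ≤ (M.coverability (policyClass F greedy)).toReal := by
    rw [← ENNReal.toReal_one]
    exact ENNReal.toReal_mono (M.coverability_ne_top (F.finite_toSet.image greedy) ⟨_, hstar⟩)
      (M.one_le_coverability ⟨_, hstar⟩ ⟨0, hH⟩)
  have hC2 : 2 ≤ C := by rw [hCdef]; linarith
  have hHR : (1 : ℝ) ≤ H := by exact_mod_cast hH
  have hFR : (2 : ℝ) ≤ F.card := by exact_mod_cast hF2
  have hWR : (1 : ℝ) ≤ W.card := by exact_mod_cast hW.card_pos
  have hFW : (2 : ℝ) ≤ F.card * W.card := by nlinarith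
  have hL2 : Real.log 2 ≤ L := by
    rw [hLdef]
    refine Real.log_le_log (by norm_num) ?_
    rw [le_div_iff₀ hδ]; linarith
  have hLpos : 0 < L := lt_of_lt_of_le (Real.log_pos (by norm_num)) hL2
  have hDpos : 0 < D := by linarith
  have hlf : 0 < logFactor H C L ε := by
    refine Real.log_pos ?_
    have h1 : 0 ≤ H * C * L / ε := by positivity
    linarith [Real.exp_one_gt_d9]
  have hxpos : 0 < (1073741824 : ℝ) * (D ^ 2 * C / ε ^ 2 * L) * logFactor H C L ε ^ 2 := by
    positivity
  have hTle : (1073741824 : ℝ) * (D ^ 2 * C / ε ^ 2 * L) * logFactor H C L ε ^ 2 ≤ T := by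
    rw [hT]; exact Nat.le_ceil _
  have hTge : (T : ℝ) ≤ 1073741824 * (D ^ 2 * C / ε ^ 2 * L) * logFactor H C L ε ^ 2 + 1 := by
    rw [hT]; exact (Nat.ceil_lt_add_one hxpos.le).le
  obtain ⟨hγ0, hγ1, hfin⟩ := tuning (β := Real.log (4 * H) + L) hHR hHD hDH hC2 hL2 hε hε1.le rfl
    hTle hTge rfl hγ
  have hT0 : 0 < T := by rw [hT]; exact Nat.ceil_pos.2 hxpos
  refine hyGlowSucceeds_of_regret_le hM hF hgr hstar hC (by linarith) hH hDpos.le htest hγ0 hγ1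
    (β := Real.log (4 * H) + L) ?_ hδ hT0 ?_ ?_
  · have := Real.log_nonneg (by linarith : (1 : ℝ) ≤ 4 * H)
    linarith
  · rw [hLdef, ← Real.log_mul (by positivity) (by positivity), ← Real.log_inv,
      Real.exp_log (by positivity)]
    push_cast
    refine le_of_eq ?_
    field_simp
  · rw [← hCdef]; exact hfin

end Main

end

end HybridRL

theorem mainTheorem5 :
    ∃ (c : ℝ) (p : ℕ), 0 < c ∧
      ∀ (X : Type u₁) (A : Type u₂) [Countable X] [Countable A]
        [MeasurableSpace X] [MeasurableSpace A]
        [DiscreteMeasurableSpace X] [DiscreteMeasurableSpace A]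
        (H : ℕ) (_ : 1 ≤ H) (M : HybridRL.MDP X A H) (_ : M.NormalizedRewards)
        (F : Finset (HybridRL.ValueFn X A H))
        (_ : ∀ f ∈ F, ∀ h x a, f h x a ∈ Set.Icc (0 : ℝ) 1)
        (W : Finset (HybridRL.WeightFn X A H)) (_ : W.Nonempty)
        (greedy : HybridRL.ValueFn X A H → HybridRL.DetPolicy X A H)
        (_ : HybridRL.IsGreedyRule F greedy)
        (πstar : HybridRL.DetPolicy X A H) (_ : M.IsOptimal πstar.toPolicy)
        (_ : πstar ∈ HybridRL.policyClass F greedy)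
        (_ : M.Q πstar.toPolicy ∈ F)
        (ν : Fin H → MeasureTheory.ProbabilityMeasure (X × A)) (Cstar : ℝ)
        (_ : M.SinglePolicyConcentrability πstar ν Cstar)
        (ε δ : ℝ) (_ : 0 < ε) (_ : 0 < δ) (_ : δ < 1)
        (C : ℝ) (_ : C = (M.coverability (HybridRL.policyClass F greedy)).toReal + Cstar)
        (L : ℝ) (_ : L = Real.log (F.card * W.card / δ)),
        -- the tuning `T = Θ̃(H⁴ C L / ε²)`, `γ = √(C / (T H² L))`
        (∀ (T : ℕ) (γ : ℝ),
          T = ⌈c * ((H : ℝ) ^ 4 * C / ε ^ 2 * L) * HybridRL.logFactor H C L ε ^ p⌉₊ →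
          γ = Real.sqrt (C / (T * (H : ℝ) ^ 2 * L)) →
          M.RatioRealizableLayerwise ν (HybridRL.policyClass F greedy) W T →
          HybridRL.HyGlowSucceeds.{v} M ν F W greedy πstar T γ ε δ) ∧
        -- the trajectory bound `T = Õ(H² C L / ε²)`, reached with `γ = √(C / (T L))`
        (∀ (T : ℕ) (γ : ℝ),
          T = ⌈c * ((H : ℝ) ^ 2 * C / ε ^ 2 * L) * HybridRL.logFactor H C L ε ^ p⌉₊ →
          γ = Real.sqrt (C / (T * L)) →
          M.RatioRealizable ν (HybridRL.policyClass F greedy) W T →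
          HybridRL.HyGlowSucceeds.{v} M ν F W greedy πstar T γ ε δ) := by
  refine ⟨1073741824, 2, by norm_num, ?_⟩
  intro X A _ _ _ _ _ _ H hH M hM F hF W hW greedy hgr πstar hopt hstar hQF ν Cstar hC ε δ hε hδ
    hδ1 C hCdef L hL
  have hHR : (1 : ℝ) ≤ H := by exact_mod_cast hH
  have hHsq : (H : ℝ) ≤ (H : ℝ) ^ 2 := le_self_pow₀ hHR two_ne_zero
  have hQ := hopt.bellmanErr_Q
  constructor
  · intro T γ hT hγ hreal
    refine HybridRL.hyGlowSucceeds_of_testable hM hF hW hgr hstar hC hH hε hδ hδ1 hCdef hL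
      (D := (H : ℝ) ^ 2) hHsq le_rfl ?_ ?_ (hreal.testable hF hQF hQ)
    · rw [hT, ← pow_mul]
    · have e : C / (T * (H : ℝ) ^ 2 * L) = C / (T * L) / (H : ℝ) ^ 2 := by
        rw [div_div]; congr 1; ring
      rw [hγ, e, Real.sqrt_div' _ (by positivity), Real.sqrt_sq (by linarith)]
      field_simp
  · intro T γ hT hγ hreal
    refine HybridRL.hyGlowSucceeds_of_testable hM hF hW hgr hstar hC hH hε hδ hδ1 hCdef hL
      (D := (H : ℝ)) le_rfl hHsq hT ?_ (hreal.testable hF hQF hQ)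
    rw [hγ, div_self (by linarith), one_mul]
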